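/- For $n\ge 1$ let $V_n=\{0,1\}^n$, and let $Q_n$ be the $n$-dimensional hypercube, i.e. the graph with vertex set $V_n$ in which two vectors are adjacent when they differ in exactly one coordinate. The parity of $\alpha\in V_n$ is $\chi(\alpha)=\prod_{i}(-1)^{\alpha(i)}$. A \emph{pair} is a multiset $\{\alpha,\beta\}$ of two (possibly equal) vertices of $Q_n$; it is \emph{odd} if $\chi(\alpha)\neq\chi(\beta)$, and an \emph{edge-pair} if it is an edge of $Q_n$. A \emph{pair-set} in $Q_n$ is a set $A$ of pairs such that distinct pairs of $A$ are disjoint and, if $A\ne\emptyset$, at least one pair of $A$ consists of two distinct vertices. Write $\bigcup A$ for the set of vertices occurring in the pairs of $A$, and $\mathrm{enc}(A)$ for the set of vertices $\alpha\notin\bigcup A$ all of whose neighbours in $Q_n$ belong to $\bigcup A$. A pair-set $A$ in $Q_n$, all of whose pairs are odd, is \emph{diminishable} if one of the following holds: (a) $|A|\le n-1$ and, if $n=4$, then either $A$ contains an edge-pair or there is no set $X$ with $\bigcup A\subseteq X\subseteq V_4$ such that the subgraph of $Q_4$ induced by $X$ is isomorphic to $Q_3$; (b) $|A|=n$, $n\neq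 4$, $A$ contains at least two edge-pairs, and $\mathrm{enc}(A)=\emptyset$. A pair-set $A$ is \emph{connectable} if there is a family $\{P_{\alpha,\beta} : \{\alpha,\beta\}\in A\}$ of vertex-disjoint paths in $Q_n$ such that $P_{\alpha,\beta}$ is a path between $\alpha$ and $\beta$ and every vertex of $Q_n$ lies on exactly one of these paths. \textbf{Theorem.} Every non-empty diminishable pair-set in $Q_5$ is connectable. -/

import Mathlib

namespace Hypercube

/-- The set `V n` of all `n`-dimensional `(0,1)`-vectors. -/
abbrev V (n : ℕ) : Type := Fin n → Bool

/-- Coordinatewise sum modulo two of two vectors. -/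
def vxor {n : ℕ} (α β : V n) : V n := fun i => xor (α i) (β i)

/-- The vector `e i` whose only nonzero coordinate is the `i`-th one. -/
def e {n : ℕ} (i : Fin n) : V n := fun j => decide (i = j)

/-- The `n`-dimensional hypercube: `α` and `β` are adjacent when `α ⊕ β = e i` for some `i`. -/
def Q (n : ℕ) : SimpleGraph (V n) where
  Adj α β := ∃ i : Fin n, vxor α β = e i
  symm := ⟨by
    rintro α β ⟨i, hi⟩
    refine ⟨i, ?_⟩
    rw [← hi]
    funext j
    exact Bool.xor_comm _ _⟩
  loopless := ⟨by
    rintro α ⟨i, hi⟩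
    have h := congrFun hi i
    simp [vxor, e] at h⟩

/-- The parity `χ α = ∏ i, (-1) ^ α i` of a vector. -/
def parity {n : ℕ} (α : V n) : ℤ := ∏ i : Fin n, (-1 : ℤ) ^ (α i).toNat

/-- A pair (an unordered pair, possibly with two equal entries) is odd if its two entries have
different parities. -/
def IsOddPair {n : ℕ} (p : Sym2 (V n)) : Prop :=
  ∃ α β : V n, p = s(α, β) ∧ parity α ≠ parity β

/-- A pair is an edge-pair if it is an edge of the hypercube. -/
def IsEdgePair {n : ℕ} (p : Sym2 (V n)) : Prop := p ∈ (Q n).edgeSet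

/-- A pair-set: distinct pairs are disjoint, and a nonempty pair-set contains a pair with
two different entries. -/
def IsPairSet {n : ℕ} (A : Finset (Sym2 (V n))) : Prop :=
  (∀ p ∈ A, ∀ q ∈ A, p ≠ q → ∀ α : V n, ¬ (α ∈ p ∧ α ∈ q)) ∧
  (A.Nonempty → ∃ p ∈ A, ¬ p.IsDiag)

/-- The set of all vertices that occur in some pair of `A`. -/
def verts {n : ℕ} (A : Finset (Sym2 (V n))) : Set (V n) := {α | ∃ p ∈ A, α ∈ p}

/-- The vertices encompassed by `X`, i.e. those all of whose neighbours belong to `X`. -/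
def encClosed {n : ℕ} (X : Set (V n)) : Set (V n) := {α | ∀ β : V n, (Q n).Adj α β → β ∈ X}

/-- The vertices outside `X` that are encompassed by `X`. -/
def enc {n : ℕ} (X : Set (V n)) : Set (V n) := encClosed X \ X

/-- An odd pair-set is a pair-set all of whose pairs are odd. -/
def IsOddPairSet {n : ℕ} (A : Finset (Sym2 (V n))) : Prop :=
  IsPairSet A ∧ ∀ p ∈ A, IsOddPair p

/-- Diminishable pair-sets. -/
def IsDiminishable {n : ℕ} (A : Finset (Sym2 (V n))) : Prop :=
  IsOddPairSet A ∧
  ((A.card + 1 ≤ n ∧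
      (n = 4 →
        (∃ p ∈ A, IsEdgePair p) ∨
        ¬ ∃ X : Set (V n), verts A ⊆ X ∧ Nonempty ((Q n).induce X ≃g Q 3))) ∨
   (A.card = n ∧ n ≠ 4 ∧
      (∃ p ∈ A, ∃ q ∈ A, p ≠ q ∧ IsEdgePair p ∧ IsEdgePair q) ∧
      enc (verts A) = ∅))

/-- A connector of `A`: for every pair of `A` a path between the two entries of that pair, such
that the paths are vertex-disjoint and every vertex of the hypercube lies on exactly one of
them. -/
structure Connector {n : ℕ} (A : Finset (Sym2 (V n))) where
  /-- first end of the path of a pair -/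
  src : {p // p ∈ A} → V n
  /-- second end of the path of a pair -/
  dst : {p // p ∈ A} → V n
  ends : ∀ p : {p // p ∈ A}, s(src p, dst p) = p.1
  path : ∀ p : {p // p ∈ A}, (Q n).Path (src p) (dst p)
  disjoint : ∀ p q : {p // p ∈ A}, p ≠ q → ∀ γ : V n,
    ¬ (γ ∈ (path p).1.support ∧ γ ∈ (path q).1.support)
  cover : ∀ γ : V n, ∃! p : {p // p ∈ A}, γ ∈ (path p).1.support

/-- Connectable pair-sets. -/
def IsConnectable {n : ℕ} (A : Finset (Sym2 (V n))) : Prop :=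
  IsPairSet A ∧ Nonempty (Connector A)

end Hypercube

/-!
Every pair is odd, so a diminishable pair-set in `Q 5` consists either of at most four disjoint odd
pairs, or of five disjoint odd pairs, at least two of which are edges, that do not enclose a vertex.
Vectors are encoded by natural numbers below `32`, and `Linked n L` says that `Q n` is partitioned
into paths whose pairs of ends are the entries of the list `L`.

The basic construction is gluing (`Linked.glue`). A coordinate cuts `Q 5` into two copies of `Q 4`.
A pair `{a, b}` with entries in different halves is replaced by `{a, u}` in one half and by `{u, b}`
in the other, for a crossing vertex `u`; path systems of the two halves are then joined at the
crossing vertices. The path systems of `Q 4` with an edge among four pairs are recorded in `table4`,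
which the kernel recomputes from explicit systems; from this, one, two or three pairs in `Q 4` are
treated by splitting pairs (`linked_edge_two`, `linked_two`, `linked_three`).

For five pairs with two edges, four distributions of the pairs over the two halves always permit
gluing (`linked_join_three_two`, `linked_join_two_two`, `linked_join_three_one`,
`linked_join_two_one`); the hypothesis that no vertex is enclosed is used for the last two. If none
of the five coordinates gives such a distribution, the pairs are found by a search: the two edges
are brought into one of seven positions by an automorphism, the remaining three pairs are enumerated
up to the symmetries that preserve the edges, and for each of the triples not covered by the
previous argument the kernel glues suitable path systems of `Q 4`, or looks up one of a few explicit
path systems of `Q 5`. This gives `linked_of_two_edges`.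

For four pairs, one of them an edge, another pair `{a, b}` is split into an edge `{a, u}` and a pair
`{v, b}`, where `u` and `v` are adjacent; by a count of neighbours this is possible without
enclosing a vertex (`exists_split`). If there is no edge, either some pair has distance three, and a
search shows that it can be split into two edges or that gluing works directly, or all pairs are
antipodal, and gluing works directly (`linked_four`). Smaller sets of pairs are split until there
are four (`linked_of_length_le_four`).
-/

namespace Hypercube

/-! ### Path systems on vertex codes -/

/-- A pair of vertices, each vertex of the cube `Q n` being encoded by a natural number below
`2 ^ n` whose binary digits are the coordinates. -/
abbrev Pair := ℕ × ℕ

/-- Two codes are adjacent when they differ in exactly one binary digit. -/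
def Adj (a b : ℕ) : Prop := ∃ i, a ^^^ b = 2 ^ i

theorem Adj.symm {a b : ℕ} (h : Adj a b) : Adj b a := by
  obtain ⟨i, hi⟩ := h
  exact ⟨i, by rw [Nat.xor_comm, hi]⟩

/-- First and last entry of a list. -/
def ends : List ℕ → Pair
  | [] => (0, 0)
  | a :: t => (a, t.getLastD a)

theorem ends_eq {l : List ℕ} (h : l ≠ []) : ends l = (l.head h, l.getLast h) := by
  cases l with
  | nil => exact absurd rfl h
  | cons a t => simp [ends, List.getLast_eq_getLastD]

/-- `Linked n L`: the vertices of `Q n` can be partitioned into paths whose pairs of ends are the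
entries of `L`, in this order. -/
def Linked (n : ℕ) (L : List Pair) : Prop :=
  ∃ P : List (List ℕ), (∀ l ∈ P, l ≠ [] ∧ l.IsChain Adj) ∧ P.flatten.Perm (List.range (2 ^ n)) ∧
    P.map ends = L

theorem forall₂_ends {L : List Pair} {P : List (List ℕ)} :
    List.Forall₂ (fun p l => p = ends l) L P ↔ P.map ends = L := by
  rw [← List.forall₂_map_right_iff, List.forall₂_eq_eq_eq, eq_comm]

theorem Linked.perm {n : ℕ} {L M : List Pair} (h : L.Perm M) (hL : Linked n L) : Linked n M := by
  obtain ⟨P, hP, hr, hends⟩ := hL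
  obtain ⟨P', hMP, hPP⟩ := List.perm_comp_forall₂ h.symm (forall₂_ends.2 hends)
  exact ⟨P', fun l hl => hP l (hPP.subset hl), hPP.flatten.trans hr, forall₂_ends.1 hMP⟩

/-- Two ordered pairs with the same entries. -/
def SameEnds (p q : Pair) : Prop := q = p ∨ q = (p.2, p.1)

theorem SameEnds.refl (p : Pair) : SameEnds p p := Or.inl rfl

theorem SameEnds.symm {p q : Pair} (h : SameEnds p q) : SameEnds q p := by
  rcases h with h | h
  · exact Or.inl h.symm
  · exact Or.inr (by rw [h])

/-- The order of the two entries of a pair does not matter, since a path can be reversed. -/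
theorem Linked.congr {n : ℕ} {L M : List Pair} (h : List.Forall₂ SameEnds L M)
    (hL : Linked n L) : Linked n M := by
  obtain ⟨P, hP, hr, rfl⟩ := hL
  suffices H : ∃ P' : List (List ℕ), (∀ l ∈ P', l ≠ [] ∧ l.IsChain Adj) ∧
      P'.flatten.Perm P.flatten ∧ P'.map ends = M from by
    obtain ⟨P', h1, h2, h3⟩ := H
    exact ⟨P', h1, h2.trans hr, h3⟩
  clear hr
  induction P generalizing M with
  | nil =>
    cases h
    exact ⟨[], by simp, by simp, rfl⟩
  | cons l P ih =>
    rw [List.map_cons] at h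
    obtain _ | ⟨hab, hrest⟩ := h
    obtain ⟨P', h1, h2, h3⟩ := ih (fun l hl => hP l (List.mem_cons_of_mem _ hl)) hrest
    obtain ⟨hne, hch⟩ := hP l List.mem_cons_self
    rcases hab with rfl | rfl
    · refine ⟨l :: P', ?_, by simpa using h2.append_left l, by rw [List.map_cons, h3]⟩
      simp only [List.mem_cons, forall_eq_or_imp]
      exact ⟨⟨hne, hch⟩, h1⟩
    · refine ⟨l.reverse :: P', ?_, ?_, ?_⟩
      · simp only [List.mem_cons, forall_eq_or_imp]
        refine ⟨⟨by simpa using hne, ?_⟩, h1⟩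
        rw [List.isChain_reverse]
        exact hch.imp fun _ _ hx => hx.symm
      · simp only [List.flatten_cons]
        exact (List.reverse_perm l).append h2
      · rw [List.map_cons, h3, ends_eq (by simpa using hne), ends_eq hne]
        simp

/-- The entries of the pairs of a list. -/
def vertsOf (L : List Pair) : List ℕ := L.flatMap fun p => [p.1, p.2]

theorem vertsOf_cons (p : Pair) (L : List Pair) : vertsOf (p :: L) = p.1 :: p.2 :: vertsOf L := rfl

theorem mem_vertsOf {L : List Pair} {v : ℕ} : v ∈ vertsOf L ↔ ∃ p ∈ L, v = p.1 ∨ v = p.2 := by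
  simp [vertsOf]

theorem vertsOf_append (L M : List Pair) : vertsOf (L ++ M) = vertsOf L ++ vertsOf M := by
  simp [vertsOf]

theorem vertsOf_perm {L M : List Pair} (h : L.Perm M) : (vertsOf L).Perm (vertsOf M) :=
  h.flatMap_right _

theorem vertsOf_congr {L M : List Pair} (h : List.Forall₂ SameEnds L M) :
    (vertsOf L).Perm (vertsOf M) := by
  induction h with
  | nil => exact List.Perm.refl _
  | cons hab _ ih =>
    rw [vertsOf_cons, vertsOf_cons]
    rcases hab with rfl | rfl
    · exact (ih.cons _).cons _
    · exact (List.Perm.swap _ _ _).trans ((ih.cons _).cons _)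

/-- If `u` and `v` are adjacent, a path from `a` to `u` and a path from `v` to `b` can be joined. -/
theorem Linked.merge {n : ℕ} {a u v b : ℕ} {L : List Pair} (huv : Adj u v)
    (h : Linked n ((a, u) :: (v, b) :: L)) : Linked n ((a, b) :: L) := by
  obtain ⟨P, hP, hr, hends⟩ := h
  obtain ⟨l₁, P₁, rfl, h1, hends⟩ := List.map_eq_cons_iff.1 hends
  obtain ⟨l₂, P₂, rfl, h2, rfl⟩ := List.map_eq_cons_iff.1 hends
  obtain ⟨n1, c1⟩ := hP l₁ (by simp)
  obtain ⟨n2, c2⟩ := hP l₂ (by simp)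
  rw [ends_eq n1, Prod.mk.injEq] at h1
  rw [ends_eq n2, Prod.mk.injEq] at h2
  refine ⟨(l₁ ++ l₂) :: P₂, ?_, ?_, ?_⟩
  · simp only [List.mem_cons, forall_eq_or_imp]
    refine ⟨⟨by simp [n1], ?_⟩, fun l hl => hP l (by simp [hl])⟩
    rw [List.isChain_append]
    refine ⟨c1, c2, ?_⟩
    rw [List.getLast?_eq_some_getLast n1, List.head?_eq_some_head n2, h1.2, h2.1]
    simpa using huv
  · simpa using hr
  · rw [List.map_cons, ends_eq (by simp [n1])]
    simp [List.head_append_of_ne_nil, List.getLast_append_of_ne_nil, n1, n2, h1.1, h2.2]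

theorem two_pow_add_xor {n a b : ℕ} (ha : a < 2 ^ n) (hb : b < 2 ^ n) :
    (2 ^ n + a) ^^^ (2 ^ n + b) = a ^^^ b := by
  rw [← Nat.mul_one (2 ^ n), Nat.two_pow_add_eq_or_of_lt ha, Nat.two_pow_add_eq_or_of_lt hb]
  refine Nat.eq_of_testBit_eq fun k => ?_
  simp only [Nat.testBit_xor, Nat.testBit_or, Nat.mul_one, Nat.testBit_two_pow]
  by_cases hk : n = k
  · subst hk
    simp [Nat.testBit_lt_two_pow ha, Nat.testBit_lt_two_pow hb]
  · simp [hk]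

theorem xor_two_pow_add {n a : ℕ} (ha : a < 2 ^ n) : a ^^^ (2 ^ n + a) = 2 ^ n := by
  rw [← Nat.mul_one (2 ^ n), Nat.two_pow_add_eq_or_of_lt ha]
  refine Nat.eq_of_testBit_eq fun k => ?_
  simp only [Nat.testBit_xor, Nat.testBit_or, Nat.mul_one, Nat.testBit_two_pow]
  by_cases hk : n = k
  · subst hk
    simp [Nat.testBit_lt_two_pow ha]
  · simp [hk]

theorem isChain_two_pow_add {n : ℕ} {l : List ℕ} (hl : ∀ v ∈ l, v < 2 ^ n)
    (hc : l.IsChain Adj) : (l.map (2 ^ n + ·)).IsChain Adj := by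
  rw [List.isChain_map]
  exact hc.imp_of_mem_imp fun a b ha hb ⟨i, hi⟩ =>
    ⟨i, by rw [← hi, two_pow_add_xor (hl a ha) (hl b hb)]⟩

theorem ends_map {f : ℕ → ℕ} {l : List ℕ} (h : l ≠ []) :
    ends (l.map f) = (f (ends l).1, f (ends l).2) := by
  rw [ends_eq h, ends_eq (by simpa using h)]
  simp

/-- The crossing paths of `Linked.glue`. -/
theorem exists_crossing_paths {n : ℕ} (D : List (ℕ × ℕ × ℕ)) {P R : List (List ℕ)}
    (hP : ∀ l ∈ P, l ≠ [] ∧ l.IsChain Adj ∧ ∀ v ∈ l, v < 2 ^ n)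
    (hR : ∀ l ∈ R, l ≠ [] ∧ l.IsChain Adj ∧ ∀ v ∈ l, v < 2 ^ n)
    (hPe : P.map ends = D.map (fun t => (t.1, t.2.1)))
    (hRe : R.map ends = D.map (fun t => (t.2.1, t.2.2))) :
    ∃ Z : List (List ℕ), (∀ l ∈ Z, l ≠ [] ∧ l.IsChain Adj) ∧
      Z.flatten.Perm (P.flatten ++ R.flatten.map (2 ^ n + ·)) ∧
      Z.map ends = D.map (fun t => (t.1, 2 ^ n + t.2.2)) := by
  induction D generalizing P R with
  | nil =>
    obtain rfl : P = [] := by simpa using hPe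
    obtain rfl : R = [] := by simpa using hRe
    exact ⟨[], by simp, by simp, rfl⟩
  | cons t D ih =>
    obtain ⟨p, P, rfl, hp, hPe⟩ := List.map_eq_cons_iff.1 hPe
    obtain ⟨r, R, rfl, hr, hRe⟩ := List.map_eq_cons_iff.1 hRe
    obtain ⟨Z, h1, h2, h3⟩ := ih (fun l hl => hP l (by simp [hl]))
      (fun l hl => hR l (by simp [hl])) hPe hRe
    obtain ⟨np, cp, bp⟩ := hP p (by simp)
    obtain ⟨nr, cr, br⟩ := hR r (by simp)
    rw [ends_eq np, Prod.mk.injEq] at hp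
    rw [ends_eq nr, Prod.mk.injEq] at hr
    have nr' : r.map (2 ^ n + ·) ≠ [] := by simpa using nr
    refine ⟨(p ++ r.map (2 ^ n + ·)) :: Z, ?_, ?_, ?_⟩
    · simp only [List.mem_cons, forall_eq_or_imp]
      refine ⟨⟨by simp [np], ?_⟩, h1⟩
      rw [List.isChain_append]
      refine ⟨cp, isChain_two_pow_add br cr, ?_⟩
      rw [List.getLast?_eq_some_getLast np, List.head?_eq_some_head nr', List.head_map, hp.2, hr.1]
      simp only [Option.mem_some_iff, forall_eq']
      exact ⟨n, xor_two_pow_add (hp.2 ▸ bp _ (List.getLast_mem np))⟩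
    · simp only [List.flatten_cons, List.map_append, List.append_assoc]
      refine List.Perm.append_left _ ?_
      refine (List.Perm.append_left _ h2).trans ?_
      rw [← List.append_assoc, ← List.append_assoc]
      exact List.Perm.append_right _ List.perm_append_comm
    · rw [List.map_cons, List.map_cons, h3, ends_eq (by simp [np]),
        List.head_append_of_ne_nil np, List.getLast_append_of_ne_nil _ nr', List.getLast_map,
        hp.1, hr.2]

/-- Gluing along the top coordinate: path systems of the two halves of `Q (n + 1)` are combined,
where each pair `(t.1, 2 ^ n + t.2.2)` crosses from one half to the other at the vertex `t.2.1`. -/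
theorem Linked.glue {n : ℕ} (D : List (ℕ × ℕ × ℕ)) {L₀ L₁ : List Pair}
    (h₀ : Linked n (D.map (fun t => (t.1, t.2.1)) ++ L₀))
    (h₁ : Linked n (D.map (fun t => (t.2.1, t.2.2)) ++ L₁)) :
    Linked (n + 1) (D.map (fun t => (t.1, 2 ^ n + t.2.2)) ++
      (L₀ ++ L₁.map (fun p => (2 ^ n + p.1, 2 ^ n + p.2)))) := by
  obtain ⟨P, hP, hPr, hPe⟩ := h₀
  obtain ⟨R, hR, hRr, hRe⟩ := h₁
  obtain ⟨PA, P₀, rfl, hPA, rfl⟩ := List.map_eq_append_iff.1 hPe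
  obtain ⟨RA, R₁, rfl, hRA, rfl⟩ := List.map_eq_append_iff.1 hRe
  have hP' : ∀ l ∈ PA ++ P₀, l ≠ [] ∧ l.IsChain Adj ∧ ∀ v ∈ l, v < 2 ^ n := fun l hl =>
    ⟨(hP l hl).1, (hP l hl).2, fun v hv => by
      simpa using hPr.subset (List.mem_flatten.2 ⟨l, hl, hv⟩)⟩
  have hR' : ∀ l ∈ RA ++ R₁, l ≠ [] ∧ l.IsChain Adj ∧ ∀ v ∈ l, v < 2 ^ n := fun l hl =>
    ⟨(hR l hl).1, (hR l hl).2, fun v hv => by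
      simpa using hRr.subset (List.mem_flatten.2 ⟨l, hl, hv⟩)⟩
  obtain ⟨Z, h1, h2, h3⟩ := exists_crossing_paths D (fun l hl => hP' l (by simp [hl]))
    (fun l hl => hR' l (by simp [hl])) hPA hRA
  refine ⟨Z ++ (P₀ ++ R₁.map (fun l => l.map (2 ^ n + ·))), ?_, ?_, ?_⟩
  · intro l hl
    rcases List.mem_append.1 hl with hl | hl
    · exact h1 l hl
    rcases List.mem_append.1 hl with hl | hl
    · exact hP l (by simp [hl])
    obtain ⟨r, hr, rfl⟩ := List.mem_map.1 hl
    obtain ⟨a, b, c⟩ := hR' r (by simp [hr])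
    exact ⟨by simpa using a, isChain_two_pow_add c b⟩
  · rw [Nat.pow_succ, Nat.mul_two, List.range_add]
    refine List.Perm.trans ?_ (hPr.append (hRr.map _))
    simp only [List.flatten_append, List.map_append, ← List.map_flatten]
    refine (List.Perm.append_right _ h2).trans ?_
    simp only [List.append_assoc]
    refine List.Perm.append_left _ ?_
    rw [← List.append_assoc, ← List.append_assoc]
    exact List.Perm.append_right _ List.perm_append_comm
  · rw [List.map_append, List.map_append, h3, List.map_map, List.map_map]
    refine congrArg _ (congrArg _ (List.map_congr_left fun l hl => ?_))
    simp only [Function.comp_apply]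
    exact ends_map (hR l (by simp [hl])).1

/-! ### Automorphisms -/

/-- The parity of the number of nonzero binary digits, for codes below `32`. -/
def par (v : ℕ) : ℕ := Nat.land (Nat.shiftRight 0x96696996 v) 1

/-- `IsAut n g`: the map `g` induces an automorphism of `Q n`, on the codes below `2 ^ n`. -/
structure IsAut (n : ℕ) (g : ℕ → ℕ) : Prop where
  lt : ∀ a < 2 ^ n, g a < 2 ^ n
  inj : ∀ a < 2 ^ n, ∀ b < 2 ^ n, g a = g b → a = b
  adj : ∀ a < 2 ^ n, ∀ b < 2 ^ n, Adj a b → Adj (g a) (g b)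
  par : ∀ a < 2 ^ n, ∀ b < 2 ^ n, par a ≠ par b → par (g a) ≠ par (g b)

/-- Image of a pair. -/
def mapPair (g : ℕ → ℕ) (p : Pair) : Pair := (g p.1, g p.2)

theorem IsAut.comp {n : ℕ} {f g : ℕ → ℕ} (hf : IsAut n f) (hg : IsAut n g) : IsAut n (f ∘ g) where
  lt a ha := hf.lt _ (hg.lt a ha)
  inj a ha b hb h := hg.inj a ha b hb (hf.inj _ (hg.lt a ha) _ (hg.lt b hb) h)
  adj a ha b hb h := hf.adj _ (hg.lt a ha) _ (hg.lt b hb) (hg.adj a ha b hb h)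
  par a ha b hb h := hf.par _ (hg.lt a ha) _ (hg.lt b hb) (hg.par a ha b hb h)

theorem IsAut.id {n : ℕ} : IsAut n id :=
  ⟨fun _ h => h, fun _ _ _ _ h => h, fun _ _ _ _ h => h, fun _ _ _ _ h => h⟩

theorem IsAut.iterate {n : ℕ} {g : ℕ → ℕ} (hg : IsAut n g) (k : ℕ) : IsAut n g^[k] := by
  induction k with
  | zero => exact IsAut.id
  | succ k ih => rw [Function.iterate_succ']; exact hg.comp ih

/-- The inverse of an automorphism is one of its powers. -/
theorem IsAut.exists_inverse {n : ℕ} {g : ℕ → ℕ} (hg : IsAut n g) :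
    ∃ f, IsAut n f ∧ (∀ a < 2 ^ n, f (g a) = a) ∧ ∀ a < 2 ^ n, g (f a) = a := by
  let e : Fin (2 ^ n) → Fin (2 ^ n) := fun a => ⟨g a, hg.lt a a.2⟩
  have he : Function.Injective e := fun a b h =>
    Fin.ext (hg.inj a a.2 b b.2 (congrArg Fin.val h))
  let σ : Equiv.Perm (Fin (2 ^ n)) := Equiv.ofBijective e (Finite.injective_iff_bijective.1 he)
  have hpow : ∀ k (a : Fin (2 ^ n)), ((σ ^ k) a : ℕ) = g^[k] a := by
    intro k
    induction k with
    | zero => intro a; rfl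
    | succ k ih => intro a; rw [pow_succ', Function.iterate_succ_apply', ← ih]; rfl
  have hpos := orderOf_pos σ
  obtain ⟨k, hk⟩ : ∃ k, orderOf σ = k + 1 := ⟨orderOf σ - 1, by omega⟩
  have hid : ∀ a < 2 ^ n, g^[k + 1] a = a := fun a ha => by
    have := hpow (k + 1) ⟨a, ha⟩
    rw [← hk, pow_orderOf_eq_one] at this
    rw [← hk]
    exact this.symm
  refine ⟨g^[k], hg.iterate k, fun a ha => ?_, fun a ha => ?_⟩
  · rw [← Function.iterate_succ_apply]; exact hid a ha
  · rw [← Function.iterate_succ_apply' g]; exact hid a ha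

/-- Automorphisms act on path systems. -/
theorem Linked.map {n : ℕ} {g : ℕ → ℕ} (hg : IsAut n g) {L : List Pair} (h : Linked n L) :
    Linked n (L.map (mapPair g)) := by
  obtain ⟨P, hP, hr, rfl⟩ := h
  have hlt : ∀ l ∈ P, ∀ v ∈ l, v < 2 ^ n := fun l hl v hv => by
    simpa using hr.subset (List.mem_flatten.2 ⟨l, hl, hv⟩)
  refine ⟨P.map (List.map g), ?_, ?_, ?_⟩
  · intro l hl
    obtain ⟨l, hl', rfl⟩ := List.mem_map.1 hl
    refine ⟨by simpa using (hP l hl').1, ?_⟩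
    rw [List.isChain_map]
    exact (hP l hl').2.imp_of_mem_imp fun a b ha hb =>
      hg.adj a (hlt l hl' a ha) b (hlt l hl' b hb)
  · rw [← List.map_flatten]
    refine (hr.map g).trans ?_
    refine List.Subperm.perm_of_length_le (List.Nodup.subperm ?_ ?_) (by simp)
    · refine List.Nodup.map_on ?_ List.nodup_range
      intro a ha b hb
      exact hg.inj a (by simpa using ha) b (by simpa using hb)
    · intro x hx
      obtain ⟨a, ha, rfl⟩ := List.mem_map.1 hx
      simpa using hg.lt a (by simpa using ha)
  · rw [List.map_map, List.map_map]
    exact List.map_congr_left fun l hl => ends_map (hP l hl).1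

theorem Linked.of_map {n : ℕ} {g : ℕ → ℕ} (hg : IsAut n g) {L : List Pair}
    (hL : ∀ p ∈ L, p.1 < 2 ^ n ∧ p.2 < 2 ^ n) (h : Linked n (L.map (mapPair g))) :
    Linked n L := by
  obtain ⟨f, hf, hfg, -⟩ := hg.exists_inverse
  have := h.map hf
  rw [List.map_map] at this
  convert this
  conv_lhs => rw [← List.map_id L]
  refine List.map_congr_left fun p hp => ?_
  simp [mapPair, hfg _ (hL p hp).1, hfg _ (hL p hp).2]

/-- Two lists of pairs which agree up to the order of the pairs and the order inside the pairs. -/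
def SameSys (L M : List Pair) : Prop :=
  (L.map fun p => s(p.1, p.2)).Perm (M.map fun p => s(p.1, p.2))

theorem SameSys.of_perm {L M : List Pair} (h : L.Perm M) : SameSys L M := h.map _

theorem SameSys.refl (L : List Pair) : SameSys L L := List.Perm.refl _

theorem SameSys.symm {L M : List Pair} (h : SameSys L M) : SameSys M L := List.Perm.symm h

theorem SameSys.trans {L M N : List Pair} (h : SameSys L M) (h' : SameSys M N) : SameSys L N :=
  List.Perm.trans h h'

theorem sameEnds_iff {p q : Pair} : SameEnds p q ↔ s(p.1, p.2) = s(q.1, q.2) := by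
  rw [Sym2.eq_iff, SameEnds, Prod.ext_iff, Prod.ext_iff]
  constructor <;> rintro (⟨h, h'⟩ | ⟨h, h'⟩) <;> simp_all

theorem SameSys.cons {L M : List Pair} {p q : Pair} (hpq : SameEnds p q) (h : SameSys L M) :
    SameSys (p :: L) (q :: M) := by
  unfold SameSys
  rw [List.map_cons, List.map_cons, sameEnds_iff.1 hpq]
  exact List.Perm.cons _ h

theorem SameSys.append {L M L' M' : List Pair} (h : SameSys L M) (h' : SameSys L' M') :
    SameSys (L ++ L') (M ++ M') := by
  unfold SameSys
  rw [List.map_append, List.map_append]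
  exact List.Perm.append h h'

theorem SameSys.exists_perm {L M : List Pair} (h : SameSys L M) :
    ∃ N, L.Perm N ∧ List.Forall₂ SameEnds N M := by
  obtain ⟨N, hMN, hNL⟩ := List.perm_comp_forall₂ (r := fun (s : Sym2 ℕ) (p : Pair) => s(p.1, p.2) = s)
    (List.Perm.symm h) (List.forall₂_map_left_iff.2 (List.forall₂_same.2 fun _ _ => rfl))
  refine ⟨N, hNL.symm, ?_⟩
  rw [List.forall₂_map_left_iff] at hMN
  exact hMN.flip.imp fun a b hab => sameEnds_iff.2 hab

theorem SameSys.linked {n : ℕ} {L M : List Pair} (h : SameSys L M) (hL : Linked n L) :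
    Linked n M := by
  obtain ⟨N, h1, h2⟩ := h.exists_perm
  exact (hL.perm h1).congr h2

theorem SameSys.vertsOf {L M : List Pair} (h : SameSys L M) : (vertsOf L).Perm (vertsOf M) := by
  obtain ⟨N, h1, h2⟩ := h.exists_perm
  exact (vertsOf_perm h1).trans (vertsOf_congr h2)

theorem SameSys.map {L M : List Pair} (h : SameSys L M) (g : ℕ → ℕ) :
    SameSys (L.map (mapPair g)) (M.map (mapPair g)) := by
  have := List.Perm.map (Sym2.map g) h
  unfold SameSys
  rw [List.map_map, List.map_map] at this ⊢
  exact this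

theorem vertsOf_map (g : ℕ → ℕ) (L : List Pair) :
    vertsOf (L.map (mapPair g)) = (vertsOf L).map g := by
  induction L with
  | nil => rfl
  | cons p L ih => rw [List.map_cons, vertsOf_cons, ih, vertsOf_cons]; rfl

/-- The pairs are odd, with pairwise different vertices of `Q n`. -/
def Valid (n : ℕ) (L : List Pair) : Prop :=
  (∀ p ∈ L, p.1 < 2 ^ n ∧ p.2 < 2 ^ n ∧ par p.1 ≠ par p.2) ∧ (vertsOf L).Nodup

/-- No vertex outside the pairs has all its neighbours in the pairs. -/
def NoEnc (n : ℕ) (L : List Pair) : Prop :=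
  ∀ w < 2 ^ n, w ∉ vertsOf L → ∃ v < 2 ^ n, Adj w v ∧ v ∉ vertsOf L

theorem SameSys.valid {n : ℕ} {L M : List Pair} (h : SameSys L M) (hL : Valid n L) :
    Valid n M := by
  refine ⟨fun q hq => ?_, h.vertsOf.nodup_iff.1 hL.2⟩
  have hq' := (List.Perm.mem_iff h).2 (List.mem_map_of_mem (f := fun p : Pair => s(p.1, p.2)) hq)
  obtain ⟨p, hp, hpq⟩ := List.mem_map.1 hq'
  obtain ⟨h1, h2, h3⟩ := hL.1 p hp
  rcases sameEnds_iff.2 hpq with rfl | rfl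
  · exact ⟨h1, h2, h3⟩
  · exact ⟨h2, h1, h3.symm⟩

theorem SameSys.noEnc {n : ℕ} {L M : List Pair} (h : SameSys L M) (hL : NoEnc n L) :
    NoEnc n M := by
  intro w hw hwM
  obtain ⟨v, h1, h2, h3⟩ := hL w hw fun hwL => hwM (h.vertsOf.subset hwL)
  exact ⟨v, h1, h2, fun hv => h3 (h.vertsOf.symm.subset hv)⟩

theorem Valid.lt {n : ℕ} {L : List Pair} (hL : Valid n L) {v : ℕ} (hv : v ∈ vertsOf L) :
    v < 2 ^ n := by
  obtain ⟨p, hp, rfl | rfl⟩ := mem_vertsOf.1 hv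
  · exact (hL.1 p hp).1
  · exact (hL.1 p hp).2.1

theorem Valid.map {n : ℕ} {L : List Pair} (hL : Valid n L) {g : ℕ → ℕ} (hg : IsAut n g) :
    Valid n (L.map (mapPair g)) := by
  refine ⟨fun q hq => ?_, ?_⟩
  · obtain ⟨p, hp, rfl⟩ := List.mem_map.1 hq
    obtain ⟨h1, h2, h3⟩ := hL.1 p hp
    exact ⟨hg.lt _ h1, hg.lt _ h2, hg.par _ h1 _ h2 h3⟩
  · rw [vertsOf_map]
    exact hL.2.map_on fun a ha b hb => hg.inj a (hL.lt ha) b (hL.lt hb)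

theorem NoEnc.map {n : ℕ} {L : List Pair} (hL : NoEnc n L) (hv : Valid n L) {g : ℕ → ℕ}
    (hg : IsAut n g) : NoEnc n (L.map (mapPair g)) := by
  intro w hw hwL
  obtain ⟨f, hf, -, hgf⟩ := hg.exists_inverse
  rw [vertsOf_map] at hwL ⊢
  obtain ⟨v, h1, h2, h3⟩ := hL (f w) (hf.lt w hw) fun h =>
    hwL (List.mem_map.2 ⟨_, h, hgf w hw⟩)
  refine ⟨g v, hg.lt v h1, ?_, fun h => h3 ?_⟩
  · have := hg.adj _ (hf.lt w hw) _ h1 h2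
    rwa [hgf w hw] at this
  · obtain ⟨u, hu, huv⟩ := List.mem_map.1 h
    rwa [← hg.inj u (hv.lt hu) v h1 huv]

/-- A list of pairs may be replaced by its image under an automorphism, up to order. -/
theorem Linked.of_map_same {n : ℕ} {g : ℕ → ℕ} (hg : IsAut n g) {L M : List Pair}
    (hL : Valid n L) (h : SameSys (L.map (mapPair g)) M) (hM : Linked n M) : Linked n L :=
  Linked.of_map hg (fun p hp => ⟨(hL.1 p hp).1, (hL.1 p hp).2.1⟩) (h.symm.linked hM)

/-! ### Arithmetic for kernel computations

The functions to be evaluated by the kernel use bare recursors and the accelerated operations on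
natural numbers, and they force intermediate results to numerals. -/

/-- `force n f = f n`; when evaluated by the kernel, `n` is reduced to a numeral first. -/
def force {α : Type} (n : ℕ) (f : ℕ → α) : α := Nat.rec (f 0) (fun k _ => f (Nat.succ k)) n

@[simp] theorem force_eq {α : Type} (n : ℕ) (f : ℕ → α) : force n f = f n := by cases n <;> rfl

/-- Conditional, as a bare recursor. -/
def sel {α : Type} (c : Bool) (x y : α) : α := Bool.rec y x c

@[simp] theorem sel_true {α : Type} (x y : α) : sel true x y = x := rfl
@[simp] theorem sel_false {α : Type} (x y : α) : sel false x y = y := rfl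

theorem sel_false_right {c b : Bool} : sel c b false = true ↔ c = true ∧ b = true := by
  cases c <;> simp

theorem sel_true_left {c b : Bool} : sel c true b = true ↔ c = true ∨ b = true := by
  cases c <;> simp

/-- `f` holds below `n`. -/
def allN (n : ℕ) (f : ℕ → Bool) : Bool := Nat.rec true (fun k ih => sel (f k) ih false) n

theorem allN_iff {n : ℕ} {f : ℕ → Bool} : allN n f = true ↔ ∀ i < n, f i = true := by
  induction n with
  | zero => simp [allN]
  | succ n ih =>
    change sel (f n) (allN n f) false = true ↔ _
    rw [sel_false_right, ih, Nat.forall_lt_succ_right, and_comm]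

/-- `f` holds somewhere below `n`. -/
def anyN (n : ℕ) (f : ℕ → Bool) : Bool := Nat.rec false (fun k ih => sel (f k) true ih) n

theorem anyN_iff {n : ℕ} {f : ℕ → Bool} : anyN n f = true ↔ ∃ i < n, f i = true := by
  induction n with
  | zero => simp [anyN]
  | succ n ih =>
    change sel (f n) true (anyN n f) = true ↔ _
    rw [sel_true_left, ih, Nat.exists_lt_succ_right, or_comm]

/-- `f` holds on some entry of the list. -/
def anyL {α : Type} (f : α → Bool) (l : List α) : Bool :=
  List.rec false (fun a _ ih => sel (f a) true ih) l

theorem anyL_iff {α : Type} {f : α → Bool} {l : List α} :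
    anyL f l = true ↔ ∃ a ∈ l, f a = true := by
  induction l with
  | nil => simp [anyL]
  | cons a l ih =>
    change sel (f a) true (anyL f l) = true ↔ _
    rw [sel_true_left, ih]
    simp

/-- `f` holds on every entry of the list. -/
def allL {α : Type} (f : α → Bool) (l : List α) : Bool :=
  List.rec true (fun a _ ih => sel (f a) ih false) l

theorem allL_iff {α : Type} {f : α → Bool} {l : List α} :
    allL f l = true ↔ ∀ a ∈ l, f a = true := by
  induction l with
  | nil => simp [allL]
  | cons a l ih =>
    change sel (f a) (allL f l) false = true ↔ _
    rw [sel_false_right, ih]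
    simp

/-- The binary digit `i` of `m`. -/
def hasBit (m i : ℕ) : Bool := Nat.beq (Nat.land (Nat.shiftRight m i) 1) 1

theorem hasBit_eq (m i : ℕ) : hasBit m i = m.testBit i := by
  rw [Nat.testBit_eq_decide_div_mod_eq]
  change Nat.beq (m >>> i &&& 1) 1 = _
  rw [Nat.and_one_is_mod, Nat.shiftRight_eq_div_pow]
  exact Bool.eq_iff_iff.2 (by rw [Nat.beq_eq, decide_eq_true_iff])

/-- The number whose only binary digit is `v`. -/
def single (v : ℕ) : ℕ := Nat.shiftLeft 1 v

theorem single_eq (v : ℕ) : single v = 2 ^ v := Nat.one_shiftLeft v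

/-- Adjacency test, for codes below `32`. -/
def adjB (a b : ℕ) : Bool := hasBit 0x10116 (Nat.xor a b)

theorem adj_of_adjB {a b : ℕ} (h : adjB a b = true) : Adj a b := by
  have h' : Nat.testBit 0x10116 (a ^^^ b) = true := by rw [← hasBit_eq]; exact h
  have hlt : a ^^^ b < 17 := by
    by_contra hc
    have : (0x10116 : ℕ) < 2 ^ (a ^^^ b) :=
      lt_of_lt_of_le (by norm_num) (Nat.pow_le_pow_right (n := 2) (by norm_num) (not_lt.1 hc))
    rw [Nat.testBit_lt_two_pow this] at h'
    exact absurd h' (by simp)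
  generalize hx : a ^^^ b = x at h' hlt
  have : ∀ x < 17, Nat.testBit 0x10116 x = true → ∃ i < 5, x = 2 ^ i := by decide
  obtain ⟨i, -, hi⟩ := this x hlt h'
  exact ⟨i, hx.trans hi⟩

theorem adjB_of_adj {a b : ℕ} (ha : a < 32) (hb : b < 32) (h : Adj a b) : adjB a b = true := by
  obtain ⟨i, hi⟩ := h
  have hlt : a ^^^ b < 2 ^ 5 := Nat.xor_lt_two_pow ha hb
  have h5 : i < 5 := by
    rw [hi] at hlt
    exact (Nat.pow_lt_pow_iff_right (by norm_num)).1 hlt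
  change hasBit 0x10116 (a ^^^ b) = true
  have : ∀ i < 5, hasBit 0x10116 (2 ^ i) = true := by decide
  rw [hi]
  exact this i h5

/-- The two entries of a pair are adjacent. -/
def isEdge (p : Pair) : Bool := adjB p.1 p.2

/-! ### Automorphisms given by tables -/

/-- The entry `v` of a table of five-bit numbers packed into `P`. -/
def app (P v : ℕ) : ℕ := Nat.land (Nat.shiftRight P (Nat.mul 5 v)) 31

/-- The table `P` describes an automorphism of `Q n`. -/
def checkAut (n P : ℕ) : Bool :=
  sel (allN (Nat.pow 2 n) fun v => sel (Nat.blt (app P v) (Nat.pow 2 n))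
    (sel (Nat.beq (Nat.xor (par (app P v)) (par v)) (par (app P 0)))
      (allN n fun j => adjB (app P v) (app P (Nat.xor v (Nat.pow 2 j)))) false) false)
    (allN (Nat.pow 2 n) fun v => anyN (Nat.pow 2 n) fun w => Nat.beq (app P w) v) false

theorem isAut_of_check {n P : ℕ} (h : checkAut n P = true) : IsAut n (app P) := by
  rw [checkAut, sel_false_right, allN_iff, allN_iff] at h
  obtain ⟨h1, h2⟩ := h
  simp only [sel_false_right, allN_iff, anyN_iff, Nat.blt_eq, Nat.beq_eq] at h1 h2
  refine ⟨fun a ha => (h1 a ha).1, ?_, ?_, ?_⟩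
  · let e : Fin (2 ^ n) → Fin (2 ^ n) := fun a => ⟨app P a, (h1 a a.2).1⟩
    have he : Function.Surjective e := fun b => by
      obtain ⟨w, hw, hwb⟩ := h2 b b.2
      exact ⟨⟨w, hw⟩, Fin.ext hwb⟩
    have := Finite.injective_iff_surjective.2 he
    intro a ha b hb hab
    exact congrArg Fin.val (this (a₁ := ⟨a, ha⟩) (a₂ := ⟨b, hb⟩) (Fin.ext hab))
  · rintro a ha b hb ⟨i, hi⟩
    have hi' : i < n := by
      have : a ^^^ b < 2 ^ n := Nat.xor_lt_two_pow ha hb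
      rw [hi] at this
      exact (Nat.pow_lt_pow_iff_right (by norm_num)).1 this
    have hb' : b = a ^^^ 2 ^ i := by rw [← hi, ← Nat.xor_assoc, Nat.xor_self, Nat.zero_xor]
    rw [hb']
    exact adj_of_adjB ((h1 a ha).2.2 i hi')
  · intro a ha b hb hab h
    have e1 : par (app P a) ^^^ par a = par (app P 0) := (h1 a ha).2.1
    have e2 : par (app P b) ^^^ par b = par (app P 0) := (h1 b hb).2.1
    rw [← e2, h] at e1
    exact hab (Nat.xor_right_injective e1)

/-! ### Path systems given by numerals -/

/-- The digits of `m` in base `2 ^ (n + 1)`, cut into lists by the digit `2 ^ n`; the argument `k`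
bounds the number of digits. -/
def decodeFrom (n : ℕ) (k : ℕ) : ℕ → List ℕ → List (List ℕ) :=
  Nat.rec (motive := fun _ => ℕ → List ℕ → List (List ℕ)) (fun _ _ => [])
    (fun _ ih m cur => sel (Nat.beq m 0) []
      (force (Nat.land m (Nat.sub (Nat.shiftLeft 1 (Nat.succ n)) 1)) fun v =>
        force (Nat.shiftRight m (Nat.succ n)) fun m' =>
          sel (Nat.beq v (Nat.shiftLeft 1 n)) (cur.reverse :: ih m' []) (ih m' (v :: cur)))) k

/-- The list of paths in `Q n` encoded by a numeral. -/
def decodeSys (n m : ℕ) : List (List ℕ) := decodeFrom n (Nat.pow 2 (Nat.succ n)) m []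

/-- Consecutive entries of `a :: l` are adjacent. -/
def chainB (l : List ℕ) : ℕ → Bool :=
  List.rec (motive := fun _ => ℕ → Bool) (fun _ => true)
    (fun b _ ih a => sel (adjB a b) (ih b) false) l

/-- The list is nonempty and its consecutive entries are adjacent. -/
def pathB (l : List ℕ) : Bool := List.rec false (fun a l _ => chainB l a) l

/-- The lists are paths, which together visit every vertex of `Q n` exactly once. -/
def goodSys (n : ℕ) (P : List (List ℕ)) : Bool :=
  sel (allL pathB P) (sel (Nat.beq P.flatten.length (Nat.pow 2 n))
    (Nat.beq (List.rec 0 (fun v _ ih => Nat.lor (single v) ih) P.flatten)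
      (Nat.sub (Nat.pow 2 (Nat.pow 2 n)) 1)) false) false

theorem isChain_of_chainB {l : List ℕ} {a : ℕ} (h : chainB l a = true) :
    (a :: l).IsChain Adj := by
  induction l generalizing a with
  | nil => simp
  | cons b l ih =>
    change sel (adjB a b) (chainB l b) false = true at h
    rw [sel_false_right] at h
    exact List.isChain_cons_cons.2 ⟨adj_of_adjB h.1, ih h.2⟩

theorem linked_of_goodSys {n : ℕ} {P : List (List ℕ)} (h : goodSys n P = true) :
    Linked n (P.map ends) := by
  rw [goodSys, sel_false_right, sel_false_right, allL_iff, Nat.beq_eq, Nat.beq_eq] at h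
  obtain ⟨hP, hlen, hor⟩ := h
  refine ⟨P, fun l hl => ?_, ?_, rfl⟩
  · have := hP l hl
    cases l with
    | nil => exact absurd this (by simp [pathB])
    | cons a l => exact ⟨by simp, isChain_of_chainB this⟩
  · have key : ∀ (l : List ℕ) (v : ℕ),
        Nat.testBit (List.rec 0 (fun v _ ih => Nat.lor (single v) ih) l : ℕ) v = true → v ∈ l := by
      intro l v
      induction l with
      | nil => simp
      | cons w l ih =>
        intro hv
        have hv' : Nat.testBit (2 ^ w ||| (List.rec 0 (fun v _ ih => Nat.lor (single v) ih) l : ℕ)) v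
            = true := by rw [← single_eq]; exact hv
        rw [Nat.testBit_or, Bool.or_eq_true, Nat.testBit_two_pow, decide_eq_true_iff] at hv'
        rcases hv' with rfl | hv'
        · simp
        · exact List.mem_cons_of_mem _ (ih hv')
    have hsub : List.range (2 ^ n) ⊆ P.flatten := by
      intro v hv
      refine key _ v ?_
      rw [hor]
      change Nat.testBit (2 ^ 2 ^ n - 1) v = true
      rw [Nat.testBit_two_pow_sub_one]
      simpa using hv
    exact ((List.nodup_range.subperm hsub).perm_of_length_le
      (by rw [hlen, List.length_range]; exact le_rfl)).symm

/-! ### Four pairs in the four-dimensional cube -/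

/-- The even vertex with upper digits `h`. -/
def evenV (h : ℕ) : ℕ := Nat.add (Nat.shiftLeft h 1) (par h)

/-- The odd vertex with upper digits `h`. -/
def oddV (h : ℕ) : ℕ := Nat.xor (evenV h) 1

/-- The code of an odd pair in `Q 4`: the upper digits of the even and of the odd vertex. -/
def codeP (p : Pair) : ℕ :=
  sel (Nat.beq (par p.1) 0)
    (Nat.add (Nat.shiftRight p.1 1) (Nat.shiftLeft (Nat.shiftRight p.2 1) 3))
    (Nat.add (Nat.shiftRight p.2 1) (Nat.shiftLeft (Nat.shiftRight p.1 1) 3))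

/-- The odd pair in `Q 4` with a given code, the even vertex first. -/
def pairOf (c : ℕ) : Pair := (evenV (Nat.land c 7), oddV (Nat.shiftRight c 3))

/-- The automorphisms `v ↦ π (v ^^^ c)` of `Q 4`, where `π` exchanges the digits `0` and `i`; the
table `16 * i + c` sends the edge `{c, c ^^^ 2 ^ i}` to `{0, 1}`. -/
def edgeTabs : ℕ :=
  0x204a230ce0a46b2b4ef40142611c648563695e7128083388c1ac293bcad509007198458d2179da5230ce0204a2b4ef0a46b611c640142695e7485633388c128083bcad1ac29719845090079da558d210a46b2b4ef0204a230ce48563695e740142611c61ac293bcad128083388c58d2179da550900719842b4ef0a46b230ce0204a695e748563611c6401423bcad1ac293388c1280879da558d21719845090001046094674314e4b56f200c2284e3621ca6a5eb1180419c255390c5bd2d3088038ca1729887ada909467010464b56f4314e284e3200c26a5eb621ca19c25118045bd2d5390c38ca1308807ada9729884314e4b56f0104609467621ca6a5eb200c2284e35390c5bd2d1180419c25729887ada93088038ca14b56f4314e09467010466a5eb621ca284e3200c25bd2d5390c19c25118047ada97298838ca13088000823218a74292b639af10061310e552169731ed08c0229c864ad0a6bd8e18440394c45a5487b5cc218a7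00823639af4292b310e510061731ed5216929c8608c026bd8e4ad0a394c4184407b5cc5a5484292b639af00823218a752169731ed10061310e54ad0a6bd8e08c0229c865a5487b5cc18440394c4639af4292b218a700823731ed52169310e5100616bd8e4ad0a29c8608c027b5cc5a548394c41844000443214c74254b635cf08062290e64a16a6b1ee10c0131c8552d0973d8d18820398a45a9287b9ac214c700443635cf4254b290e6080626b1ee4a16a31c8510c0173d8d52d09398a4188207b9ac5a9284254b635cf00443214c74a16a6b1ee08062290e652d0973d8d10c0131c855a9287b9ac18820398a4635cf4254b214c7004436b1ee4a16a290e60806273d8d52d0931c8510c017b9ac5a928398a418820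

/-- The twelve automorphisms of `Q 4` that preserve the edge `{0, 1}`. -/
def stabTabs : ℕ :=
  0x73cc752c4363485424017b8e65a8626b0a44a02073cc76348552c43424017b8e66b0a45a8624a02073d4b31c4363509214017b96a398626b1282902073d4b6350931c43214017b96a6b128398622902073d8d31c8552d0910c017b9ac398a45a9281882073d8d52d0931c8510c017b9ac5a928398a418820

/-- The table number `i` of a list of packed tables for `Q 4`. -/
def subTab (T i : ℕ) : ℕ := Nat.shiftRight T (Nat.mul 80 i)

/-- The codes of nine pairs representing the orbits, under the automorphisms `stabTabs`, of the odd
pairs disjoint from the edge `{0, 1}`; one byte for each. -/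
def repTab : ℕ := 0x3f1f1d1b0f0e0b0a09

/-- For each code of an odd pair disjoint from `{0, 1}`: the number of its representative in
`repTab` (four low bits) and the number of an automorphism in `stabTabs` leading to it (four high
bits). The remaining codes get the value `15`. -/
def normTab : ℕ :=
  0x89737741754140f878576b25692130f276625721653320f64a262606391310f074606730552120f448243814240110f040322210201000f0f0f0f0f0f0f0f0f

/-- The byte `i` of `T`. -/
def byte (T i : ℕ) : ℕ := Nat.land (Nat.shiftRight T (Nat.shiftLeft i 3)) 255

/-- The digit `4096 * k + codeP r + 64 * codeP s` tells whether the pairs `{0, 1}`, `r`, `s` and the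
representative number `k` in `repTab` are joined by a path system of `Q 4`. -/
def table4 : ℕ :=
  0x3e3e3e3e3e0000005e5e5e5e5e0000006e6e6e6e6e00000076767676760000007a7a7a7a7a000000787c6c7c7c0000000000000000000000000000000000003e003e3e3e3e00005e005e5e5e5e00006e006e6e6e6e0000760076767676000078007a6a7a7a00007c007c7c7c7c0000000000000000000000000000000000003e3e003e3e3e00005e5e005e5e5e00006e6e006e6e6e000076760076563600007a7a007a7a7a00007c7c007c7c7c0000000000000000000000000000000000003e3e3e003e3e00005e5e5e005e5e00006c6a6e006e6e000076767600767600007a7a7a007a7a00007c7c7c007c7c0000000000000000000000000000000000003e3e3e3e003e00005e5e565e001e00006e6e6e6e006e000076767676007600007a7a7a7a007a00007c7c7c7c007c0000000000000000000000000000000000003e3e363e1e0000005e5e5e5e5e0000006e6e6e6e6e00000076767676760000007a7a7a7a7a0000007c7c7c7c7c00000000000000000000000000000000000000000000000000000000000000000000000000000000000000000000000000000000000000000000000000000000000000000000000000000000000000000000003e3e3e003e3e00005e5e5e005e5e00006e6e6e006e6e000076767600767600007a7a7a007a7a00007c7c7c007c7c00000000000000000000000000000000003e003e3e00043e005e005e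5e00045e006e006e6e00046e0076007276000472007a007a7a007a7a007c00707c00046c00000000000000000000000000000000003e3e003e003e02005e5e005e005e02006e6e006e006e020076740076007402007a70007a006a02007c7c007c007c7c00000000000000000000000000000000003e3e3e00003e3e005e5e5e00005e5e006e6e6e00006e6e0076767600007676007a7a7a00007a7a007c7c7c00007c7c0000000000000000000000000000000000000000000000000000000000000000000000000000000000000000000000000000000000000000000000000000000000000000000000000000000000000000003e043e3e00003e005e045e5e00005e006e046a6e00006a0076047676000076007a7a7a7a00007a007c04747c00006800000000000000000000000000000000003e3e023e003e00005e5e025e005e00006e6c026e006c000076760276007600007a72027a006800007c7c7c7c007c0000000000000000000000000000000000000000000000000000000000000000000000000000000000000000000000000000000000000000000000000000000000000000000000000000005e5e5e005e5e00008e8e9e008e8e000000000000000000008e8e4c008e8e0000d4d4d400d4920000d2dada005a5a0000d4905400d4480000000000000000005e005e5e00045e008e008e9e00048e0000000000000000008e008ece00048e00d000d4d400045200da00dada00dada00d40050d400048c0000000000000000005e5c005c005e02008c8e001c008e020000000000000000008e8e00ce008e0200d4d400d400d40200d8d800da00da0200d4d400d400d4dc0000000000000000004c5e1e00005e5e009e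9e9e00009e9e000000000000000000cecece0000cece00d4d4d40000d41600dadada0000dada00c4d4140000d44c000000000000000000000000000000000000000000000000000000000000000000000000000000000000000000000000000000000000000000000000000000000000000000000000005a045e5e00005a008e048e9e00008e0000000000000000008e048ece00008e00d404d4d40000d600dadadada0000da00d404d4d400000800000000000000000058560254005c0000868c0296008c000000000000000000008c8c02cc008c0000d6d602d600d60000d0d202da00580000dcdcdcdc00dc0000000000000000000000000000000000000000000000000000000000000000000000000000000000000000000000000000000000000000000000000000000000000000000000000000007676760076760000b2b2b200b6b20000d4d4d400d4d60000e6e6e600e6e600000000000000000000b2b2b20072b20000d4d4d400d4740000000000000000007600767600047600b200b2b20004b200d400d4d40004d600e600e6e60004e6000000000000000000b200b2b200f2b200d400d4d40004f40000000000000000007676007600760200b2b200b200b60200d4d400d400d40200e6e600e600e602000000000000000000b2b200b200f20200d4d400d400d4f40000000000000000007676760000767600b2b2b20000b6b200d4d4d40000d4d600e6e6e60000e6e6000000000000000000b2b2b20000e2b200d4d4d40000d4e4000000000000000000000000000000000000000000000000000000000000000000000000000000000000000000000000000000000000000000000000000000000000000000000000007204767600007600b604b6b60000b600d404d4d40000d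600e604e6e20000e6000000000000000000f2f2f2f20000f200d404d4d40000f40000000000000000007476027600760000b2b202b200b60000d6d602d600d60000e6e602e400e600000000000000000000b2b202b200f20000f4f4f4f400f400000000000000000000000000000000000000000000000000000000000000000000000000000000000000000000000000000000000000000000000000000000000000000000000000000000000000000000003e3e3e3e3e0000005e5e5e5e5e0000004e666a6e6c0000007676767676000000727a785a6a000000541074045c0000000000000000000000000000000000003e003e3e3e3e00004c00565e5e5e00006e006e6e6e6e000070007676567600007a007a7a7a7a00007c00787c6c7c0000000000000000000000000000000000003c3e003c023e00005c5e005e025e00006e6e006e026e000064560074025400007878007a026a00007c7c007c7c7c0000000000000000000000000000000000003e3e3e003e3e00005e5e5e005e5e00006e6e6e006e6e000074767600567600006a7a7a006a7a0000787c34005c7c0000000000000000000000000000000000003c3e023e003c000058560254005c00006c6c026a006e000074760276007600007a7a027a007a00007c7c7c7c007c0000000000000000000000000000000000003e3e3e3e3e0000005c5e565e5e0000006a6e6a6e6e00000076767676760000007a7a7a7a7a0000006c7c747c1c0000000000000000000000000000000000000000000000000000000000000000000000000000000000000000000000000000000000000000000000000000000000000000000000000000000000000000000000000000000000000000000000000000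0000000000000000000000000000000000000000000000000000000000000000000000000000000000003e3e363e1e00000000000000000000008e86968e8c0000008e8e268e8c000000b2b2b09296000000b2b2b0b21a000000bcbcb4bc9c000000000000000000003e003e3e3e3e000000000000000000008e008e168e8e00008e008eae8e8e0000b200b2b2b2160000b200b2b2b2ba0000bc00b0b48c9c000000000000000000003e3e003e023e000000000000000000008e8e009e028e00008e8e00ae028e000092b000b002960000b2b000b2029a0000bcbc00bcbcbc000000000000000000002e1e3e003e3e000000000000000000009e9e9e009e9e0000aeaeae00aeae00000090b20082840000b2b2b200b28a0000b0bcb400bc9c000000000000000000003e3e023e003e00000000000000000000868c0296008c00008e8c02a6008e0000b2b202b200b60000b2b202b200ba0000bcbcbcbc00bc000000000000000000003a363e3e3e0000000000000000000000008482908e0000008e8e8ea28e000000b6b6b6b6b6000000bababababa0000008cbcbcb49c00000000000000000000000000000000000000000000000000000000000000000000000000000000000000000000000000000000000000000000000000000000000000000000000000000000000000000000000000000000000000000000000000000000000000000000000000000000000000000000000000000000000000000000000000000000000000007676767676000000b2b2b2b2b6000000d6d6d6d6d6000000e6e6e6e6e60000000000000000000000b2b2b2b2f2000000f4f4f4f4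f4000000000000000000007600767676760000b200b2b2b2b60000d600d6d6d6d60000e600e6e6e6e600000000000000000000b200b2b2b2f20000f400f4f4f4f4000000000000000000007676007602760000b2b200b202b60000d6d600d602d60000e6e600e602e600000000000000000000b2b200b202f20000f4f400f4f4f4000000000000000000007676760076760000b2b2b200b2b60000d6d6d600d6d60000e6e6e600e6e600000000000000000000b2b2b200b2f20000f4f4f400f4f4000000000000000000007676027600760000b2b202b200b60000d6d602d600d60000e6e602e600e600000000000000000000b2b202b200f20000f4f4f4f400f4000000000000000000007676767676000000b6b6b6b6b6000000d6d6d6d6d6000000e6e6e6e6e60000000000000000000000f2f2f2f2f2000000f4f4f4f4f400000000000000000000000000000000000000000000000000000000000000000000000000000000000000000000000000000000000000000000000000000000000000000000000000000000000000000000000000000000000000000000000000000000000000000000000000000000000000000000000000000000000000000000000000000000000000007a7a7a7a7a000000b2b2b2b28a000000dadadadada000000eaeaeaea4a000000b2b2b092f00000000000000000000000f0f078d8f8000000000000000000007a007a7a7a7a0000b200b2b2b2b80000da00dadadada0000ea00eaeaeaea0000b000b2b2127000000000000000000000f8007078e8f8000000000000000000007a780078027a0000b2b200b202ba0000dada00d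a02d80000eaea00ea02ea0000b0b000b002f000000000000000000000f8f800f8f8f80000000000000000000078787a007a7a0000b2b2b200b2ba0000dadada00dada0000eaeaea00eaea0000b2b2b200b2d000000000000000000000f0f87000f8f8000000000000000000007a72027a00680000b2b202b200080000d0d202da00580000eae802ea00e80000b2b202b200f200000000000000000000f8f8f8f800f8000000000000000000006a727a7a1a000000bababababa0000008adadad29a000000aaeaeaea2a000000f2f2f2f2f20000000000000000000000f0b0d0f00800000000000000000000000000000000000000000000000000000000000000000000000000000000000000000000000000000000000000000000000000000000000000000000000000000000000000000000000000000000000000000000000000000000000000000000000000000000000000000000000000000000000000000000000000000000000000007c7c7c7c7c000000bcbcbcbcbc000000dcdcdcdcdc000000ececececec000000f4f4f4f4f4000000f8f8f8f8f80000000000000000000000000000000000007c007c7c7c7c0000bc00bcbcbcbc0000dc00dcdcdcdc0000ec00ecececec0000f400f4f4f4f40000f800f8f8f8f80000000000000000000000000000000000007c7c007c7c7c0000bcbc00bcbcbc0000dcdc00dcdcdc0000ecec00ececec0000f4f400f4f4f40000f8f800f8f8f80000000000000000000000000000000000007c7c7c007c7c0000bcbcbc00bcbc0000dcdcdc00dc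dc0000ececec00ecec0000f4f4f400f4f40000f8f8f800f8f80000000000000000000000000000000000007c7c7c7c007c0000bcbcbcbc00bc0000dcdcdcdc00dc0000ecececec00ec0000f4f4f4f400f40000f8f8f8f800f80000000000000000000000000000000000007c7c7c7c7c000000bcbcbcbcbc000000dcdcdcdcdc000000ececececec000000f4f4f4f4f4000000f8f8f8f8f8000000000000000000000000000000000000000000000000000000000000000000000000000000000000000000000000000000000000000000000000000000000000000000000000000000000000000000000000000000000000000000000000000000000000000000000000000000000000000000000000000000000000000000000000000000000000000000000000000000

/-- Path systems of `Q 4` with one path from `0` to `1` and three further paths. Up to the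
automorphisms in `stabTabs` these are all the systems of this form, as far as their ends are
concerned. -/
def systems4 : List ℕ :=
  [0x81deb5212d638d0216021c020, 0x81cce7ad484c08c696021c020, 0x81cce7b5884ad50216021c020,
   0x81cce52d28635f0216021c020, 0x8218d79cce52d30216021c020, 0x8218e31ded4ad50216021c020,
   0x8212d639f0218e58094b1c020, 0x82de73398d4a150216021c020, 0x82d4e7b590218e5808700a500,
   0x82d484b58e31df0216021c020, 0x8394b4a18d7c086396021c020, 0x81deb4a14e634b021a021c020,
   0x81cad639eb5213021a021c020, 0x81cad7b9884ad5021a021c020, 0x81cad640868094e7ac700a500,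
   0x81cad4ad48639f021a021c020, 0x8212d639e72c0868094b1c020, 0x8218e7b52b5408539a021c020,
   0x8212b539ed6408539a021c020, 0x8212d639f0214e68094b1c020, 0x82d484b58e79cb021a021c020,
   0x82ded639484c08539a021c020, 0x82dee635285408539a021c020, 0x82d4e7b590214e6808700a500,
   0x82d484b58e7c08539a021c020, 0x834b0231095a9cf39a021c020, 0x8358e7ad484c08539a021c020,
   0x835884ad50214ef71a021c020, 0x8352852dee6408539a021c020, 0x8352b5218e7c08539a021c020,
   0x839e72c086809486352b1c020, 0x839eb52130231a539a021c020, 0x839ed6212b5408539a021c020,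
   0x839484aded6408539a021c020, 0x8394b4a18d7c08539a021c020, 0x81cd0215ac73d6a426021c020,
   0x81cce7ad50215ac426021c020, 0x81cad6408673d6a426021c020, 0x81cce52df0215ac426021c020,
   0x8218d2c0863bdca5a6021c020, 0x8214e3408c694ef5a6021c020, 0x82190215af72969808c71c020,
   0x8218d7c085399ca5a6021c020, 0x82de7340856b1ca426021c020, 0x82ded64085399ca426021c020,
   0x82df0215ac72909808c71c020, 0x83590214e673d6a426021c020, 0x835f0214e6731098094b1c020,
   0x8394b7c0856b109808c71c020, 0x81dee340856b1095aa021c020, 0x81cad62130219cf5aa021c020,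
   0x81cad6408673d6a808700a500, 0x81cce7c0856b1095aa021c020, 0x8218e340853bda95aa021c020,
   0x82190214e673da95aa021c020, 0x8218e7c0856a56a808c71c020, 0x82de72c086731a942a021c020,
   0x82d2d29dee3408c42a021c020, 0x82dee640856a50a808c71c020, 0x82df0214e6731a942a021c020,
   0x834b0218ef731095aa021c020, 0x834a77b8d0231095aa021c020, 0x835884c085399cf5aa021c020,
   0x8352864085399cf5aa021c020, 0x835f0214e6731095aa021c020, 0x839ed2c08c4256a808c71c020,
   0x838d0214ef6b1095aa021c020, 0x839884c0856bd6a808c71c020, 0x83990215af5aa0231c700a500,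
   0x838c77c0856b1095aa021c020, 0x81deb4a14e340856b2021c020, 0x81cce7ad50215a9432021c020,
   0x81cce5212b7c0856b2021c020, 0x8212b539f0218e56b2021c020, 0x82d4e7b4a73408c808700a500,
   0x82d2854085399cf6b2021c020, 0x82df0214e6729096b2021c020, 0x834b0218ef5a50a732021c020,
   0x834a73408c8094e7ac700a500, 0x835eb52130214e6732021c020, 0x834a7339eb5408c808700a500,
   0x8352852df0214e6732021c020, 0x838c72c08c809484b5eb1c020, 0x838d0214ef5a9096b2021c020,
   0x839eb52130218e56b2021c020, 0x838c77ad28540856b2021c020, 0x839484adf0218e56b2021c020,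
   0x81cd0215ac73e025212b1c020, 0x81cad6212b5408673e021c020, 0x81cad6408673e025212b1c020,
   0x82d484b4a73408c73e021c020, 0x82d28540856b1cf808c71c020, 0x82d484b590214e673e021c020,
   0x834a73408c73e025212b1c020, 0x835884ad50214e673e021c020, 0x8352b52190214e673e021c020,
   0x838c72c08c6be025212b1c020, 0x838d0214ef809486352b1c020, 0x8398852d30215af808c71c020,
   0x839884ad50215af808c71c020, 0x8394b4a190215af808c71c020, 0x82dee610ad4a15039a021c020,
   0x82d4e7b59039486808700a500, 0x82d484b4a4639f039a021c020, 0x8352852dee640e521a021c020,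
   0x834a46212b539f039a021c020, 0x8394b4a1842b5f039a021c020, 0x82dee340e5231a942a021c020,
   0x82dee640e6215a942a021c020, 0x82df0399cc6a50a8087009480, 0x83528640e673d6a8087009480,
   0x835f0399cc4256a8087009480, 0x839f0398856b1095aa021c020, 0x82df0399ca425ac8087009480,
   0x834a4340ef732025212b1c020, 0x835eb4a150399cc8087009480, 0x8352852df0399cc8087009480,
   0x838d03bdac809484ac7009480, 0x839eb4a150398856b2021c020, 0x839484adf0398856b2021c020,
   0x8352b521903948673e021c020, 0x838d03948c429696be021c020, 0x839884ad50398856be021c020,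
   0x8394b4a190398856be021c020, 0x838c429df06a56a432021c020, 0x838c7291906a50a5be021c020,
   0x81cd02310958e02539ed2c020, 0x82150231cf6a563808c72c020, 0x8212d7c08c72963808c72c020,
   0x82d286408638e02539ed2c020, 0x82df0218e38094e634b00a500, 0x839f0231a942963808c72c020,
   0x81c7021a0252dee634b00a500, 0x81c6b4c08680948639ed2c020, 0x81dee540868086b4a18d2c020,
   0x81c6b4a19021a02539ed2c020, 0x81df021a021ad4e634b00a500, 0x8218d4ac7021a02539e72c020,
   0x8218e7b52b54086808672c020, 0x8212b539ed64086808672c020, 0x8214b4b58e7c086808672c020,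
   0x82c7021a025212d639e72c020, 0x82ded639484c086808672c020, 0x82dee6352854086808672c020,
   0x82d4e7b59021a0219cb00a500, 0x82d484b58e7c086808672c020, 0x8352b1c08680948639e72c020,
   0x8358e7ad484c086808672c020, 0x835ee6212b54086808672c020, 0x8352852dee64086808672c020,
   0x8352b5218e7c086808672c020, 0x839e71c0868094b4a18d2c020, 0x8398d7ad484c086808672c020,
   0x839ed6212b54086808672c020, 0x839484aded64086808672c020, 0x8394b4a18d7c086808672c020,
   0x81cd0231098086b539ed2c020, 0x81c6b5408c42602339ed2c020, 0x8214e7ac70231a9808c72c020,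
   0x8214e3408c6bd69808672c020, 0x82150231a98086b7b8c72c020, 0x8218d7c08672969808672c020,
   0x82c673408c42602539ed2c020, 0x82d50219cf6b109808672c020, 0x82df0219ca431a9808672c020,
   0x835eb538d023109808672c020, 0x835f0231098086b538c72c020, 0x839f0231a9808c72c0235a900,
   0x81cd0231ca8086b7b4b00a500, 0x81c6b4c08c42a02339ed2c020, 0x81df0219ca8086b4a18d2c020,
   0x82190219cf6a56a808672c020, 0x8218d4adf0219ca808672c020, 0x82c70231cf6a50a808c72c020,
   0x82dee3408c6a50a808672c020, 0x82d30219cf6b10a808672c020, 0x82ded6408672a0219cb00a500,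
   0x82df0219cc6a50a808672c020, 0x835eb1c08c72a0231cb00a500, 0x835ee3408c4256a808672c020,
   0x835302310a8086b7b8c72c020, 0x835286408673d6a808672c020, 0x835f0231ca808c72c0235a500,
   0x839eb1c08c6a50a808c72c020, 0x838d0231af5aa0219cb00a500, 0x838c77c08c42a021ad2d2c020,
   0x81cd0232021ad4e7b4b00a500, 0x81c6b5213023202339ed2c020, 0x81c6b5408c808ce7b4b00a500,
   0x81df0219cc8086b5212d2c020, 0x8214b4b5ee3408c808672c020, 0x82150232021ad2d7b8c72c020,
   0x8212d7c08c8086b538c72c020, 0x82c702320231cb00a5af72900, 0x82d484b5ee3408c808672c020,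
   0x82d484c08673dac808672c020, 0x82d285408673dac808672c020, 0x82df0219ca425ac808672c020,
   0x835ee3408c808672c0295a900, 0x835302320231cb008d6f72900, 0x835ee5408c808c72c0235a500,
   0x835f0232021ad4e31cb00a500, 0x839ed4a14b1c08c808c72c020, 0x838d02320219cb00a5af5a900,
   0x839ed4c08c808c72c0235a900, 0x839502320231cb008d6f6a500, 0x838c77c08c8086b5212d2c020,
   0x81cd0231cf8086b5212d2c020, 0x81c6b4c08673e025218d2c020, 0x8212b538d0231af808672c020,
   0x8218d4ad50219cf808672c020, 0x8214b4b590219cf808672c020, 0x82d4e3408c6be0219cb00a500,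
   0x82d4863530219cf808672c020, 0x82d2d62150219cf808672c020, 0x82d484b590219cf808672c020,
   0x83530231cf808c72c0235a900, 0x835884ad50219cf808672c020, 0x8352b52190219cf808672c020,
   0x8394b1c08c6be0231cb00a500, 0x838d0231af808672c0295a900, 0x83950231af808c72c0235a500,
   0x83990218ef8086b5212d2c020, 0x821503bdc68086b4b5842c020, 0x8214e7c0e68086b4b5842c020,
   0x83528540e68086b7b9842c020, 0x835f039a021ad4e610b00a500, 0x839f039a021ad484b5842c020,
   0x82184340e35a602539ed2c020, 0x8218d7b95038d69808c42c020, 0x8214e7b59038d69808c42c020,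
   0x8214e635f038d69808c42c020, 0x835ee340e35a602521842c020, 0x835ee6215038d69808c42c020,
   0x835ee640e35a909808c42c020, 0x8358e7c0e35a909808c42c020, 0x838d03bda98086b521842c020,
   0x8395038d6f6b109808c42c020, 0x839ed640e35a909808c42c020, 0x8398d7c0e35a909808c42c020,
   0x8212d7b99038d6a808c42c020, 0x8212d639f038d6a808c42c020, 0x835ee6213038d6a808c42c020,
   0x835ee640e35aa02310b00a500, 0x83528639f038d6a808c42c020, 0x839ed6213038d6a808c42c020,
   0x839ed4a19038d6a808c42c020, 0x839884b5f038d6a808c42c020, 0x8215038d696bdcc808c42c020,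
   0x8214e7c0e35a5ac808c42c020, 0x835303bdcc808c42c0235a900, 0x83528540e35bdcc808c42c020,
   0x835f038d6a73202310b00a500, 0x839484c0e35bdac808c42c020, 0x8395038d6f6b202310b00a500,
   0x839f038d6a425ac808c42c020, 0x8215038d696b1cf808c42c020, 0x8212d640e35a9cf808c42c020,
   0x8353038d6a431cf808c42c020, 0x8358e540ef808c42c0235a500, 0x83528640e35a9cf808c42c020,
   0x838d03be021ad484b5842c020, 0x8398d4c0ef808c42c0235a900, 0x8395038d69431af808c42c020,
   0x8399038d6a425af808c42c020, 0x82dee6353042a0219cc42c020, 0x82d2d7b99042a0219cc42c020,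
   0x82d2d639f042a0219cc42c020, 0x83530431cf5aa0219cc42c020, 0x835ee641095aa0219cc42c020,
   0x8358e7c1095aa0219cc42c020, 0x8398d7ad3042a0219cc42c020, 0x839ed641095aa0219cc42c020,
   0x8398d7c1095aa0219cc42c020, 0x82d30429cf6b20219cc42c020, 0x82dee541096b20219cc42c020,
   0x82d4e7c1096b20219cc42c020, 0x8352b7b9504320219cc42c020, 0x835f04256a7320219cc42c020,
   0x8394b7b5304320219cc42c020, 0x839504256f6b20219cc42c020, 0x8394b7c1096b20219cc42c020,
   0x82d50425ac73e0219cc42c020, 0x82d2d6410a73e0219cc42c020, 0x8352b5410c73e0219cc42c020,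
   0x835904256a73e0219cc42c020, 0x8394b4c10c6be0219cc42c020, 0x83950431a95be0219cc42c020,
   0x83990429696be0219cc42c020, 0x835ee6416942a0219cc42c020, 0x83528639f05aa0219cc42c020,
   0x839ed4a1905aa0219cc42c020, 0x839884b5f05aa0219cc42c020, 0x835285416f7320219cc42c020,
   0x835f05a9cc80867310b00a500, 0x839f05a9096b20219cc42c020, 0x8358e5416f80867310b00a500,
   0x839505a50c6be0219cc42c020, 0x839905a9096be0219cc42c020, 0x839f06b1095aa0219cc42c020,
   0x839884ad506be0219cc42c020, 0x81c70215af731095aa0234020, 0x81cb0231a942a021adee34020,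
   0x81c6b4c0856bdcc42a0234020, 0x81c6b7b990215a942a0234020, 0x81df0215ac72a02340235a500,
   0x82190215a95aa0219dee34020, 0x8218e7c0856a56a8086734020, 0x82c70214ef731a942a0234020,
   0x82c672c08c73da942a0234020, 0x82d30215ac42a0219dee34020, 0x82dee640856a50a8086734020,
   0x82df0215ac72a0219cd00a500, 0x834a71c08c73d6a808d00a500, 0x834b0231095aa0219dee34020,
   0x835ee62130214e35aa0234020, 0x835ee6408538d6a808d00a500, 0x83528639f0214e35aa0234020,
   0x839e71c0856b1095aa0234020, 0x839ed2c08c4256a8086734020, 0x839884c0856bd6a8086734020,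
   0x83990215af5aa0219cd00a500, 0x839f0215ac4256a8086734020, 0x81dee5212b1c0856b20234020,
   0x81c6b4a14e7b4b02320234020, 0x81c6b52130215af7320234020, 0x81c6b540856bdcc808d00a500,
   0x81c6b4a14e7c0856b20234020, 0x8212b7b950215ac8086734020, 0x8212b539f0215ac8086734020,
   0x82c70215a943202539e734020, 0x82c672c08c809484b5ee34020, 0x82dee52130215ac8086734020,
   0x82d28540856bdcc8086734020, 0x82d28539f0215ac8086734020, 0x834a71c08c809484adee34020,
   0x834b0232021ad28539e734020, 0x83530214e35bdca4320234020, 0x835285408538d6f7320234020,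
   0x835f0214e35a50a7320234020, 0x839ed29c7023202340295a900, 0x839ed4a14b19cb02320234020,
   0x839eb52130215ac8086734020, 0x839eb4a150215ac8086734020, 0x839f0232021ad484b4a734020,
   0x81c70215ac73e02340295a900, 0x81c6b5212d2c08c73e0234020, 0x81c6b52130215ac73e0234020,
   0x81c6b540856b1cf808d00a500, 0x81c6b53990215af808d00a500, 0x82190215a95a9cf8086734020,
   0x82c70231cf809484b4a734020, 0x82d484b4b0231cf8086734020, 0x82d484c0856b1cf8086734020,
   0x82d28540856b1cf8086734020, 0x82d4e640856be0219cd00a500, 0x834a71c08c73e02340295a900,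
   0x834b0231cf809484ac6734020, 0x83530214e35a90c73e0234020, 0x834a71ad50231cf808d00a500,
   0x835286408538d6a73e0234020, 0x8398d4a14b1c0853be0234020, 0x8394b19cb0231af808d00a500,
   0x839884c0856be0252c6734020, 0x83950214e35a50c6be0234020, 0x83990214e35a9096be0234020,
   0x8219038e02539eb4b4a434020, 0x8214b4b58e7c0e3808d009480, 0x82dee610ad4a15038e0234020,
   0x82d28539ed640e3808d009480, 0x82df038e02539884b4a434020, 0x834a4640ef7290958e0234020,
   0x834a46212b539f038e0234020, 0x839f038e0252d28634a434020, 0x8214e7c0e58086b4b58434020,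
   0x83528540e58086b7b98434020, 0x835f0396021ad285398434020, 0x839f0396021ad484b58434020,
   0x8219038d698094e7b4a434020, 0x8214e7c0e35a602340256b080, 0x835eb1c0e5231ca4260234020,
   0x835ee6215038d69808d009480, 0x835ee640e35a909808d009480, 0x834a4639f038d6a4260234020,
   0x8394b1c0ef6b109808d009480, 0x839ed610b038d6a4260234020, 0x8395038d6f6b109808d009480,
   0x839ed2919038d6a4260234020, 0x839842b5f038d6a4260234020, 0x8212d7b99038d6a808d009480,
   0x8212d639f038d6a808d009480, 0x82c703bdcc6a50a808d009480, 0x8352b1c0ef7310a808d009480,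
   0x835ee610b038d6a808d00a500, 0x835ee6213038d6a808d009480, 0x835ee640e35a50a808d009480,
   0x83528639f038d6a808d009480, 0x839eb1c0e5231a942a0234020, 0x839ed610b038d6a808d00a500,
   0x839ed6213038d6a808d009480, 0x839ed4a19038d6a808d009480, 0x839884b5f038d6a808d009480,
   0x8214e7c0e35a5ac808d009480, 0x82c703bdca425ac808d009480, 0x8352852c703bdcc808d009480,
   0x8353038d6f7290c808d009480, 0x83528540e35bdcc808d009480, 0x835f038d69429cc808d009480,
   0x839484ac703bdac808d009480, 0x839484c0e35bdac808d009480, 0x8395038d6f6a50c808d009480,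
   0x839f038d6a425ac808d009480, 0x8214e640ef8086b4b4a434020, 0x82c703be02539884b4a434020,
   0x8352852c703948c73e0234020, 0x834b03be021ad285398434020, 0x834a46213038d6a73e0234020,
   0x835286395038d6f808d009480, 0x834a4640e35a50a73e0234020, 0x8398d4a14b1c0ef808d009480,
   0x839484b5842c0e35be0234020, 0x839484c0e35be02340256b080, 0x839503be021ad28634a434020,
   0x839903be021ad484b4a434020, 0x82c70425a523202539e734020, 0x82dee541096948c8086734020,
   0x82d4e7c1096948c8086734020, 0x839e71c10c8094b4b4a434020, 0x839504256f6948c8086734020,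
   0x8394b7c1096948c8086734020, 0x82d2d610a71c10a73e0234020, 0x82d2d610b0429cf8086734020,
   0x82d30429cf808672b58434020, 0x82d50425ac73e0219ca434020, 0x82d2d6410a73e0219ca434020,
   0x8358429c704256a73e0234020, 0x835842c1095a9cf8086734020, 0x83530431cf8094b19ca434020,
   0x8352b5410c73e0219ca434020, 0x834a4641095a9cf8086734020, 0x8398429c70429696be0234020,
   0x839842c1096be0252c6734020, 0x8394b4c10c6be0219ca434020, 0x83950431af808d00a56339480,
   0x83990425af8094b19ca434020, 0x83528641638094e79ca434020, 0x835f05a50a7308538e0234020,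
   0x839f058e025212d610a734020, 0x835e71c16a73085808d00a500, 0x835285416f730858086734020,
   0x835f05a9cc2160219cd00a500, 0x839e71c16a425ac2160234020, 0x839484c16f6b0858086734020,
   0x839505bdac2160219cd00a500, 0x839f05a9096b0858086734020, 0x834a46416f729098086734020,
   0x834a4639f05a9098086734020, 0x839ed291905a9098086734020, 0x839842b5f05a9098086734020,
   0x8358429c705bdca808d00a500, 0x834a4621305bdca8086734020, 0x835ee6416942a0219ca434020,
   0x834a4639f05a50a8086734020, 0x839ed610a71c16942a0234020, 0x839ed610b05a50a8086734020,
   0x839ed621305aa0219ca434020, 0x839ed291905a50a8086734020, 0x839842b5f05a50a8086734020,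
   0x835e71c169429cc808d009480, 0x835285416f7320219ca434020, 0x835f05a9cc80867290d00a500,
   0x839e71c16a425ac808d009480, 0x839484c16f6b20219ca434020, 0x839505bdac80867290d00a500,
   0x839f05a9096b20219ca434020, 0x8358429c705a50a73e0234020, 0x834a4621305a9cf8086734020,
   0x83528541633948c73e0234020, 0x834a464169429cf8086734020, 0x839484b58429c705be0234020,
   0x839484b5842c16f8086734020, 0x839484c16f808672b58434020, 0x839505a50c215af8086734020,
   0x839484b4a46416f8086734020, 0x839842c1af38e02340295a900, 0x839eb521306b08538e0234020,
   0x839eb4a1506b08538e0234020, 0x8394b4a1906bce3808d009480, 0x839484adf06b08538e0234020,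
   0x839f06a6021ad48610a734020, 0x839e71c1ac4256a808d009480, 0x839842c1af5aa0219cd00a500,
   0x839884c1af5aa0219ca434020, 0x839906bd6a80867290d00a500, 0x839f06b1095aa0219ca434020,
   0x839e71c1a95a90c808d009480, 0x839eb521306948c8086734020, 0x839eb4a1506948c8086734020,
   0x839484adf06948c8086734020, 0x8398429c706a50a5be0234020, 0x839842c1a94296f8086734020,
   0x8398429c6b521306be0234020, 0x839506be021ad28610a734020, 0x8394b4a1906be0219ca434020,
   0x81cd0215a942a021adee64020, 0x81c6b7c0856a50a808ce64020, 0x8212b7c08672a0219cad64020,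
   0x82df0219ca808672b5900a500, 0x81cd0215af8086b539900a500, 0x81c6b52130215af808ce64020,
   0x81c6b540856be02339900a500, 0x82c672c08673e025212d64020, 0x82c67340856be02539900a500,
   0x82d285408673e0219cad64020, 0x8352852c70214ef808ce64020, 0x835285408538d6f808ce64020,
   0x838c71c0856be0252d2864020, 0x838d0214ef8086b5212d64020, 0x838c71ad30215af8094864020,
   0x83950218e56be021ad2864020, 0x835eb1c0e521a02539900a500, 0x83528540e521a021adee64020,
   0x835f0394868086b539900a500, 0x839eb1c0e521a025212d64020, 0x839484c0e521a021aded64020,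
   0x83950394868086b7b5900a500, 0x839f0394868086b5212d64020, 0x835ee340e35a6025219009480,
   0x835f038d6a426023399009480, 0x839f038d6a42602310ad64020, 0x834a4340ef72a021ad2864020,
   0x835f038d6942a023399009480, 0x839eb1c0e56a50a808c464020, 0x839ed2c0e35aa02311900a500,
   0x839f038d6a808c42b5900a500, 0x8352852c703be023399009480, 0x834a4340ef8086b539900a500,
   0x83528540e35be023399009480, 0x8394b1c0ef808c42b5900a500, 0x838c42c0ef8086b5212d64020,
   0x838d03be021ad484b59009480, 0x839484c0e35be02310ad64020, 0x839503be02310ad640235a500,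
   0x839f06948638e0252d2864020, 0x839e71c1a521a0252d2864020, 0x839e71ad30694868094864020,
   0x8395069486808677ad2864020, 0x839f06a56339a025219009480, 0x838c71c1af8094b4a19009480,
   0x838c42c1a958cef8094864020, 0x838d06be0252d286402339480, 0x83528540e5231c68086b7c020,
   0x83528640e521a021ad4e7c020, 0x839842c0e68086b5212d7c020, 0x839484c0e56b0868086b7c020,
   0x83950394868086b4a18d7c020, 0x83990394868086b5212d7c020, 0x83528640e35aa02339f009480,
   0x838d03948c42a021ad2d7c020, 0x839884c0e35aa02310ad7c020, 0x8399038d6a808c42b5f00a500,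
   0x834a4340e35a50c8094e7c020, 0x83528540e6732021adf009480, 0x838d03948c8086b5212d7c020,
   0x839484c0e6215ac8086b7c020, 0x8395038d6943202310ad7c020, 0x839484c1ac214e68086b7c020,
   0x839506b08539a021adf00a500, 0x8394b4a19069486808677c020, 0x838c71c1a94320252df009480,
   0x838d06a50c8094b7c02339480, 0x835ee6416942a07290d008c40, 0x83528639f058c4a81ca434020,
   0x839884b5f058c4a81ca434020, 0x835285416f73207290d008c40, 0x835f05a50a73207290d008c40,
   0x839f05a9096b207290d008c40, 0x839505a50c215af81c6234020, 0x8399058c4a425af81ca434020,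
   0x835f058c4681ca4639500a500, 0x839f058c4681ca46352854020, 0x834a434169432077b95008c40,
   0x835f05a50c81ca43395008c40, 0x839f058c46232072b52854020, 0x838d05be072918d4a15008c40,
   0x839905be07310ad4a15008c40, 0x839906be07290c21ad500a500]

/-- The image of a pair under a table. -/
def appP (P : ℕ) (p : Pair) : Pair := (app P p.1, app P p.2)

/-- Position in `table4` belonging to the number `e = normTab`-entry of a pair and to two further
pairs. -/
def index4 (e a b : ℕ) : ℕ :=
  Nat.add (Nat.shiftLeft (Nat.land e 15) 12) (Nat.add a (Nat.shiftLeft b 6))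

/-- Look up whether the pairs `{0, 1}`, `q`, `r`, `s` are joined by a path system of `Q 4`. -/
def look (q r s : Pair) : Bool :=
  force (byte normTab (codeP q)) fun e => force (subTab stabTabs (Nat.shiftRight e 4)) fun P =>
    hasBit table4 (index4 e (codeP (appP P r)) (codeP (appP P s)))

/-- The position of the lowest nonzero digit of `1`, `2`, `4` or `8`. -/
def lg (d : ℕ) : ℕ := Nat.land (Nat.shiftRight 0x30002010 (Nat.shiftLeft (Nat.sub d 1) 2)) 15

/-- Look up whether the edge `p` and the pairs `q`, `r`, `s` are joined by a path system of `Q 4`.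
-/
def lookEdge (p q r s : Pair) : Bool :=
  force (subTab edgeTabs (Nat.add (Nat.shiftLeft (lg (Nat.xor p.1 p.2)) 4) p.1)) fun P =>
    look (appP P q) (appP P r) (appP P s)

/-- Force both entries of a pair. -/
def forceP {α : Type} (p : Pair) (f : Pair → α) : α :=
  force p.1 fun x => force p.2 fun y => f (x, y)

@[simp] theorem forceP_eq {α : Type} (p : Pair) (f : Pair → α) : forceP p f = f p := by
  simp [forceP]

/-- An odd pair of vertices of `Q 4`. -/
def Odd4 (p : Pair) : Prop := p.1 < 16 ∧ p.2 < 16 ∧ par p.1 ≠ par p.2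

/-- Test for `Odd4`. -/
def oddB (p : Pair) : Bool :=
  sel (Nat.blt p.1 16) (sel (Nat.blt p.2 16) (sel (Nat.beq (par p.1) (par p.2)) false true) false)
    false

theorem odd4_iff {p : Pair} : oddB p = true ↔ Odd4 p := by
  rw [oddB, sel_false_right, sel_false_right, Nat.blt_eq, Nat.blt_eq, Odd4]
  refine and_congr_right' (and_congr_right' ?_)
  cases h : Nat.beq (par p.1) (par p.2)
  · simpa using Nat.ne_of_beq_eq_false h
  · simpa using Nat.eq_of_beq_eq_true h

/-- Iterate `f` over the numbers below `n`. -/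
def foldN (n acc : ℕ) (f : ℕ → ℕ → ℕ) : ℕ := Nat.rec acc (fun k ih => force ih fun a => f k a) n

theorem foldN_induction {C : ℕ → Prop} {n acc : ℕ} {f : ℕ → ℕ → ℕ} (h₀ : C acc)
    (h : ∀ k < n, ∀ a, C a → C (f k a)) : C (foldN n acc f) := by
  induction n with
  | zero => exact h₀
  | succ n ih =>
    change C (force (foldN n acc f) fun a => f n a)
    rw [force_eq]
    exact h n (Nat.lt_succ_self n) _ (ih fun k hk => h k (hk.trans (Nat.lt_succ_self n)))

/-- Add to `acc` the digits of `table4` which come from the system of pairs `{0, 1}`, `q`, `r`, `s`,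
by normalising the pair `q`. -/
def addTriple (acc : ℕ) (q r s : Pair) : ℕ :=
  foldN 12 acc fun j acc => force (subTab stabTabs j) fun P =>
    force (codeP (appP P q)) fun a => force (byte normTab a) fun e =>
      sel (Nat.beq (byte repTab (Nat.land e 15)) a)
        (force (codeP (appP P r)) fun b => force (codeP (appP P s)) fun c =>
          Nat.lor acc (Nat.lor (single (index4 e b c)) (single (index4 e c b)))) acc

/-- Add to `acc` the digits of `table4` which come from four pairs. -/
def addPairs (acc : ℕ) (L : List Pair) : ℕ :=
  match L with
  | [p, q, r, s] =>
    forceP q fun q => forceP r fun r => forceP s fun s =>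
      sel (sel (Nat.beq p.1 0) (sel (Nat.beq p.2 1) (sel (oddB q) (sel (oddB r) (oddB s) false)
        false) false) false)
        (force (addTriple acc q r s) fun acc => force (addTriple acc r q s) fun acc =>
          addTriple acc s q r) acc
  | _ => acc

/-- The table computed from `systems4`. -/
def buildTable : ℕ :=
  List.rec 0 (fun m _ ih => force ih fun acc =>
    (fun P => sel (goodSys 4 P) (addPairs acc (P.map ends)) acc) (decodeSys 4 m)) systems4

theorem buildTable_eq : buildTable = table4 := by
  have h : Nat.beq buildTable table4 = true := by decide +kernel
  exact Nat.eq_of_beq_eq_true h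

/-- Every digit of `T` corresponds to a path system. -/
def TableOk (T : ℕ) : Prop :=
  ∀ k < 16, ∀ a < 64, ∀ b < 64, Nat.testBit T (4096 * k + (a + 64 * b)) = true →
    Linked 4 [(0, 1), pairOf (byte repTab k), pairOf a, pairOf b]

theorem index4_eq (e a b : ℕ) : index4 e a b = 4096 * (e % 16) + (a + 64 * b) := by
  change (e &&& (2 ^ 4 - 1)) <<< 12 + (a + b <<< 6) = _
  rw [Nat.and_two_pow_sub_one_eq_mod, Nat.shiftLeft_eq, Nat.shiftLeft_eq]
  ring

theorem codeP_spec {p : Pair} (hp : Odd4 p) : codeP p < 64 ∧ SameEnds p (pairOf (codeP p)) := by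
  have h : allN 16 (fun x => allN 16 fun y => sel (Nat.beq (par x) (par y)) true
      (sel (Nat.blt (codeP (x, y)) 64) ((fun q : Pair =>
        sel (sel (Nat.beq q.1 x) (Nat.beq q.2 y) false) true
          (sel (Nat.beq q.1 y) (Nat.beq q.2 x) false)) (pairOf (codeP (x, y)))) false)) = true := by
    decide +kernel
  obtain ⟨x, y⟩ := p
  obtain ⟨h1, h2, h3⟩ := hp
  have := allN_iff.1 (allN_iff.1 h x h1) y h2
  have h3' : Nat.beq (par x) (par y) = false := by
    rw [← Bool.not_eq_true, Nat.beq_eq]; exact h3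
  rw [h3', sel_false, sel_false_right, Nat.blt_eq, sel_true_left, sel_false_right, sel_false_right]
    at this
  simp only [Nat.beq_eq] at this
  refine ⟨this.1, ?_⟩
  rcases this.2 with ⟨h4, h5⟩ | ⟨h4, h5⟩
  · exact Or.inl (Prod.ext h4 h5)
  · exact Or.inr (Prod.ext h4 h5)

theorem stabTabs_aut {j : ℕ} (hj : j < 12) : IsAut 4 (app (subTab stabTabs j)) ∧
    SameEnds (appP (subTab stabTabs j) (0, 1)) (0, 1) := by
  have h : allN 12 (fun j => sel (checkAut 4 (subTab stabTabs j))
      (sel (sel (Nat.beq (app (subTab stabTabs j) 0) 0) (Nat.beq (app (subTab stabTabs j) 1) 1)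
        false) true (sel (Nat.beq (app (subTab stabTabs j) 0) 1)
          (Nat.beq (app (subTab stabTabs j) 1) 0) false)) false) = true := by
    decide +kernel
  have := allN_iff.1 h j hj
  rw [sel_false_right, sel_true_left, sel_false_right, sel_false_right] at this
  simp only [Nat.beq_eq] at this
  refine ⟨isAut_of_check this.1, ?_⟩
  rcases this.2 with ⟨h4, h5⟩ | ⟨h4, h5⟩
  · exact Or.inl (Prod.ext h4.symm h5.symm)
  · exact Or.inr (Prod.ext h5.symm h4.symm)

theorem mapPair_app (P : ℕ) : mapPair (app P) = appP P := rfl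

theorem IsAut.odd4 {P : ℕ} (hg : IsAut 4 (app P)) {p : Pair} (hp : Odd4 p) : Odd4 (appP P p) :=
  ⟨hg.lt _ hp.1, hg.lt _ hp.2.1, hg.par _ hp.1 _ hp.2.1 hp.2.2⟩

theorem linked_codeP {q r s : Pair} (hq : Odd4 q) (hr : Odd4 r) (hs : Odd4 s)
    {p : Pair} (hp : SameEnds p (0, 1)) :
    Linked 4 [p, q, r, s] ↔
      Linked 4 [(0, 1), pairOf (codeP q), pairOf (codeP r), pairOf (codeP s)] := by
  have h : SameSys [p, q, r, s]
      [(0, 1), pairOf (codeP q), pairOf (codeP r), pairOf (codeP s)] :=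
    .cons hp (.cons (codeP_spec hq).2 (.cons (codeP_spec hr).2 (.cons (codeP_spec hs).2
      (.refl []))))
  exact ⟨h.linked, h.symm.linked⟩

/-- Every digit added by `addTriple` comes from a path system, because the pair `q` is moved to its
representative by an automorphism that preserves the edge `{0, 1}`. -/
theorem TableOk.addTriple {T : ℕ} (hT : TableOk T) {q r s : Pair} (hq : Odd4 q) (hr : Odd4 r)
    (hs : Odd4 s) (h : Linked 4 [(0, 1), q, r, s]) : TableOk (addTriple T q r s) := by
  refine foldN_induction hT fun j hj A hA => ?_
  simp only [force_eq]
  obtain ⟨haut, hfix⟩ := stabTabs_aut hj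
  set P := subTab stabTabs j
  have hmap := h.map haut
  simp only [List.map_cons, List.map_nil, mapPair_app] at hmap
  rw [linked_codeP (haut.odd4 hq) (haut.odd4 hr) (haut.odd4 hs) hfix] at hmap
  have hb := (codeP_spec (haut.odd4 hr)).1
  have hc := (codeP_spec (haut.odd4 hs)).1
  generalize codeP (appP P q) = a at *
  generalize codeP (appP P r) = b at *
  generalize codeP (appP P s) = c at *
  cases hsel : Nat.beq (byte repTab (Nat.land (byte normTab a) 15)) a
  · exact hA
  rw [sel_true]
  have ha := Nat.eq_of_beq_eq_true hsel
  intro k hk x hx y hy hbit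
  have he : Nat.land (byte normTab a) 15 = byte normTab a % 16 :=
    Nat.and_two_pow_sub_one_eq_mod _ 4
  rw [he] at ha
  change Nat.testBit (A ||| (single (index4 (byte normTab a) b c) |||
    single (index4 (byte normTab a) c b))) _ = true at hbit
  rw [Nat.testBit_or, Nat.testBit_or, single_eq, single_eq, Nat.testBit_two_pow,
    Nat.testBit_two_pow, index4_eq, index4_eq] at hbit
  simp only [Bool.or_eq_true, decide_eq_true_iff] at hbit
  have hmod : byte normTab a % 16 < 16 := Nat.mod_lt _ (by norm_num)
  rcases hbit with hbit | hbit | hbit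
  · exact hA k hk x hx y hy hbit
  · obtain ⟨rfl, rfl, rfl⟩ : k = byte normTab a % 16 ∧ x = b ∧ y = c := by omega
    rw [ha]; exact hmap
  · obtain ⟨rfl, rfl, rfl⟩ : k = byte normTab a % 16 ∧ x = c ∧ y = b := by omega
    rw [ha]; exact hmap.perm (.cons _ (.cons _ (.swap _ _ _)))

theorem TableOk.addPairs {T : ℕ} (hT : TableOk T) {L : List Pair} (hL : Linked 4 L) :
    TableOk (addPairs T L) := by
  unfold Hypercube.addPairs
  split
  · rename_i p q r s
    simp only [forceP_eq, force_eq]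
    cases hsel : sel (Nat.beq p.1 0) (sel (Nat.beq p.2 1) (sel (oddB q) (sel (oddB r) (oddB s)
      false) false) false) false
    · exact hT
    rw [sel_false_right, sel_false_right, sel_false_right, sel_false_right, Nat.beq_eq, Nat.beq_eq,
      odd4_iff, odd4_iff, odd4_iff] at hsel
    obtain ⟨h0, h1, hq, hr, hs⟩ := hsel
    obtain rfl : p = (0, 1) := Prod.ext h0 h1
    exact ((hT.addTriple hq hr hs hL).addTriple hr hq hs
      (hL.perm (.cons _ (.swap _ _ _)))).addTriple hs hq hr
      (hL.perm (.cons _ ((List.Perm.cons _ (.swap _ _ _)).trans (.swap _ _ _))))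
  · exact hT

/-- The table is built from `systems4` by steps that preserve `TableOk`. -/
theorem tableOk_table4 : TableOk table4 := by
  rw [← buildTable_eq]
  unfold buildTable
  generalize systems4 = S
  induction S with
  | nil => intro k _ a _ b _ h; simp at h
  | cons m S ih =>
    change TableOk (force _ _)
    rw [force_eq]
    beta_reduce
    cases h : goodSys 4 (decodeSys 4 m)
    · exact ih
    · exact ih.addPairs (linked_of_goodSys h)

theorem edgeTabs_spec {c i : ℕ} (hc : c < 16) (hi : i < 4) :
    IsAut 4 (app (subTab edgeTabs (16 * i + c))) ∧
      appP (subTab edgeTabs (16 * i + c)) (c, c ^^^ 2 ^ i) = (0, 1) := by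
  have h : allN 4 (fun i => allN 16 fun c => force (subTab edgeTabs (Nat.add (Nat.mul 16 i) c))
      fun P => sel (checkAut 4 P) (sel (Nat.beq (app P c) 0)
        (Nat.beq (app P (Nat.xor c (Nat.pow 2 i))) 1) false) false) = true := by
    decide +kernel
  have := allN_iff.1 (allN_iff.1 h i hi) c hc
  rw [force_eq, sel_false_right, sel_false_right, Nat.beq_eq, Nat.beq_eq] at this
  exact ⟨isAut_of_check this.1, Prod.ext this.2.1 this.2.2⟩

theorem normTab_spec {c : ℕ} (hc : c < 64) : byte normTab c % 16 = 15 ∨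
    (byte normTab c / 16 < 12 ∧ codeP (appP (subTab stabTabs (byte normTab c / 16)) (pairOf c)) =
      byte repTab (byte normTab c % 16)) := by
  have h : allN 64 (fun c => force (byte normTab c) fun e => sel (Nat.beq (Nat.mod e 16) 15) true
      (sel (Nat.blt (Nat.div e 16) 12) (Nat.beq (codeP (appP (subTab stabTabs (Nat.div e 16))
        (pairOf c))) (byte repTab (Nat.mod e 16))) false)) = true := by
    decide +kernel
  have := allN_iff.1 h c hc
  rw [force_eq, sel_true_left, sel_false_right, Nat.blt_eq, Nat.beq_eq, Nat.beq_eq] at this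
  exact this

set_option exponentiation.threshold 61440 in
theorem linked_of_look {q r s : Pair} (hq : Odd4 q) (hr : Odd4 r) (hs : Odd4 s)
    (h : look q r s = true) : Linked 4 [(0, 1), q, r, s] := by
  obtain ⟨hc, hqc⟩ := codeP_spec hq
  simp only [look, force_eq, hasBit_eq, index4_eq] at h
  have hshift : Nat.shiftRight (byte normTab (codeP q)) 4 = byte normTab (codeP q) / 16 :=
    Nat.shiftRight_eq_div_pow _ 4
  rw [hshift] at h
  generalize he : byte normTab (codeP q) = e at h
  have hnorm := normTab_spec hc
  rw [he] at hnorm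
  rcases hnorm with h15 | ⟨h12, hrep⟩
  · exfalso
    rw [h15] at h
    -- the table has no digits for the value `15`
    have hb : table4 < 2 ^ (4096 * 15) := by
      have : Nat.blt table4 (Nat.pow 2 (Nat.mul 4096 15)) = true := by decide +kernel
      rwa [Nat.blt_eq] at this
    rw [Nat.testBit_lt_two_pow (lt_of_lt_of_le hb (Nat.pow_le_pow_right (by norm_num)
      (Nat.le_add_right _ _)))] at h
    exact absurd h (by simp)
  obtain ⟨haut, hfix⟩ := stabTabs_aut h12
  set P := subTab stabTabs (e / 16)
  have hb := codeP_spec (haut.odd4 hr)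
  have hd := codeP_spec (haut.odd4 hs)
  have hlink := tableOk_table4 (e % 16) (Nat.mod_lt _ (by norm_num)) _ hb.1 _ hd.1 h
  rw [← hrep] at hlink
  have hqc' : SameEnds (appP P q) (appP P (pairOf (codeP q))) := by
    rcases hqc with h | h
    · exact Or.inl (by rw [h])
    · exact Or.inr (by rw [h]; rfl)
  have hodd : Odd4 (pairOf (codeP q)) := by
    rcases hqc with h | h <;> rw [h]
    · exact hq
    · exact ⟨hq.2.1, hq.1, hq.2.2.symm⟩
  rw [← linked_codeP (haut.odd4 hodd) (haut.odd4 hr) (haut.odd4 hs) hfix] at hlink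
  refine Linked.of_map haut ?_ ((SameSys.cons (.refl _) (.cons hqc'.symm (.refl _))).linked hlink)
  simp only [List.mem_cons, forall_eq_or_imp, List.not_mem_nil, false_imp_iff, implies_true,
    and_true]
  exact ⟨by norm_num, ⟨hq.1, hq.2.1⟩, ⟨hr.1, hr.2.1⟩, ⟨hs.1, hs.2.1⟩⟩

theorem linked_of_lookEdge {p q r s : Pair} (hp : Odd4 p) (hq : Odd4 q) (hr : Odd4 r)
    (hs : Odd4 s) (hedge : isEdge p = true) (h : lookEdge p q r s = true) :
    Linked 4 [p, q, r, s] := by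
  obtain ⟨i, hi⟩ := adj_of_adjB hedge
  have hi4 : i < 4 := by
    have : p.1 ^^^ p.2 < 2 ^ 4 := Nat.xor_lt_two_pow hp.1 hp.2.1
    rw [hi] at this
    exact (Nat.pow_lt_pow_iff_right (by norm_num)).1 this
  have hlg : ∀ i < 4, Nat.add (Nat.shiftLeft (lg (2 ^ i)) 4) p.1 = 16 * i + p.1 := by
    have : ∀ i < 4, Nat.shiftLeft (lg (2 ^ i)) 4 = 16 * i := by decide
    intro i hi
    rw [this i hi]
    rfl
  rw [lookEdge, force_eq, show Nat.xor p.1 p.2 = 2 ^ i from hi, hlg i hi4] at h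
  obtain ⟨haut, hpe⟩ := edgeTabs_spec hp.1 hi4
  have hp2 : p.1 ^^^ 2 ^ i = p.2 := by
    rw [← hi, ← Nat.xor_assoc, Nat.xor_self, Nat.zero_xor]
  rw [hp2] at hpe
  have hl := linked_of_look (haut.odd4 hq) (haut.odd4 hr) (haut.odd4 hs) h
  rw [← hpe] at hl
  refine Linked.of_map haut ?_ hl
  simp only [List.mem_cons, forall_eq_or_imp, List.not_mem_nil, false_imp_iff, implies_true,
    and_true]
  exact ⟨⟨hp.1, hp.2.1⟩, ⟨hq.1, hq.2.1⟩, ⟨hr.1, hr.2.1⟩, ⟨hs.1, hs.2.1⟩⟩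

/-! ### At most three pairs in the four-dimensional cube -/

/-- No vertex is common to both pairs. -/
def Apart (p q : Pair) : Prop := p.1 ≠ q.1 ∧ p.1 ≠ q.2 ∧ p.2 ≠ q.1 ∧ p.2 ≠ q.2

/-- Test for `Apart`. -/
def apart (p q : Pair) : Bool :=
  sel (Nat.beq p.1 q.1) false (sel (Nat.beq p.1 q.2) false
    (sel (Nat.beq p.2 q.1) false (sel (Nat.beq p.2 q.2) false true)))

theorem apart_iff {p q : Pair} : apart p q = true ↔ Apart p q := by
  have h : ∀ c b : Bool, sel c false b = true ↔ ¬ c = true ∧ b = true := by decide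
  rw [apart, h, h, h, h, Nat.beq_eq, Nat.beq_eq, Nat.beq_eq, Nat.beq_eq, Apart]
  simp

theorem Apart.symm {p q : Pair} (h : Apart p q) : Apart q p :=
  ⟨h.1.symm, h.2.2.1.symm, h.2.1.symm, h.2.2.2.symm⟩

theorem Apart.congr {p q p' q' : Pair} (h : Apart p q) (hp : SameEnds p p') (hq : SameEnds q q') :
    Apart p' q' := by
  obtain ⟨h1, h2, h3, h4⟩ := h
  rcases hp with rfl | rfl <;> rcases hq with rfl | rfl
  · exact ⟨h1, h2, h3, h4⟩
  · exact ⟨h2, h1, h4, h3⟩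
  · exact ⟨h3, h4, h1, h2⟩
  · exact ⟨h4, h3, h2, h1⟩

theorem Apart.map {n : ℕ} {g : ℕ → ℕ} (hg : IsAut n g) {p q : Pair} (h : Apart p q)
    (hp : p.1 < 2 ^ n ∧ p.2 < 2 ^ n) (hq : q.1 < 2 ^ n ∧ q.2 < 2 ^ n) :
    Apart (mapPair g p) (mapPair g q) :=
  ⟨fun e => h.1 (hg.inj _ hp.1 _ hq.1 e), fun e => h.2.1 (hg.inj _ hp.1 _ hq.2 e),
    fun e => h.2.2.1 (hg.inj _ hp.2 _ hq.1 e), fun e => h.2.2.2 (hg.inj _ hp.2 _ hq.2 e)⟩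

/-- Some splitting of the pair `p` into an edge `{p.1, u}` and a pair `{v, p.2}`, where `u` and `v`
are adjacent, satisfies the test `f`. -/
def splitB (f : Pair → Pair → Bool) (p : Pair) : Bool :=
  anyN 4 fun i => force (Nat.xor p.1 (Nat.pow 2 i)) fun u => anyN 4 fun j =>
    force (Nat.xor u (Nat.pow 2 j)) fun v => f (p.1, u) (v, p.2)

theorem xor_two_pow_lt {n v i : ℕ} (hv : v < 2 ^ n) (hi : i < n) : v ^^^ 2 ^ i < 2 ^ n :=
  Nat.xor_lt_two_pow hv (Nat.pow_lt_pow_right (by norm_num) hi)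

theorem par_lt (v : ℕ) : par v < 2 := by
  change _ &&& 1 < 2
  rw [Nat.and_one_is_mod]
  exact Nat.mod_lt _ (by norm_num)

theorem par_xor_two_pow {v i : ℕ} (hv : v < 32) (hi : i < 5) : par (v ^^^ 2 ^ i) ≠ par v := by
  have : ∀ v < 32, ∀ i < 5, par (v ^^^ 2 ^ i) ≠ par v := by decide +kernel
  exact this v hv i hi

theorem adj_xor_two_pow (v i : ℕ) : Adj v (v ^^^ 2 ^ i) :=
  ⟨i, by rw [← Nat.xor_assoc, Nat.xor_self, Nat.zero_xor]⟩

/-- A path for `p` arises from the edge `{p.1, u}`, the edge `{u, v}` and a path from `v` to `p.2`.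
-/
theorem linked_of_splitB {f : Pair → Pair → Bool} {p : Pair} {L : List Pair} (hp : Odd4 p)
    (hf : ∀ x y, Odd4 x → Odd4 y → isEdge x = true → f x y = true → Linked 4 (x :: y :: L))
    (h : splitB f p = true) : Linked 4 (p :: L) := by
  simp only [splitB, anyN_iff, force_eq] at h
  obtain ⟨i, hi, j, hj, h⟩ := h
  change f (p.1, p.1 ^^^ 2 ^ i) (p.1 ^^^ 2 ^ i ^^^ 2 ^ j, p.2) = true at h
  have hu : p.1 ^^^ 2 ^ i < 2 ^ 4 := xor_two_pow_lt hp.1 hi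
  have hv : p.1 ^^^ 2 ^ i ^^^ 2 ^ j < 2 ^ 4 := xor_two_pow_lt hu hj
  have p1 := par_xor_two_pow (lt_trans hp.1 (by norm_num)) (lt_trans hi (by norm_num))
  have p2 := par_xor_two_pow (lt_trans hu (by norm_num)) (lt_trans hj (by norm_num))
  refine Linked.merge (a := p.1) (b := p.2) (adj_xor_two_pow (p.1 ^^^ 2 ^ i) j)
    (hf _ _ ⟨hp.1, hu, p1.symm⟩ ⟨hv, hp.2.1, ?_⟩ ?_ h)
  · change par (p.1 ^^^ 2 ^ i ^^^ 2 ^ j) ≠ par p.2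
    have := par_lt p.1
    have := par_lt p.2
    have := par_lt (p.1 ^^^ 2 ^ i)
    have := par_lt (p.1 ^^^ 2 ^ i ^^^ 2 ^ j)
    have := hp.2.2
    omega
  · exact adjB_of_adj (lt_trans hp.1 (by norm_num)) (lt_trans hu (by norm_num))
      (adj_xor_two_pow _ _)

theorem odd4_pairOf_codeP {p : Pair} (hp : Odd4 p) : Odd4 (pairOf (codeP p)) := by
  rcases (codeP_spec hp).2 with h | h <;> rw [h]
  · exact hp
  · exact ⟨hp.2.1, hp.1, hp.2.2.symm⟩

/-- The edge is moved to `{0, 1}`; then one of the other pairs can be split so that the resulting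
four pairs are found in the table. -/
theorem linked_edge_two {p q r : Pair} (hp : Odd4 p) (hq : Odd4 q) (hr : Odd4 r)
    (hedge : isEdge p = true) (hpq : Apart p q) (hpr : Apart p r) (hqr : Apart q r) :
    Linked 4 [p, q, r] := by
  -- the edge is moved to `{0, 1}`
  obtain ⟨i, hi⟩ := adj_of_adjB hedge
  have hi4 : i < 4 := by
    have : p.1 ^^^ p.2 < 2 ^ 4 := Nat.xor_lt_two_pow hp.1 hp.2.1
    rw [hi] at this
    exact (Nat.pow_lt_pow_iff_right (by norm_num)).1 this
  obtain ⟨haut, hpe⟩ := edgeTabs_spec hp.1 hi4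
  have hp2 : p.1 ^^^ 2 ^ i = p.2 := by
    rw [← hi, ← Nat.xor_assoc, Nat.xor_self, Nat.zero_xor]
  rw [hp2] at hpe
  set P := subTab edgeTabs (16 * i + p.1)
  have hq' := haut.odd4 hq
  have hr' := haut.odd4 hr
  have a1 : Apart (0, 1) (appP P q) :=
    hpe ▸ hpq.map haut ⟨hp.1, hp.2.1⟩ ⟨hq.1, hq.2.1⟩
  have a2 : Apart (0, 1) (appP P r) :=
    hpe ▸ hpr.map haut ⟨hp.1, hp.2.1⟩ ⟨hr.1, hr.2.1⟩
  have a3 : Apart (appP P q) (appP P r) := hqr.map haut ⟨hq.1, hq.2.1⟩ ⟨hr.1, hr.2.1⟩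
  refine Linked.of_map haut (by
    simp only [List.mem_cons, forall_eq_or_imp, List.not_mem_nil, false_imp_iff, implies_true,
      and_true]
    exact ⟨⟨hp.1, hp.2.1⟩, ⟨hq.1, hq.2.1⟩, ⟨hr.1, hr.2.1⟩⟩) ?_
  change Linked 4 [appP P (p.1, p.2), appP P q, appP P r]
  rw [hpe]
  generalize appP P q = q at *
  generalize appP P r = r at *
  have hcheck : allN 64 (fun a => allN 64 fun b =>
      forceP (pairOf a) fun q => forceP (pairOf b) fun r =>
        sel (apart (0, 1) q) (sel (apart (0, 1) r) (sel (apart q r)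
          (sel (splitB (fun x y => look x y r) q) true (splitB (fun x y => look x y q) r))
            true) true) true) = true := by decide +kernel
  obtain ⟨hc, hqc⟩ := codeP_spec hq'
  obtain ⟨hd, hrc⟩ := codeP_spec hr'
  have := allN_iff.1 (allN_iff.1 hcheck _ hc) _ hd
  rw [forceP_eq, forceP_eq, apart_iff.2 (a1.congr (.refl _) hqc), apart_iff.2 (a2.congr (.refl _) hrc),
    apart_iff.2 (a3.congr hqc hrc), sel_true, sel_true, sel_true, sel_true_left] at this
  have hoq := odd4_pairOf_codeP hq'
  have hor := odd4_pairOf_codeP hr'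
  refine (SameSys.cons (.refl _) (.cons hqc.symm (.cons hrc.symm (.refl [])))).linked ?_
  rcases this with h | h
  · refine Linked.perm (.swap _ _ _) (linked_of_splitB hoq (fun x y hx hy _ h => ?_) h)
    refine Linked.perm ?_ (linked_of_look hx hy hor h)
    exact (List.Perm.swap _ _ _).trans (.cons _ (.swap _ _ _))
  · refine Linked.perm ?_
      (linked_of_splitB (L := [(0, 1), pairOf (codeP q)]) hor (fun x y hx hy _ h => ?_) h)
    · exact (List.Perm.swap _ _ _).trans (.cons _ (.swap _ _ _))
    · refine Linked.perm ?_ (linked_of_look hx hy hoq h)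
      exact (List.Perm.swap _ _ _).trans (.cons _ (.swap _ _ _))

theorem linked_two {p q : Pair} (hp : Odd4 p) (hq : Odd4 q) (hpq : Apart p q) :
    Linked 4 [p, q] := by
  have hcheck : allN 64 (fun a => allN 64 fun b =>
      forceP (pairOf a) fun p => forceP (pairOf b) fun q => sel (apart p q)
        (splitB (fun x y => sel (apart x y) (sel (apart x q) (apart y q) false) false) p) true)
      = true := by decide +kernel
  obtain ⟨hc, hpc⟩ := codeP_spec hp
  obtain ⟨hd, hqc⟩ := codeP_spec hq
  have := allN_iff.1 (allN_iff.1 hcheck _ hc) _ hd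
  rw [forceP_eq, forceP_eq, apart_iff.2 (hpq.congr hpc hqc), sel_true] at this
  have hoq := odd4_pairOf_codeP hq
  refine (SameSys.cons hpc.symm (.cons hqc.symm (.refl []))).linked ?_
  refine linked_of_splitB (odd4_pairOf_codeP hp) (fun x y hx hy he h => ?_) this
  rw [sel_false_right, sel_false_right, apart_iff, apart_iff, apart_iff] at h
  exact linked_edge_two hx hy hoq he h.1 h.2.1 h.2.2

theorem linked_one {p : Pair} (hp : Odd4 p) : Linked 4 [p] := by
  have hcheck : allN 64 (fun a => forceP (pairOf a) fun p => splitB apart p) = true := by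
    decide +kernel
  obtain ⟨hc, hpc⟩ := codeP_spec hp
  have := allN_iff.1 hcheck _ hc
  rw [forceP_eq] at this
  refine (SameSys.cons hpc.symm (.refl [])).linked ?_
  exact linked_of_splitB (odd4_pairOf_codeP hp)
    (fun x y hx hy he h => linked_two hx hy (apart_iff.1 h)) this

/-- Three disjoint odd pairs of `Q 4` are joined if their differences are not all equal. This
condition excludes three antipodal pairs of a three-dimensional subcube. -/
theorem linked_three {p q r : Pair} (hp : Odd4 p) (hq : Odd4 q) (hr : Odd4 r)
    (hpq : Apart p q) (hpr : Apart p r) (hqr : Apart q r)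
    (hne : p.1 ^^^ p.2 ≠ q.1 ^^^ q.2 ∨ p.1 ^^^ p.2 ≠ r.1 ^^^ r.2) : Linked 4 [p, q, r] := by
  have hcheck : allN 64 (fun a => allN a fun b => allN b fun c =>
      forceP (pairOf a) fun p => forceP (pairOf b) fun q => forceP (pairOf c) fun r =>
        sel (apart p q) (sel (apart p r) (sel (apart q r)
          (sel (sel (isEdge p) true (sel (isEdge q) true (isEdge r))) true
            (sel (sel (Nat.beq (Nat.xor p.1 p.2) (Nat.xor q.1 q.2))
              (Nat.beq (Nat.xor p.1 p.2) (Nat.xor r.1 r.2)) false) true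
              (splitB (fun x y => lookEdge x y q r) p))) true) true) true) = true := by
    decide +kernel
  -- the check covers only one order of the three pairs
  have hsorted : ∀ p q r : Pair, Odd4 p → Odd4 q → Odd4 r → Apart p q → Apart p r → Apart q r →
      (p.1 ^^^ p.2 ≠ q.1 ^^^ q.2 ∨ p.1 ^^^ p.2 ≠ r.1 ^^^ r.2) →
      codeP q < codeP p → codeP r < codeP q → Linked 4 [p, q, r] := by
    intro p q r hp hq hr hpq hpr hqr hne hlt1 hlt2
    obtain ⟨ha, hpc⟩ := codeP_spec hp
    obtain ⟨hb, hqc⟩ := codeP_spec hq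
    obtain ⟨hc, hrc⟩ := codeP_spec hr
    have := allN_iff.1 (allN_iff.1 (allN_iff.1 hcheck _ ha) _ hlt1) _ hlt2
    have hx : ∀ p p' : Pair, SameEnds p p' → p'.1 ^^^ p'.2 = p.1 ^^^ p.2 := by
      rintro p p' (rfl | rfl)
      · rfl
      · exact Nat.xor_comm _ _
    have ap := hpq.congr hpc hqc
    have ap' := hpr.congr hpc hrc
    have ap'' := hqr.congr hqc hrc
    have op := odd4_pairOf_codeP hp
    have oq := odd4_pairOf_codeP hq
    have or := odd4_pairOf_codeP hr
    rw [forceP_eq, forceP_eq, forceP_eq, apart_iff.2 ap, apart_iff.2 ap',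
      apart_iff.2 ap'', sel_true, sel_true, sel_true,
      sel_true_left, sel_true_left, sel_true_left, sel_true_left, sel_false_right,
      Nat.beq_eq, Nat.beq_eq] at this
    refine (SameSys.cons hpc.symm (.cons hqc.symm (.cons hrc.symm (.refl [])))).linked ?_
    rcases this with (h | h | h) | h | h
    · exact linked_edge_two op oq or h ap ap' ap''
    · exact (linked_edge_two oq op or h ap.symm ap'' ap').perm (.swap _ _ _)
    · exact (linked_edge_two or op oq h ap'.symm ap''.symm ap).perm
        ((List.Perm.swap _ _ _).trans (.cons _ (.swap _ _ _)))
    · exfalso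
      have h1 := (hx _ _ hpc).symm.trans (h.1.trans (hx _ _ hqc))
      have h2 := (hx _ _ hpc).symm.trans (h.2.trans (hx _ _ hrc))
      rcases hne with hne | hne
      · exact hne h1
      · exact hne h2
    · exact linked_of_splitB op (fun x y hx hy he h => linked_of_lookEdge hx hy oq or he h) h
  have hinj : ∀ p q : Pair, Odd4 p → Odd4 q → Apart p q → codeP p ≠ codeP q := by
    intro p q hp hq hpq h
    have := hpq.congr (codeP_spec hp).2 (codeP_spec hq).2
    rw [h] at this
    exact this.1 rfl
  have s1 := hpq.symm
  have s2 := hpr.symm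
  have s3 := hqr.symm
  have hne' : (q.1 ^^^ q.2 ≠ p.1 ^^^ p.2 ∨ q.1 ^^^ q.2 ≠ r.1 ^^^ r.2) ∧
      (r.1 ^^^ r.2 ≠ p.1 ^^^ p.2 ∨ r.1 ^^^ r.2 ≠ q.1 ^^^ q.2) := by
    constructor <;> by_contra! h <;> rcases hne with hne | hne <;> apply hne <;>
      simp [h.1, ← h.2]
  rcases lt_or_gt_of_ne (hinj p q hp hq hpq) with h1 | h1 <;>
  rcases lt_or_gt_of_ne (hinj p r hp hr hpr) with h2 | h2 <;>
  rcases lt_or_gt_of_ne (hinj q r hq hr hqr) with h3 | h3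
  · exact (hsorted r q p hr hq hp s3 s2 s1 hne'.2.symm h3 h1).perm (by grind)
  · exact (hsorted q r p hq hr hp hqr s1 s2 hne'.1.symm h3 h2).perm (by grind)
  · omega
  · exact (hsorted q p r hq hp hr s1 hqr hpr hne'.1 h1 h2).perm (by grind)
  · exact (hsorted r p q hr hp hq s2 s3 hpq hne'.2 h2 h1).perm (by grind)
  · omega
  · exact (hsorted p r q hp hr hq hpr hpq s3 hne.symm h2 h3).perm (by grind)
  · exact (hsorted p q r hp hq hr hpq hpr hqr hne h1 h3).perm (by grind)

/-! ### Searching for a path system along a given coordinate -/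

/-- Case distinction on a list, as a bare recursor. -/
def uncons {α β : Type} (l : List α) (x : β) (f : α → List α → β) : β :=
  List.rec x (fun a l _ => f a l) l

/-- Length of a list, as a bare recursor. -/
def len {α : Type} (l : List α) : ℕ := List.rec 0 (fun _ _ ih => Nat.add ih 1) l

/-- A test for `Linked 4`. It may fail on linked lists, in particular if there are more than two
pairs but no edge among them. -/
def known (l : List Pair) : Bool :=
  uncons l false fun p l => uncons l true fun q l => uncons l (apart p q) fun r l =>
    uncons l (sel (sel (isEdge p) true (sel (isEdge q) true (isEdge r)))
      (sel (apart p q) (sel (apart p r) (apart q r) false) false) false) fun s l =>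
    uncons l (sel (isEdge p) (lookEdge p q r s) (sel (isEdge q) (lookEdge q p r s)
      (sel (isEdge r) (lookEdge r p q s) (sel (isEdge s) (lookEdge s p q r) false))))
      fun _ _ => false

theorem linked_of_known {l : List Pair} (hl : ∀ p ∈ l, Odd4 p) (h : known l = true) :
    Linked 4 l := by
  have hsel : ∀ c x y : Bool, sel c x y = true ↔ (c = true ∧ x = true) ∨ (c = false ∧ y = true) := by
    decide
  rcases l with _ | ⟨p, _ | ⟨q, _ | ⟨r, _ | ⟨s, _ | ⟨t, l⟩⟩⟩⟩⟩
  · exact absurd h (by simp [known, uncons])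
  · exact linked_one (hl p (by simp))
  · exact linked_two (hl p (by simp)) (hl q (by simp)) (apart_iff.1 h)
  · replace h : sel (sel (isEdge p) true (sel (isEdge q) true (isEdge r)))
      (sel (apart p q) (sel (apart p r) (apart q r) false) false) false = true := h
    rw [sel_false_right, sel_false_right, sel_false_right, sel_true_left, sel_true_left,
      apart_iff, apart_iff, apart_iff] at h
    obtain ⟨he, h1, h2, h3⟩ := h
    have op := hl p (by simp)
    have oq := hl q (by simp)
    have or := hl r (by simp)
    rcases he with h | h | h
    · exact linked_edge_two op oq or h h1 h2 h3
    · exact (linked_edge_two oq op or h h1.symm h3 h2).perm (.swap _ _ _)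
    · exact (linked_edge_two or op oq h h2.symm h3.symm h1).perm
        ((List.Perm.swap _ _ _).trans (.cons _ (.swap _ _ _)))
  · replace h : sel (isEdge p) (lookEdge p q r s) (sel (isEdge q) (lookEdge q p r s)
      (sel (isEdge r) (lookEdge r p q s) (sel (isEdge s) (lookEdge s p q r) false))) = true := h
    rw [hsel, hsel, hsel, sel_false_right] at h
    have op := hl p (by simp)
    have oq := hl q (by simp)
    have or := hl r (by simp)
    have os := hl s (by simp)
    rcases h with h | ⟨-, h | ⟨-, h | ⟨-, h⟩⟩⟩
    · exact linked_of_lookEdge op oq or os h.1 h.2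
    · exact (linked_of_lookEdge oq op or os h.1 h.2).perm (.swap _ _ _)
    · exact (linked_of_lookEdge or op oq os h.1 h.2).perm
        ((List.Perm.swap _ _ _).trans (.cons _ (.swap _ _ _)))
    · exact (linked_of_lookEdge os op oq or h.1 h.2).perm ((List.Perm.swap _ _ _).trans
        (.cons _ ((List.Perm.swap _ _ _).trans (.cons _ (.swap _ _ _)))))
  · exact absurd h (by simp [known, uncons])

/-- The vertices of `Q 4` whose parity differs from that of `v`. -/
def opposite (v : ℕ) : List ℕ :=
  sel (Nat.beq (par v) 0) [1, 2, 4, 7, 8, 11, 13, 14] [0, 3, 5, 6, 9, 10, 12, 15]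

theorem mem_opposite {u v : ℕ} : u ∈ opposite v ↔ u < 16 ∧ par u ≠ par v := by
  have key : ∀ l : List ℕ, ∀ b < 2, (∀ u < 16, u ∈ l ↔ par u ≠ b) → (∀ u ∈ l, u < 16) →
      par v = b → (u ∈ l ↔ u < 16 ∧ par u ≠ par v) := by
    intro l b _ h1 h2 hb
    rw [hb]
    exact ⟨fun h => ⟨h2 u h, (h1 u (h2 u h)).1 h⟩, fun h => (h1 u h.1).2 h.2⟩
  have hv := par_lt v
  unfold opposite
  cases h : Nat.beq (par v) 0
  · have h0 : par v = 1 := by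
      have := Nat.ne_of_beq_eq_false h
      omega
    exact key _ 1 (by norm_num) (by decide) (by decide) h0
  · exact key _ 0 (by norm_num) (by decide) (by decide) (Nat.eq_of_beq_eq_true h)

/-- Search for crossing vertices for the pairs in `C`, given pairs `L₀` and `L₁` in the two halves.
The crossing vertices avoid the binary digits of `used`. -/
def search (C : List Pair) : List Pair → List Pair → ℕ → Bool :=
  List.rec (motive := fun _ => List Pair → List Pair → ℕ → Bool)
    (fun L₀ L₁ _ => sel (known L₀) (known L₁) false)
    (fun c _ ih L₀ L₁ used => anyL (fun u => sel (hasBit used u) false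
      (ih ((c.1, u) :: L₀) ((u, c.2) :: L₁) (Nat.lor used (single u)))) (opposite c.1)) C

/-- The pairs of `Q 5` given by two lists of pairs in the halves, and a list of crossing pairs. -/
def join (L₀ L₁ C : List Pair) : List Pair :=
  C.map (fun p => (p.1, 2 ^ 4 + p.2)) ++ (L₀ ++ L₁.map fun p => (2 ^ 4 + p.1, 2 ^ 4 + p.2))

/-- A crossing pair with ends of the same parity, so that its ends in `Q 5` have different
parities. -/
def Even4 (p : Pair) : Prop := p.1 < 16 ∧ p.2 < 16 ∧ par p.1 = par p.2

/-- A crossing pair `{a, b}` with crossing vertex `u` is replaced by the pairs `{a, u}` and `{u, b}`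
in the two halves, and `Linked.glue` joins the paths. -/
theorem linked_of_search {C L₀ L₁ : List Pair} {used : ℕ} (hC : ∀ p ∈ C, Even4 p)
    (h₀ : ∀ p ∈ L₀, Odd4 p) (h₁ : ∀ p ∈ L₁, Odd4 p) (h : search C L₀ L₁ used = true) :
    Linked 5 (join L₀ L₁ C) := by
  suffices H : ∃ D : List (ℕ × ℕ × ℕ), D.map (fun t => (t.1, t.2.2)) = C.reverse ∧
      Linked 4 (D.map (fun t => (t.1, t.2.1)) ++ L₀) ∧
      Linked 4 (D.map (fun t => (t.2.1, t.2.2)) ++ L₁) by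
    obtain ⟨D, hD, k₀, k₁⟩ := H
    refine Linked.perm ?_ (Linked.glue D k₀ k₁)
    refine List.Perm.append_right _ ?_
    have : D.map (fun t => (t.1, 2 ^ 4 + t.2.2)) =
        (D.map (fun t => (t.1, t.2.2))).map fun p => (p.1, 2 ^ 4 + p.2) := by
      rw [List.map_map]; rfl
    rw [this, hD]
    exact (List.reverse_perm C).map _
  induction C generalizing L₀ L₁ used with
  | nil =>
    replace h : sel (known L₀) (known L₁) false = true := h
    rw [sel_false_right] at h
    exact ⟨[], rfl, linked_of_known h₀ h.1, linked_of_known h₁ h.2⟩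
  | cons c C ih =>
    replace h : anyL (fun u => sel (hasBit used u) false
      (search C ((c.1, u) :: L₀) ((u, c.2) :: L₁) (Nat.lor used (single u)))) (opposite c.1)
        = true := h
    obtain ⟨u, hu, h⟩ := anyL_iff.1 h
    have h' : search C ((c.1, u) :: L₀) ((u, c.2) :: L₁) (Nat.lor used (single u)) = true := by
      cases hb : hasBit used u
      · rwa [hb] at h
      · rw [hb] at h; exact absurd h (by simp)
    rw [mem_opposite] at hu
    obtain ⟨c1, c2, c3⟩ := hC c (by simp)
    obtain ⟨D, hD, k₀, k₁⟩ := ih (fun p hp => hC p (by simp [hp]))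
      (fun p hp => by
        rcases List.mem_cons.1 hp with rfl | hp
        · exact ⟨c1, hu.1, hu.2.symm⟩
        · exact h₀ p hp)
      (fun p hp => by
        rcases List.mem_cons.1 hp with rfl | hp
        · exact ⟨hu.1, c2, c3 ▸ hu.2⟩
        · exact h₁ p hp) h'
    refine ⟨D ++ [(c.1, u, c.2)], by simp [hD], ?_, ?_⟩
    · simpa using k₀
    · simpa using k₁

/-- One step of `split`: the image of the pair `p`, under the automorphism of `Q 5` with table `P`,
is added to one of the lists, before the continuation `ih` is called. -/
def splitStep {α : Type} (P : ℕ) (p : Pair) (ih : List Pair → List Pair → List Pair → ℕ → α)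
    (L₀ L₁ C : List Pair) (used : ℕ) : α :=
  force (app P p.1) fun x => force (app P p.2) fun y =>
  force (Nat.land x 15) fun x' => force (Nat.land y 15) fun y' =>
  force (Nat.lor used (Nat.lor (single x') (single y'))) fun used' =>
    sel (Nat.ble 16 x)
      (sel (Nat.ble 16 y) (ih L₀ ((x', y') :: L₁) C used') (ih L₀ L₁ ((y', x') :: C) used'))
      (sel (Nat.ble 16 y) (ih L₀ L₁ ((x', y') :: C) used') (ih ((x', y') :: L₀) L₁ C used'))

/-- Distribute the images of the pairs in `L`, under the automorphism of `Q 5` with table `P`, over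
the lists `L₀` (pairs in the lower half), `L₁` (pairs in the upper half) and `C` (crossing pairs),
and apply `f` to the result; `used` collects the vertices that occur. Top digits are deleted. -/
def split {α : Type} (P : ℕ) (L : List Pair) (f : List Pair → List Pair → List Pair → ℕ → α) :
    List Pair → List Pair → List Pair → ℕ → α :=
  List.rec f (fun p _ ih => splitStep P p ih) L

/-- The lists `L₀`, `L₁` and `C` describe, up to order, the images under the table `P` of the pairs
in `L`. -/
structure IsSplit (P : ℕ) (L L₀ L₁ C : List Pair) : Prop where
  lt₀ : ∀ p ∈ L₀, p.1 < 16 ∧ p.2 < 16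
  lt₁ : ∀ p ∈ L₁, p.1 < 16 ∧ p.2 < 16
  ltC : ∀ p ∈ C, p.1 < 16 ∧ p.2 < 16
  same : SameSys (join L₀ L₁ C) (L.map (appP P))

theorem IsSplit.nil (P : ℕ) : IsSplit P [] [] [] [] :=
  ⟨by simp, by simp, by simp, SameSys.refl _⟩

theorem IsSplit.perm {P : ℕ} {L M L₀ L₁ C : List Pair} (h : IsSplit P L L₀ L₁ C)
    (hLM : L.Perm M) : IsSplit P M L₀ L₁ C :=
  ⟨h.lt₀, h.lt₁, h.ltC, h.same.trans (.of_perm (hLM.map _))⟩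

theorem join_cons_left (p : Pair) (L₀ L₁ C : List Pair) :
    SameSys (p :: join L₀ L₁ C) (join (p :: L₀) L₁ C) :=
  .of_perm List.perm_middle.symm

theorem join_cons_right (p : Pair) (L₀ L₁ C : List Pair) :
    SameSys ((2 ^ 4 + p.1, 2 ^ 4 + p.2) :: join L₀ L₁ C) (join L₀ (p :: L₁) C) := by
  refine .of_perm ?_
  unfold join
  rw [← List.append_assoc, ← List.append_assoc]
  exact List.perm_middle.symm

theorem join_cons_cross (p : Pair) (L₀ L₁ C : List Pair) :
    SameSys ((p.1, 2 ^ 4 + p.2) :: join L₀ L₁ C) (join L₀ L₁ (p :: C)) := .refl _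

/-- The lists to which `split` adds one further pair. -/
theorem IsSplit.cons {P : ℕ} {L L₀ L₁ C : List Pair} (h : IsSplit P L L₀ L₁ C) (p : Pair) :
    ∃ M₀ M₁ D used', IsSplit P (p :: L) M₀ M₁ D ∧ ∀ {α : Type} (N : List Pair) (used : ℕ)
      (f : List Pair → List Pair → List Pair → ℕ → α),
      split P (p :: N) f L₀ L₁ C used = split P N f M₀ M₁ D (used ||| used') := by
  have hlt : ∀ v, app P v < 32 := fun v => by
    have : app P v = Nat.shiftRight P (Nat.mul 5 v) % 2 ^ 5 := Nat.and_two_pow_sub_one_eq_mod _ 5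
    rw [this]
    exact Nat.mod_lt _ (by norm_num)
  have hmod : ∀ v, Nat.land v 15 = v % 16 := fun v => Nat.and_two_pow_sub_one_eq_mod _ 4
  have hx := hlt p.1
  have hy := hlt p.2
  set x := app P p.1 with hxdef
  set y := app P p.2 with hydef
  have hp : appP P p = (x, y) := rfl
  have hstep : ∀ {α : Type} (N : List Pair) (used : ℕ)
      (f : List Pair → List Pair → List Pair → ℕ → α),
      split P (p :: N) f L₀ L₁ C used =
        sel (Nat.ble 16 x)
          (sel (Nat.ble 16 y)
            (split P N f L₀ ((x % 16, y % 16) :: L₁) C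
              (used ||| (single (x % 16) ||| single (y % 16))))
            (split P N f L₀ L₁ ((y % 16, x % 16) :: C)
              (used ||| (single (x % 16) ||| single (y % 16)))))
          (sel (Nat.ble 16 y)
            (split P N f L₀ L₁ ((x % 16, y % 16) :: C)
              (used ||| (single (x % 16) ||| single (y % 16))))
            (split P N f ((x % 16, y % 16) :: L₀) L₁ C
              (used ||| (single (x % 16) ||| single (y % 16))))) := by
    intro α N used f
    rw [← hmod, ← hmod]
    change splitStep P p (split P N f) L₀ L₁ C used = _
    simp only [splitStep, force_eq]
    rfl
  have hble : ∀ v, Nat.ble 16 v = decide (16 ≤ v) := fun v =>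
    Bool.eq_iff_iff.2 (by rw [Nat.ble_eq, decide_eq_true_iff])
  simp only [hble] at hstep
  have hmap : (p :: L).map (appP P) = (x, y) :: L.map (appP P) := rfl
  by_cases h1 : 16 ≤ x <;> by_cases h2 : 16 ≤ y <;>
    simp only [h1, h2, decide_true, decide_false, sel_true, sel_false] at hstep
  · refine ⟨_, _, _, _, ⟨h.lt₀, List.forall_mem_cons.2 ⟨⟨by omega, by omega⟩, h.lt₁⟩, h.ltC, ?_⟩,
      hstep⟩
    rw [hmap]
    refine (join_cons_right _ _ _ _).symm.trans (SameSys.cons (Or.inl ?_) h.same)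
    exact Prod.ext (by change x = 16 + x % 16; omega) (by change y = 16 + y % 16; omega)
  · refine ⟨_, _, _, _, ⟨h.lt₀, h.lt₁, List.forall_mem_cons.2 ⟨⟨by omega, by omega⟩, h.ltC⟩, ?_⟩,
      hstep⟩
    rw [hmap]
    refine (join_cons_cross _ _ _ _).symm.trans (SameSys.cons (Or.inr ?_) h.same)
    exact Prod.ext (by change x = 16 + x % 16; omega) (by change y = y % 16; omega)
  · refine ⟨_, _, _, _, ⟨h.lt₀, h.lt₁, List.forall_mem_cons.2 ⟨⟨by omega, by omega⟩, h.ltC⟩, ?_⟩,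
      hstep⟩
    rw [hmap]
    refine (join_cons_cross _ _ _ _).symm.trans (SameSys.cons (Or.inl ?_) h.same)
    exact Prod.ext (by change x = x % 16; omega) (by change y = 16 + y % 16; omega)
  · refine ⟨_, _, _, _, ⟨List.forall_mem_cons.2 ⟨⟨by omega, by omega⟩, h.lt₀⟩, h.lt₁, h.ltC, ?_⟩,
      hstep⟩
    rw [hmap]
    refine (join_cons_left _ _ _ _).symm.trans (SameSys.cons (Or.inl ?_) h.same)
    exact Prod.ext (by change x = x % 16; omega) (by change y = y % 16; omega)

theorem IsSplit.split {P : ℕ} {L L₀ L₁ C : List Pair} (h : IsSplit P L L₀ L₁ C) (N : List Pair) :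
    ∃ M₀ M₁ D used', IsSplit P (N ++ L) M₀ M₁ D ∧ ∀ {α : Type} (used : ℕ)
      (f : List Pair → List Pair → List Pair → ℕ → α),
      split P N f L₀ L₁ C used = f M₀ M₁ D (used ||| used') := by
  induction N generalizing L L₀ L₁ C with
  | nil => exact ⟨L₀, L₁, C, 0, h, fun used f => by rw [Nat.or_zero]; rfl⟩
  | cons p N ih =>
    obtain ⟨M₀, M₁, D, u, h1, h2⟩ := h.cons p
    obtain ⟨M₀', M₁', D', u', h1', h2'⟩ := ih h1
    refine ⟨M₀', M₁', D', u ||| u', h1'.perm List.perm_middle, fun used f => ?_⟩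
    rw [h2, h2', Nat.or_assoc]

/-- Parities of the pairs that form a valid list in `Q 5`. -/
theorem parity_of_valid_join {L₀ L₁ C : List Pair} (lt₀ : ∀ p ∈ L₀, p.1 < 16 ∧ p.2 < 16)
    (lt₁ : ∀ p ∈ L₁, p.1 < 16 ∧ p.2 < 16) (ltC : ∀ p ∈ C, p.1 < 16 ∧ p.2 < 16)
    (hv : Valid 5 (join L₀ L₁ C)) :
    (∀ p ∈ L₀, Odd4 p) ∧ (∀ p ∈ L₁, Odd4 p) ∧ ∀ p ∈ C, Even4 p := by
  have hpar : ∀ v < 16, par (2 ^ 4 + v) = 1 - par v := by decide +kernel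
  refine ⟨fun p hp => ?_, fun p hp => ?_, fun p hp => ?_⟩
  · exact ⟨(lt₀ p hp).1, (lt₀ p hp).2, (hv.1 p (by simp [join, hp])).2.2⟩
  · have := (hv.1 (2 ^ 4 + p.1, 2 ^ 4 + p.2)
      (List.mem_append_right _ (List.mem_append_right _ (List.mem_map_of_mem hp)))).2.2
    obtain ⟨h1, h2⟩ := lt₁ p hp
    rw [hpar _ h1, hpar _ h2] at this
    exact ⟨h1, h2, fun e => this (by rw [e])⟩
  · have hne := (hv.1 (p.1, 2 ^ 4 + p.2)
      (List.mem_append_left _ (List.mem_map_of_mem hp))).2.2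
    obtain ⟨h1, h2⟩ := ltC p hp
    have h3 := hpar _ h2
    have := par_lt p.1
    have := par_lt p.2
    exact ⟨h1, h2, by dsimp only at hne; omega⟩

/-- An intermediate state of `split`. -/
structure Split where
  /-- table of an automorphism -/
  tab : ℕ
  /-- pairs in the lower half -/
  lower : List Pair
  /-- pairs in the upper half, without top digits -/
  upper : List Pair
  /-- crossing pairs, the end in the lower half first, without top digits -/
  cross : List Pair
  /-- set of the vertices that occur, without top digits -/
  used : ℕ

/-- Try to find a path system for the pairs in `L` and those distributed by `s`, with at most `k`
crossing pairs. -/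
def glueFrom (k : ℕ) (L : List Pair) (s : Split) : Bool :=
  split s.tab L (fun L₀ L₁ C used =>
    force (len C) fun c => sel (Nat.ble c k) (sel (Nat.ble (Nat.add (len L₀) c) 4)
      (sel (Nat.ble (Nat.add (len L₁) c) 4) (search C L₀ L₁ used) false) false) false)
    s.lower s.upper s.cross s.used

theorem linked_of_glueFrom {k : ℕ} {L M : List Pair} {s : Split} (hP : IsAut 5 (app s.tab))
    (hs : IsSplit s.tab M s.lower s.upper s.cross) (hL : Valid 5 (L ++ M))
    (h : glueFrom k L s = true) : Linked 5 (L ++ M) := by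
  obtain ⟨M₀, M₁, D, u, h1, h2⟩ := hs.split L
  rw [glueFrom, h2, force_eq, sel_false_right, sel_false_right, sel_false_right] at h
  obtain ⟨k₀, k₁, kC⟩ := parity_of_valid_join h1.lt₀ h1.lt₁ h1.ltC (h1.same.symm.valid (hL.map hP))
  exact Linked.of_map_same hP hL h1.same.symm (linked_of_search kC k₀ k₁ h.2.2.2)

/-- Tables of the automorphisms of `Q 5` that exchange the digit `d` and the top digit. -/
def swapTab (d : ℕ) : ℕ := Nat.rec 0xfbfaddaf29b9ea598e21f3b8cd2b08b1a8490a00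
  (fun d _ => Nat.rec 0xff9eede96abd8e69c862ef1acce128ad0a48c020
    (fun d _ => Nat.rec 0xffbbc7b9acbdab4398a4deb385a9289ca3018820
      (fun d _ => Nat.rec 0xffbbcdeb387b9ac5a928bdab49ca30398a418820
        (fun _ _ => 0xffbbcdeb38bdab49ca307b9ac5a928398a418820) d) d) d) d

theorem swapTab_spec {d : ℕ} (hd : d < 5) : IsAut 5 (app (swapTab d)) := by
  have h : allN 5 (fun d => checkAut 5 (swapTab d)) = true := by decide +kernel
  exact isAut_of_check (allN_iff.1 h d hd)

/-- The splittings of `L` along the five directions, passed to `f`. -/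
def splits {α : Type} (L : List Pair) (f : List Split → α) : α :=
  Nat.rec (motive := fun _ => List Split → α) f
    (fun d ih S => split (swapTab d) L (fun L₀ L₁ C used =>
      ih (⟨swapTab d, L₀, L₁, C, used⟩ :: S)) [] [] [] 0) 5 []

theorem splits_spec (L : List Pair) : ∃ S : List Split, (∀ s ∈ S, IsAut 5 (app s.tab) ∧
    IsSplit s.tab L s.lower s.upper s.cross) ∧ ∀ {α : Type} (f : List Split → α),
      splits L f = f S := by
  suffices H : ∀ n ≤ 5, ∀ S : List Split, (∀ s ∈ S, IsAut 5 (app s.tab) ∧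
      IsSplit s.tab L s.lower s.upper s.cross) → ∃ T : List Split, (∀ s ∈ T, IsAut 5 (app s.tab) ∧
      IsSplit s.tab L s.lower s.upper s.cross) ∧ ∀ {α : Type} (f : List Split → α),
      (Nat.rec (motive := fun _ => List Split → α) f
        (fun d ih S => split (swapTab d) L (fun L₀ L₁ C used =>
          ih (⟨swapTab d, L₀, L₁, C, used⟩ :: S)) [] [] [] 0) n : List Split → α) S = f T from
    H 5 le_rfl [] (by simp)
  intro n
  induction n with
  | zero => intro _ S hS; exact ⟨S, hS, fun f => rfl⟩
  | succ d ih =>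
    intro hd S hS
    obtain ⟨M₀, M₁, D, u, h1, h2⟩ := (IsSplit.nil (swapTab d)).split L
    rw [List.append_nil] at h1
    obtain ⟨T, hT, hf⟩ := ih (by omega) (⟨swapTab d, M₀, M₁, D, 0 ||| u⟩ :: S) (by
      simp only [List.mem_cons, forall_eq_or_imp]
      exact ⟨⟨swapTab_spec (by omega), h1⟩, hS⟩)
    exact ⟨T, hT, fun f => (h2 _ _).trans (hf f)⟩

/-! ### Pairs distributed over the two halves -/

/-- Lists of pairs in the two halves of `Q 5` and of crossing pairs, which together form a valid
list of pairs, such that every other vertex has a neighbour outside these pairs. -/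
structure Halves (L₀ L₁ C : List Pair) : Prop where
  lt₀ : ∀ p ∈ L₀, p.1 < 16 ∧ p.2 < 16
  lt₁ : ∀ p ∈ L₁, p.1 < 16 ∧ p.2 < 16
  ltC : ∀ p ∈ C, p.1 < 16 ∧ p.2 < 16
  valid : Valid 5 (join L₀ L₁ C)
  noEnc : NoEnc 5 (join L₀ L₁ C)

theorem Halves.odd₀ {L₀ L₁ C : List Pair} (h : Halves L₀ L₁ C) : ∀ p ∈ L₀, Odd4 p :=
  (parity_of_valid_join h.lt₀ h.lt₁ h.ltC h.valid).1

theorem Halves.odd₁ {L₀ L₁ C : List Pair} (h : Halves L₀ L₁ C) : ∀ p ∈ L₁, Odd4 p :=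
  (parity_of_valid_join h.lt₀ h.lt₁ h.ltC h.valid).2.1

theorem Halves.even {L₀ L₁ C : List Pair} (h : Halves L₀ L₁ C) : ∀ p ∈ C, Even4 p :=
  (parity_of_valid_join h.lt₀ h.lt₁ h.ltC h.valid).2.2

theorem vertsOf_join (L₀ L₁ C : List Pair) : (vertsOf (join L₀ L₁ C)).Perm
    ((vertsOf L₀ ++ C.map Prod.fst) ++ (vertsOf L₁ ++ C.map Prod.snd).map (2 ^ 4 + ·)) := by
  have hC : (vertsOf (C.map fun p => (p.1, 2 ^ 4 + p.2))).Perm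
      (C.map Prod.fst ++ (C.map Prod.snd).map (2 ^ 4 + ·)) := by
    induction C with
    | nil => rfl
    | cons c C ih =>
      rw [List.map_cons, vertsOf_cons]
      simp only [List.map_cons, List.cons_append]
      exact ((ih.cons _).trans List.perm_middle.symm).cons _
  have h₁ : vertsOf (L₁.map fun p => (2 ^ 4 + p.1, 2 ^ 4 + p.2)) = (vertsOf L₁).map (2 ^ 4 + ·) :=
    vertsOf_map (2 ^ 4 + ·) L₁
  rw [join, vertsOf_append, vertsOf_append, h₁, List.map_append]
  refine (hC.append_right _).trans ?_
  generalize C.map Prod.fst = a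
  generalize (C.map Prod.snd).map (2 ^ 4 + ·) = b
  generalize vertsOf L₀ = c
  generalize (vertsOf L₁).map (2 ^ 4 + ·) = d
  rw [← Multiset.coe_eq_coe]
  simp only [← Multiset.coe_add]
  abel

theorem Halves.nodup {L₀ L₁ C : List Pair} (h : Halves L₀ L₁ C) :
    (vertsOf L₀ ++ C.map Prod.fst).Nodup ∧ (vertsOf L₁ ++ C.map Prod.snd).Nodup := by
  have := (vertsOf_join L₀ L₁ C).nodup_iff.1 h.valid.2
  rw [List.nodup_append] at this
  exact ⟨this.1, List.Nodup.of_map _ this.2.1⟩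

theorem pairwise_apart {L : List Pair} (h : (vertsOf L).Nodup) : L.Pairwise Apart := by
  induction L with
  | nil => exact .nil
  | cons p L ih =>
    rw [vertsOf_cons, List.nodup_cons, List.nodup_cons, List.mem_cons, not_or] at h
    refine List.pairwise_cons.2 ⟨fun q hq => ?_, ih h.2.2⟩
    have h1 := mem_vertsOf.2 ⟨q, hq, Or.inl rfl⟩
    have h2 := mem_vertsOf.2 ⟨q, hq, Or.inr rfl⟩
    exact ⟨fun e => h.1.2 (e ▸ h1), fun e => h.1.2 (e ▸ h2), fun e => h.2.1 (e ▸ h1),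
      fun e => h.2.1 (e ▸ h2)⟩

theorem Halves.apart₀ {L₀ L₁ C : List Pair} (h : Halves L₀ L₁ C) : L₀.Pairwise Apart :=
  pairwise_apart (List.nodup_append.1 h.nodup.1).1

theorem Halves.apart₁ {L₀ L₁ C : List Pair} (h : Halves L₀ L₁ C) : L₁.Pairwise Apart :=
  pairwise_apart (List.nodup_append.1 h.nodup.2).1

theorem Halves.ne₀ {L₀ L₁ C : List Pair} (h : Halves L₀ L₁ C) {c p : Pair} (hc : c ∈ C)
    (hp : p ∈ L₀) : c.1 ≠ p.1 ∧ c.1 ≠ p.2 := by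
  have := (List.nodup_append.1 h.nodup.1).2.2
  exact ⟨(this _ (mem_vertsOf.2 ⟨p, hp, Or.inl rfl⟩) _ (List.mem_map_of_mem hc)).symm,
    (this _ (mem_vertsOf.2 ⟨p, hp, Or.inr rfl⟩) _ (List.mem_map_of_mem hc)).symm⟩

theorem Halves.ne₁ {L₀ L₁ C : List Pair} (h : Halves L₀ L₁ C) {c p : Pair} (hc : c ∈ C)
    (hp : p ∈ L₁) : c.2 ≠ p.1 ∧ c.2 ≠ p.2 := by
  have := (List.nodup_append.1 h.nodup.2).2.2
  exact ⟨(this _ (mem_vertsOf.2 ⟨p, hp, Or.inl rfl⟩) _ (List.mem_map_of_mem hc)).symm,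
    (this _ (mem_vertsOf.2 ⟨p, hp, Or.inr rfl⟩) _ (List.mem_map_of_mem hc)).symm⟩

theorem Apart.of_ne {x y : ℕ} {p : Pair} (hx : x ≠ p.1 ∧ x ≠ p.2) (hy : y ≠ p.1 ∧ y ≠ p.2) :
    Apart (x, y) p := ⟨hx.1, hx.2, hy.1, hy.2⟩

/-- A vertex of the lower half outside the pairs, whose neighbour in the upper half belongs to the
pairs, has a neighbour in the lower half outside the pairs. -/
theorem Halves.exists_adj {L₀ L₁ C : List Pair} (h : Halves L₀ L₁ C) {w : ℕ} (hw : w < 16)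
    (h₀ : w ∉ vertsOf L₀ ++ C.map Prod.fst) (h₁ : w ∈ vertsOf L₁ ++ C.map Prod.snd) :
    ∃ v < 16, Adj w v ∧ v ∉ vertsOf L₀ ++ C.map Prod.fst := by
  have hmem : ∀ v, v ∈ vertsOf (join L₀ L₁ C) ↔ v ∈ vertsOf L₀ ++ C.map Prod.fst ∨
      ∃ u ∈ vertsOf L₁ ++ C.map Prod.snd, 2 ^ 4 + u = v := fun v => by
    rw [(vertsOf_join L₀ L₁ C).mem_iff, List.mem_append (s := vertsOf L₀ ++ _), List.mem_map]
  obtain ⟨v, hv, hadj, hvn⟩ := h.noEnc w (by omega) (fun hc => by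
    rcases (hmem w).1 hc with hc | ⟨u, -, hu⟩
    · exact h₀ hc
    · omega)
  rw [hmem, not_or] at hvn
  by_cases hv16 : v < 16
  · exact ⟨v, hv16, hadj, hvn.1⟩
  · exfalso
    have key : ∀ w < 16, ∀ u < 16, adjB w (16 + u) = true → u = w := by decide +kernel
    have := key w hw (v - 16) (by omega) (by
      rw [show 16 + (v - 16) = v by omega]
      exact adjB_of_adj (by omega) (by omega) hadj)
    exact hvn.2 ⟨w, h₁, by omega⟩

theorem forall_lt_of_sameSys {L M : List Pair} (h : SameSys L M)
    (hL : ∀ p ∈ L, p.1 < 16 ∧ p.2 < 16) : ∀ p ∈ M, p.1 < 16 ∧ p.2 < 16 := by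
  have hv : ∀ v ∈ vertsOf L, v < 16 := fun v hv => by
    obtain ⟨p, hp, rfl | rfl⟩ := mem_vertsOf.1 hv
    · exact (hL p hp).1
    · exact (hL p hp).2
  exact fun p hp => ⟨hv _ (h.vertsOf.mem_iff.2 (mem_vertsOf.2 ⟨p, hp, Or.inl rfl⟩)),
    hv _ (h.vertsOf.mem_iff.2 (mem_vertsOf.2 ⟨p, hp, Or.inr rfl⟩))⟩

theorem sameSys_join {L₀ L₁ C M₀ M₁ D : List Pair} (h₀ : SameSys L₀ M₀) (h₁ : SameSys L₁ M₁)
    (hC : C.Perm D) : SameSys (join L₀ L₁ C) (join M₀ M₁ D) :=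
  SameSys.append (.of_perm (hC.map _)) (h₀.append (h₁.map (2 ^ 4 + ·)))

theorem Halves.congr {L₀ L₁ C M₀ M₁ D : List Pair} (h : Halves L₀ L₁ C) (h₀ : SameSys L₀ M₀)
    (h₁ : SameSys L₁ M₁) (hC : C.Perm D) : Halves M₀ M₁ D :=
  have hj := sameSys_join h₀ h₁ hC
  ⟨forall_lt_of_sameSys h₀ h.lt₀, forall_lt_of_sameSys h₁ h.lt₁,
    fun p hp => h.ltC p (hC.mem_iff.2 hp), hj.valid h.valid,
    hj.noEnc h.noEnc⟩

theorem linked_join_congr {L₀ L₁ C M₀ M₁ D : List Pair} (h₀ : SameSys L₀ M₀)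
    (h₁ : SameSys L₁ M₁) (hC : C.Perm D) (h : Linked 5 (join M₀ M₁ D)) : Linked 5 (join L₀ L₁ C) :=
  (sameSys_join h₀ h₁ hC).symm.linked h

/-- Action of a map of `Q 4` on both halves of `Q 5`. -/
def onHalves (g : ℕ → ℕ) (v : ℕ) : ℕ := if v < 16 then g v else 2 ^ 4 + g (v - 16)

theorem par_add_sixteen {v : ℕ} (hv : v < 16) : par (2 ^ 4 + v) = 1 - par v := by
  have : ∀ v < 16, par (2 ^ 4 + v) = 1 - par v := by decide +kernel
  exact this v hv

theorem isAut_onHalves {g : ℕ → ℕ} (hg : IsAut 4 g) : IsAut 5 (onHalves g) := by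
  have hlt : ∀ a < 16, g a < 16 := hg.lt
  have hadj : ∀ a < 16, ∀ b < 16, adjB a (16 + b) = true → a = b := by decide +kernel
  have hcross : ∀ a < 16, ∀ b < 16, Adj a (2 ^ 4 + b) → a = b := fun a ha b hb h =>
    hadj a ha b hb (adjB_of_adj (by omega) (by omega) h)
  have hcode : ∀ a < 2 ^ 5, ∃ b < 16, a = b ∨ a = 2 ^ 4 + b := fun a ha => by
    by_cases h : a < 16
    · exact ⟨a, h, Or.inl rfl⟩
    · exact ⟨a - 16, by omega, Or.inr (by omega)⟩
  have hlo : ∀ a < 16, onHalves g a = g a := fun a ha => if_pos ha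
  have hhi : ∀ a < 16, onHalves g (2 ^ 4 + a) = 2 ^ 4 + g a := fun a ha => by
    unfold onHalves
    rw [if_neg (by omega), show 2 ^ 4 + a - 16 = a by omega]
  refine ⟨fun a ha => ?_, fun a ha b hb hab => ?_, fun a ha b hb hab => ?_, fun a ha b hb hab => ?_⟩
  · obtain ⟨a, ha', rfl | rfl⟩ := hcode a ha
    · rw [hlo a ha']; have := hlt a ha'; omega
    · rw [hhi a ha']; have := hlt a ha'; omega
  all_goals
    obtain ⟨a, ha', rfl | rfl⟩ := hcode a ha <;> obtain ⟨b, hb', rfl | rfl⟩ := hcode b hb <;>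
    have ha2 := hlt a ha' <;> have hb2 := hlt b hb'
  · rw [hlo a ha', hlo b hb'] at hab
    exact hg.inj a ha' b hb' hab
  · rw [hlo a ha', hhi b hb'] at hab
    omega
  · rw [hhi a ha', hlo b hb'] at hab
    omega
  · rw [hhi a ha', hhi b hb'] at hab
    rw [hg.inj a ha' b hb' (by omega)]
  · rw [hlo a ha', hlo b hb']
    exact hg.adj a ha' b hb' hab
  · rw [hlo a ha', hhi b hb', hcross a ha' b hb' hab]
    exact ⟨4, xor_two_pow_add hb2⟩
  · rw [hhi a ha', hlo b hb', hcross b hb' a ha' hab.symm]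
    exact Adj.symm ⟨4, xor_two_pow_add ha2⟩
  · rw [hhi a ha', hhi b hb']
    obtain ⟨i, hi⟩ := hab
    rw [two_pow_add_xor (n := 4) ha' hb'] at hi
    obtain ⟨j, hj⟩ := hg.adj a ha' b hb' ⟨i, hi⟩
    exact ⟨j, by rw [two_pow_add_xor ha2 hb2, hj]⟩
  all_goals
    have := par_lt a
    have := par_lt b
    have := par_lt (g a)
    have := par_lt (g b)
    have hp : par (g a) = par (g b) → par a = par b := fun h => by
      by_contra hc
      exact hg.par a ha' b hb' hc h
    have hq : par a = par b → par (g a) = par (g b) := fun h => by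
      -- a neighbour of `b` has the other parity
      have h1 : par (b ^^^ 2 ^ 0) ≠ par b := par_xor_two_pow (by omega) (by norm_num)
      have h2 : b ^^^ 2 ^ 0 < 2 ^ 4 := xor_two_pow_lt hb' (by norm_num)
      have h3 := hg.par _ h2 b hb' h1
      have h4 := hg.par _ h2 a ha' (by rw [h]; exact h1)
      have := par_lt (g (b ^^^ 2 ^ 0))
      omega
  · rw [hlo a ha', hlo b hb']
    exact hg.par a ha' b hb' hab
  · rw [par_add_sixteen hb'] at hab
    rw [hlo a ha', hhi b hb', par_add_sixteen hb2]
    omega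
  · rw [par_add_sixteen ha'] at hab
    rw [hhi a ha', hlo b hb', par_add_sixteen ha2]
    omega
  · rw [par_add_sixteen ha', par_add_sixteen hb'] at hab
    rw [hhi a ha', hhi b hb', par_add_sixteen ha2, par_add_sixteen hb2]
    omega

theorem map_join {g : ℕ → ℕ} {L₀ L₁ C : List Pair} (lt₀ : ∀ p ∈ L₀, p.1 < 16 ∧ p.2 < 16)
    (ltC : ∀ p ∈ C, p.1 < 16 ∧ p.2 < 16) :
    (join L₀ L₁ C).map (mapPair (onHalves g)) =
      join (L₀.map (mapPair g)) (L₁.map (mapPair g)) (C.map (mapPair g)) := by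
  have hlo : ∀ a < 16, onHalves g a = g a := fun a ha => if_pos ha
  have hhi : ∀ a, onHalves g (2 ^ 4 + a) = 2 ^ 4 + g a := fun a => by
    unfold onHalves
    rw [if_neg (by omega), show 2 ^ 4 + a - 16 = a by omega]
  unfold join
  simp only [List.map_append, List.map_map]
  congr 1
  · exact List.map_congr_left fun p hp =>
      Prod.ext (hlo _ (ltC p hp).1) (hhi _)
  congr 1
  · exact List.map_congr_left fun p hp => Prod.ext (hlo _ (lt₀ p hp).1) (hlo _ (lt₀ p hp).2)
  · exact List.map_congr_left fun p hp => Prod.ext (hhi _) (hhi _)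

theorem Halves.map {L₀ L₁ C : List Pair} (h : Halves L₀ L₁ C) {g : ℕ → ℕ} (hg : IsAut 4 g) :
    Halves (L₀.map (mapPair g)) (L₁.map (mapPair g)) (C.map (mapPair g)) := by
  have hlt : ∀ L : List Pair, (∀ p ∈ L, p.1 < 16 ∧ p.2 < 16) →
      ∀ p ∈ L.map (mapPair g), p.1 < 16 ∧ p.2 < 16 := fun L hL q hq => by
    obtain ⟨p, hp, rfl⟩ := List.mem_map.1 hq
    exact ⟨hg.lt _ (hL p hp).1, hg.lt _ (hL p hp).2⟩
  refine ⟨hlt _ h.lt₀, hlt _ h.lt₁, hlt _ h.ltC, ?_, ?_⟩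
  · rw [← map_join h.lt₀ h.ltC]
    exact h.valid.map (isAut_onHalves hg)
  · rw [← map_join h.lt₀ h.ltC]
    exact h.noEnc.map h.valid (isAut_onHalves hg)

theorem Halves.linked_of_map {L₀ L₁ C : List Pair} (h : Halves L₀ L₁ C) {g : ℕ → ℕ}
    (hg : IsAut 4 g)
    (hl : Linked 5 (join (L₀.map (mapPair g)) (L₁.map (mapPair g)) (C.map (mapPair g)))) :
    Linked 5 (join L₀ L₁ C) := by
  rw [← map_join h.lt₀ h.ltC] at hl
  exact Linked.of_map (isAut_onHalves hg) (fun p hp => ⟨(h.valid.1 p hp).1, (h.valid.1 p hp).2.1⟩) hl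

/-- The table of the automorphism of `Q 5` that exchanges the two halves. -/
def topTab : ℕ := 0x7b9ac5a928398a418820ffbbcdeb38bdab49ca30

theorem topTab_spec : IsAut 5 (app topTab) ∧ (∀ v < 16, app topTab v = 2 ^ 4 + v) ∧
    ∀ v < 16, app topTab (2 ^ 4 + v) = v := by
  refine ⟨isAut_of_check (by decide +kernel), by decide +kernel, by decide +kernel⟩

theorem sameSys_swap {L₀ L₁ C : List Pair} (lt₀ : ∀ p ∈ L₀, p.1 < 16 ∧ p.2 < 16)
    (lt₁ : ∀ p ∈ L₁, p.1 < 16 ∧ p.2 < 16) (ltC : ∀ p ∈ C, p.1 < 16 ∧ p.2 < 16) :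
    SameSys ((join L₀ L₁ C).map (appP topTab)) (join L₁ L₀ (C.map Prod.swap)) := by
  obtain ⟨-, hlo, hhi⟩ := topTab_spec
  unfold join
  simp only [List.map_append, List.map_map]
  refine SameSys.append ?_ ?_
  · unfold SameSys
    rw [List.map_map, List.map_map]
    refine List.Perm.of_eq (List.map_congr_left fun p hp => ?_)
    change s(app topTab p.1, app topTab (2 ^ 4 + p.2)) = s(p.2, 2 ^ 4 + p.1)
    rw [hlo _ (ltC p hp).1, hhi _ (ltC p hp).2, Sym2.eq_swap]
  · refine SameSys.trans (.of_perm List.perm_append_comm) (.of_perm (List.Perm.of_eq ?_))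
    congr 1
    · conv_rhs => rw [← List.map_id L₁]
      exact List.map_congr_left fun p hp => Prod.ext (hhi _ (lt₁ p hp).1) (hhi _ (lt₁ p hp).2)
    · exact List.map_congr_left fun p hp => Prod.ext (hlo _ (lt₀ p hp).1) (hlo _ (lt₀ p hp).2)

theorem Halves.swap {L₀ L₁ C : List Pair} (h : Halves L₀ L₁ C) :
    Halves L₁ L₀ (C.map Prod.swap) := by
  have hs := sameSys_swap h.lt₀ h.lt₁ h.ltC
  refine ⟨h.lt₁, h.lt₀, fun q hq => ?_, hs.valid (h.valid.map topTab_spec.1),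
    hs.noEnc (h.noEnc.map h.valid topTab_spec.1)⟩
  obtain ⟨p, hp, rfl⟩ := List.mem_map.1 hq
  exact (h.ltC p hp).symm

theorem Halves.linked_of_swap {L₀ L₁ C : List Pair} (h : Halves L₀ L₁ C)
    (hl : Linked 5 (join L₁ L₀ (C.map Prod.swap))) : Linked 5 (join L₀ L₁ C) :=
  Linked.of_map_same topTab_spec.1 h.valid (sameSys_swap h.lt₀ h.lt₁ h.ltC) hl

/-- An edge in the lower half may be assumed to be `{0, 1}`, and another pair in the lower half may
be assumed to be one of the nine pairs in `repTab`. -/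
theorem Halves.linked_of_edge {p q : Pair} {L₀ L₁ C : List Pair} (h : Halves (p :: q :: L₀) L₁ C)
    (hedge : isEdge p = true)
    (H : ∀ g, IsAut 4 g → ∀ k < 9, SameEnds (mapPair g q) (pairOf (byte repTab k)) →
      Halves ((0, 1) :: pairOf (byte repTab k) :: L₀.map (mapPair g)) (L₁.map (mapPair g))
        (C.map (mapPair g)) →
      Linked 5 (join ((0, 1) :: pairOf (byte repTab k) :: L₀.map (mapPair g)) (L₁.map (mapPair g))
        (C.map (mapPair g)))) :
    Linked 5 (join (p :: q :: L₀) L₁ C) := by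
  have hp := h.odd₀ p (by simp)
  have hq := h.odd₀ q (by simp)
  obtain ⟨i, hi⟩ := adj_of_adjB hedge
  have hi4 : i < 4 := by
    have : p.1 ^^^ p.2 < 2 ^ 4 := Nat.xor_lt_two_pow hp.1 hp.2.1
    rw [hi] at this
    exact (Nat.pow_lt_pow_iff_right (by norm_num)).1 this
  obtain ⟨haut, hpe⟩ := edgeTabs_spec hp.1 hi4
  have hp2 : p.1 ^^^ 2 ^ i = p.2 := by
    rw [← hi, ← Nat.xor_assoc, Nat.xor_self, Nat.zero_xor]
  rw [hp2] at hpe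
  set P := subTab edgeTabs (16 * i + p.1)
  have hq1 := haut.odd4 hq
  obtain ⟨hc, hqc⟩ := codeP_spec hq1
  have hnorm := normTab_spec hc
  have hk : byte normTab (codeP (appP P q)) % 16 < 9 := by
    have key : allN 64 (fun c => sel (apart (0, 1) (pairOf c))
        (Nat.blt (Nat.mod (byte normTab c) 16) 9) true) = true := by decide +kernel
    have hn := (h.map haut).nodup.1
    have hap : Apart (0, 1) (appP P q) := by
      rw [List.map_cons, List.map_cons, mapPair_app, show appP P p = (0, 1) from hpe] at hn
      simp only [vertsOf_cons, List.cons_append, List.nodup_cons, List.mem_cons, not_or] at hn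
      exact ⟨hn.1.2.1, hn.1.2.2.1, hn.2.1.1, hn.2.1.2.1⟩
    have := allN_iff.1 key _ hc
    rw [apart_iff.2 (hap.congr (.refl _) hqc), sel_true, Nat.blt_eq] at this
    exact this
  rcases hnorm with h15 | ⟨h12, hrep⟩
  · omega
  obtain ⟨haut2, hfix⟩ := stabTabs_aut h12
  set R := subTab stabTabs (byte normTab (codeP (appP P q)) / 16)
  have hg := haut2.comp haut
  have hqq : SameEnds (mapPair (app R ∘ app P) q)
      (pairOf (byte repTab (byte normTab (codeP (appP P q)) % 16))) := by
    rw [← hrep]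
    have h2 := (codeP_spec (haut2.odd4 (odd4_pairOf_codeP hq1))).2
    have h1 : SameEnds (appP R (appP P q)) (appP R (pairOf (codeP (appP P q)))) := by
      rcases hqc with e | e
      · exact Or.inl (by rw [e])
      · exact Or.inr (by rw [e]; rfl)
    rw [sameEnds_iff] at h1 h2 ⊢
    exact h1.trans h2
  have hpp : SameEnds (mapPair (app R ∘ app P) p) (0, 1) := by
    have : mapPair (app R ∘ app P) p = appP R (appP P p) := rfl
    rw [this, show appP P p = (0, 1) from hpe]
    exact hfix
  have hm := h.map hg
  refine h.linked_of_map hg ?_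
  rw [List.map_cons, List.map_cons] at hm ⊢
  have hsame := SameSys.cons hpp (SameSys.cons hqq (.refl (L₀.map (mapPair (app R ∘ app P)))))
  exact linked_join_congr hsame (.refl _) (.refl _)
    (H _ hg _ hk hqq (hm.congr hsame (.refl _) (.refl _)))

/-! ### Five pairs with few crossing pairs -/

theorem exists_opposite (v : ℕ) (E : List ℕ) (hE : E.length < 8) :
    ∃ u ∈ opposite v, u ∉ E := by
  have hnd : (opposite v).Nodup ∧ (opposite v).length = 8 := by
    unfold opposite
    cases Nat.beq (par v) 0 <;> decide
  by_contra! h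
  have := (hnd.1.subperm h).length_le
  omega

/-- The entry of `p` whose parity differs from that of `v`. -/
def farEnd (v : ℕ) (p : Pair) : ℕ := if par p.1 = par v then p.2 else p.1

theorem ne_of_ne_farEnd {u v : ℕ} {p : Pair} (hu : u ∈ opposite v) (hp : Odd4 p)
    (h : u ≠ farEnd v p) : u ≠ p.1 ∧ u ≠ p.2 := by
  have hu' := (mem_opposite.1 hu).2
  have h1 := hp.2.2
  have := par_lt u
  have := par_lt v
  have := par_lt p.1
  have := par_lt p.2
  unfold farEnd at h
  split at h
  · refine ⟨fun e => ?_, h⟩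
    subst e
    omega
  · refine ⟨h, fun e => ?_⟩
    subst e
    omega

/-- No pair crosses, so that the two halves are treated separately. -/
theorem linked_join_three_two {p q r p' q' : Pair} (h : Halves [p, q, r] [p', q'] [])
    (hedge : isEdge p = true) : Linked 5 (join [p, q, r] [p', q'] []) := by
  have a₀ := h.apart₀
  have a₁ := h.apart₁
  simp only [List.pairwise_cons, List.mem_cons, List.not_mem_nil, or_false, forall_eq_or_imp,
    forall_eq] at a₀ a₁
  exact Linked.glue [] (linked_edge_two (h.odd₀ p (by simp)) (h.odd₀ q (by simp))
    (h.odd₀ r (by simp)) hedge a₀.1.1 a₀.1.2 a₀.2.1)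
    (linked_two (h.odd₁ p' (by simp)) (h.odd₁ q' (by simp)) a₁.1)

theorem xor_eq_iff {a b c : ℕ} : a ^^^ b = c ↔ a = b ^^^ c := by
  constructor
  · rintro rfl
    rw [Nat.xor_comm a b, ← Nat.xor_assoc, Nat.xor_self, Nat.zero_xor]
  · rintro rfl
    rw [Nat.xor_comm b c, Nat.xor_assoc, Nat.xor_self, Nat.xor_zero]

/-- Among the eight candidates for the crossing vertex of `c`, at most four belong to the pairs, and
one more may lead to three pairs with equal differences in the upper half. -/
theorem linked_join_two_two {p q p' q' c : Pair} (h : Halves [p, q] [p', q'] [c])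
    (hedge : isEdge p = true) : Linked 5 (join [p, q] [p', q'] [c]) := by
  have a₀ := h.apart₀
  have a₁ := h.apart₁
  simp only [List.pairwise_cons, List.mem_cons, List.not_mem_nil, or_false, forall_eq] at a₀ a₁
  have hp := h.odd₀ p (by simp)
  have hq := h.odd₀ q (by simp)
  have hp' := h.odd₁ p' (by simp)
  have hq' := h.odd₁ q' (by simp)
  obtain ⟨c1, c2, c3⟩ := h.even c (by simp)
  -- the last entry excludes that the three pairs in the upper half have equal differences
  obtain ⟨u, hu, hE⟩ := exists_opposite c.1 [farEnd c.1 p, farEnd c.1 q, farEnd c.1 p',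
    farEnd c.1 q', c.2 ^^^ (p'.1 ^^^ p'.2)] (by simp)
  simp only [List.mem_cons, List.not_mem_nil, or_false, not_or] at hE
  have e1 := ne_of_ne_farEnd hu hp hE.1
  have e2 := ne_of_ne_farEnd hu hq hE.2.1
  have e3 := ne_of_ne_farEnd hu hp' hE.2.2.1
  have e4 := ne_of_ne_farEnd hu hq' hE.2.2.2.1
  have hne : u ^^^ c.2 ≠ p'.1 ^^^ p'.2 := fun e => hE.2.2.2.2 (xor_eq_iff.1 e)
  obtain ⟨u1, u2⟩ := mem_opposite.1 hu
  have k₀ : Linked 4 [p, (c.1, u), q] := linked_edge_two hp ⟨c1, u1, u2.symm⟩ hq hedge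
    (Apart.of_ne (h.ne₀ (by simp) (by simp)) e1).symm a₀.1
    (Apart.of_ne (h.ne₀ (by simp) (by simp)) e2)
  have k₁ : Linked 4 [(u, c.2), p', q'] := linked_three ⟨u1, c2, c3 ▸ u2⟩ hp' hq'
    (Apart.of_ne e3 (h.ne₁ (by simp) (by simp))) (Apart.of_ne e4 (h.ne₁ (by simp) (by simp)))
    a₁.1 (Or.inl hne)
  exact Linked.glue [(c.1, u, c.2)] (k₀.perm (.swap _ _ _)) k₁

/-- Pass to `k` the entries of `l` which satisfy `f`, in reverse order and followed by `acc`. -/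
def filterTo {α β : Type} (f : α → Bool) (l : List α) (k : List α → β) : List α → β :=
  List.rec k (fun a _ ih acc => sel (f a) (ih (a :: acc)) (ih acc)) l

theorem filterTo_eq {α β : Type} (f : α → Bool) (l : List α) (k : List α → β) (acc : List α) :
    filterTo f l k acc = k ((l.filter f).reverse ++ acc) := by
  induction l generalizing acc with
  | nil => rfl
  | cons a l ih =>
    change sel (f a) (filterTo f l k (a :: acc)) (filterTo f l k acc) = _
    rw [ih, ih]
    cases h : f a
    · rw [sel_false, List.filter_cons_of_neg (by simp [h])]
    · rw [sel_true, List.filter_cons_of_pos (by simp [h])]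
      simp

/-- `v` does not occur in the list. -/
def avoids (l : List ℕ) (v : ℕ) : Bool := allL (fun u => sel (Nat.beq u v) false true) l

theorem avoids_iff {l : List ℕ} {v : ℕ} : avoids l v = true ↔ v ∉ l := by
  have h : ∀ c : Bool, sel c false true = true ↔ ¬ c = true := by decide
  simp only [avoids, allL_iff, h, Nat.beq_eq]
  exact ⟨fun h' hv => h' v hv rfl, fun h' u hu e => h' (e ▸ hu)⟩

/-- The vertex `w` of `Q 4` is not in the list, but all its neighbours are. -/
def enclosed (l : List ℕ) (w : ℕ) : Bool :=
  sel (avoids l w) (allN 4 fun i => sel (avoids l (Nat.xor w (Nat.pow 2 i))) false true) false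

theorem Halves.not_enclosed {L₀ L₁ C : List Pair} (h : Halves L₀ L₁ C) {w : ℕ} (hw : w < 16)
    (h₁ : w ∈ vertsOf L₁ ++ C.map Prod.snd) :
    enclosed (vertsOf L₀ ++ C.map Prod.fst) w = false := by
  rw [Bool.eq_false_iff]
  intro hc
  rw [enclosed, sel_false_right, avoids_iff, allN_iff] at hc
  obtain ⟨v, hv, ⟨i, hi⟩, hvn⟩ := h.exists_adj hw hc.1 h₁
  have hi4 : i < 4 := by
    have : w ^^^ v < 2 ^ 4 := Nat.xor_lt_two_pow hw hv
    rw [hi] at this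
    exact (Nat.pow_lt_pow_iff_right (by norm_num)).1 this
  have h' : avoids (vertsOf L₀ ++ C.map Prod.fst) (w ^^^ 2 ^ i) = true := by
    rw [← xor_eq_iff.1 ((Nat.xor_comm v w).trans hi), avoids_iff]
    exact hvn
  have := hc.2 i hi4
  rw [show Nat.xor w (Nat.pow 2 i) = w ^^^ 2 ^ i from rfl, h'] at this
  exact absurd this (by simp)

theorem farEnd_mem_opposite {p : Pair} (hp : Odd4 p) (v : ℕ) : farEnd v p ∈ opposite v := by
  rw [mem_opposite]
  have := par_lt v
  have := par_lt p.1
  have := par_lt p.2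
  obtain ⟨h1, h2, h3⟩ := hp
  unfold farEnd
  split
  · exact ⟨h2, by omega⟩
  · exact ⟨h1, by omega⟩

theorem farEnd_eq (v : ℕ) (p : Pair) : farEnd v p = p.1 ∨ farEnd v p = p.2 := by
  unfold farEnd
  split
  · exact Or.inr rfl
  · exact Or.inl rfl

theorem IsAut.isEdge {g : ℕ → ℕ} (hg : IsAut 4 g) {p : Pair} (hp : Odd4 p)
    (h : isEdge p = true) : isEdge (mapPair g p) = true :=
  adjB_of_adj (lt_trans (hg.lt _ hp.1) (by norm_num)) (lt_trans (hg.lt _ hp.2.1) (by norm_num))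
    (hg.adj _ hp.1 _ hp.2.1 (adj_of_adjB h))

theorem SameEnds.isEdge {p q : Pair} (h : SameEnds p q) : isEdge q = isEdge p := by
  rcases h with rfl | rfl
  · rfl
  · unfold Hypercube.isEdge adjB
    rw [show Nat.xor (p.2, p.1).1 (p.2, p.1).2 = Nat.xor p.1 p.2 from Nat.xor_comm _ _]

/-- The vertex `α` of the lower half is the end of a crossing pair, and `w` is a vertex not
available for crossing. Unless `w` is enclosed by the pairs in the lower half, there is a crossing
vertex `u` different from `w` for which the pairs `{0, 1}`, `q`, `r`, `{α, u}` are joined. -/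
def checkThreeOne (q r : Pair) (α : ℕ) : Bool :=
  sel (avoids [0, 1, q.1, q.2, r.1, r.2] α)
    (filterTo (fun u => look q r (α, u)) (opposite α) (fun G => allL (fun w =>
      sel (anyL (fun u => sel (Nat.beq u w) false true) G) true
        (enclosed [0, 1, q.1, q.2, r.1, r.2, α] w)) (opposite α)) []) true

theorem checkThreeOne_eq {k : ℕ} (hk : k < 9) (he : isEdge (pairOf (byte repTab k)) = true)
    {r : Pair} (hr : Odd4 r) (h₁ : Apart (0, 1) (pairOf (codeP r)))
    (h₂ : Apart (pairOf (byte repTab k)) (pairOf (codeP r))) {α : ℕ} (hα : α < 16) :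
    checkThreeOne (pairOf (byte repTab k)) (pairOf (codeP r)) α = true := by
  have h : allN 9 (fun k => forceP (pairOf (byte repTab k)) fun q => sel (isEdge q) (allN 64 fun b =>
      forceP (pairOf b) fun r => sel (sel (apart (0, 1) r) (apart q r) false)
        (allN 16 fun α => checkThreeOne q r α) true) true) = true := by
    decide +kernel
  have := allN_iff.1 h k hk
  rw [forceP_eq, he, sel_true] at this
  have := allN_iff.1 this _ (codeP_spec hr).1
  rw [forceP_eq, apart_iff.2 h₁, apart_iff.2 h₂, sel_true, sel_true] at this
  exact allN_iff.1 this α hα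

/-- In the upper half, the crossing vertex of `c` has to avoid only one entry of `p'` for reasons of
parity. This entry is not enclosed by the pairs in the lower half, and so `checkThreeOne` provides a
crossing vertex. -/
theorem linked_join_three_one {p q r p' c : Pair} (h : Halves [p, q, r] [p'] [c])
    (hp : isEdge p = true) (hq : isEdge q = true) : Linked 5 (join [p, q, r] [p'] [c]) := by
  have oq := h.odd₀ q (by simp)
  refine h.linked_of_edge hp fun g hg k hk hqk h => ?_
  replace hq := hg.isEdge oq hq
  rw [← hqk.isEdge] at hq
  clear oq hqk
  simp only [List.map_cons, List.map_nil] at h ⊢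
  generalize mapPair g r = r at *
  generalize mapPair g p' = p' at *
  generalize mapPair g c = c at *
  have hr := h.odd₀ r (by simp)
  have hck := fun α => checkThreeOne_eq hk hq hr (α := α)
  have hsame : SameSys [(0, 1), pairOf (byte repTab k), r]
      [(0, 1), pairOf (byte repTab k), pairOf (codeP r)] :=
    .cons (.refl _) (.cons (.refl _) (.cons (codeP_spec hr).2 (.refl _)))
  replace h := h.congr hsame (.refl _) (.refl _)
  refine linked_join_congr hsame (.refl _) (.refl _) ?_
  clear hsame hr
  generalize pairOf (byte repTab k) = q at *
  generalize pairOf (codeP r) = r at *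
  have oq := h.odd₀ q (by simp)
  have or := h.odd₀ r (by simp)
  have op' := h.odd₁ p' (by simp)
  obtain ⟨c1, c2, c3⟩ := h.even c (by simp)
  have a₀ := h.apart₀
  simp only [List.pairwise_cons, List.mem_cons, List.not_mem_nil, or_false, forall_eq_or_imp,
    forall_eq] at a₀
  have henc := h.not_enclosed (mem_opposite.1 (farEnd_mem_opposite op' c.1)).1 (by
    rcases farEnd_eq c.1 p' with e | e <;> rw [e] <;> simp [vertsOf])
  simp only [vertsOf, List.flatMap_cons, List.flatMap_nil, List.map_nil, List.map_cons,
    List.append_nil, List.cons_append, List.nil_append] at henc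
  replace hck := hck c.1 a₀.1.2 a₀.2.1 c1
  have g4 : avoids [0, 1, q.1, q.2, r.1, r.2] c.1 = true := by
    have g1 := h.ne₀ (c := c) (p := (0, 1)) (by simp) (by simp)
    have g2 := h.ne₀ (c := c) (p := q) (by simp) (by simp)
    have g3 := h.ne₀ (c := c) (p := r) (by simp) (by simp)
    rw [avoids_iff]
    simp only [List.mem_cons, List.not_mem_nil, or_false, not_or]
    exact ⟨g1.1, g1.2, g2.1, g2.2, g3.1, g3.2⟩
  rw [checkThreeOne, g4, filterTo_eq] at hck
  simp only [sel_true] at hck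
  have := allL_iff.1 hck _ (farEnd_mem_opposite op' c.1)
  rw [henc, sel_true_left, or_iff_left (by simp), anyL_iff] at this
  obtain ⟨u, hu, huw⟩ := this
  rw [List.append_nil, List.mem_reverse, List.mem_filter] at hu
  have hne : u ≠ farEnd c.1 p' := fun e => by
    rw [e, Nat.beq_refl] at huw
    exact absurd huw (by simp)
  have e1 := ne_of_ne_farEnd hu.1 op' hne
  obtain ⟨u1, u2⟩ := mem_opposite.1 hu.1
  have k₀ := linked_of_look oq or (s := (c.1, u)) ⟨c1, u1, u2.symm⟩ hu.2
  have k₁ : Linked 4 [(u, c.2), p'] := linked_two ⟨u1, c2, c3 ▸ u2⟩ op'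
    (Apart.of_ne e1 (h.ne₁ (by simp) (by simp)))
  refine Linked.glue [(c.1, u, c.2)] (k₀.perm ?_) k₁
  exact (List.perm_append_comm (l₁ := [(0, 1), q, r]) (l₂ := [(c.1, u)]))

/-! ### Two crossing pairs -/

/-- Pass to `k` the list of all `(u, row)`, where `u` runs through the unused vertices of `Q 4` with
parity different from that of `α`, and `row` consists of the unused vertices `v` with parity
different from that of `β`, different from `u`, for which the pairs `{0, 1}`, `q`, `{α, u}`, `{β,
v}` pass the test `look`. -/
def rowsTo (q : Pair) (α β : ℕ) (k : List (ℕ × List ℕ) → Bool) : Bool :=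
  force (Nat.lor 3 (Nat.lor (Nat.lor (single q.1) (single q.2)) (Nat.lor (single α) (single β))))
    fun used => filterTo (fun u => sel (hasBit used u) false true) (opposite β) (fun V =>
      (List.rec k (fun u _ ih acc => sel (hasBit used u) (ih acc)
        (filterTo (fun v => sel (Nat.beq u v) false (look q (α, u) (β, v))) V
          (fun row => ih ((u, row) :: acc)) [])) (opposite α) : List (ℕ × List ℕ) → Bool) []) []

theorem rowsTo_spec (q : Pair) (α β : ℕ) : ∃ R : List (ℕ × List ℕ), (∀ ρ ∈ R, ρ.1 ∈ opposite α ∧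
    ρ.2.Nodup ∧ ∀ v ∈ ρ.2, v ∈ opposite β ∧ ρ.1 ≠ v ∧ look q (α, ρ.1) (β, v) = true) ∧
    ∀ k, rowsTo q α β k = k R := by
  have hnd : (opposite β).Nodup := by
    unfold opposite
    cases Nat.beq (par β) 0 <;> decide
  set used := Nat.lor 3 (Nat.lor (Nat.lor (single q.1) (single q.2))
    (Nat.lor (single α) (single β))) with hused
  set V := ((opposite β).filter fun u => sel (hasBit used u) false true).reverse ++ [] with hV
  have hV1 : V.Nodup := by
    rw [hV, List.append_nil, List.nodup_reverse]
    exact hnd.filter _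
  have hV2 : ∀ v ∈ V, v ∈ opposite β := fun v hv => by
    rw [hV, List.append_nil, List.mem_reverse] at hv
    exact (List.mem_filter.1 hv).1
  suffices H : ∀ l : List ℕ, (∀ u ∈ l, u ∈ opposite α) → ∀ acc : List (ℕ × List ℕ),
      (∀ ρ ∈ acc, ρ.1 ∈ opposite α ∧
      ρ.2.Nodup ∧ ∀ v ∈ ρ.2, v ∈ opposite β ∧ ρ.1 ≠ v ∧ look q (α, ρ.1) (β, v) = true) →
      ∃ R : List (ℕ × List ℕ), (∀ ρ ∈ R, ρ.1 ∈ opposite α ∧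
      ρ.2.Nodup ∧ ∀ v ∈ ρ.2, v ∈ opposite β ∧ ρ.1 ≠ v ∧ look q (α, ρ.1) (β, v) = true) ∧
      ∀ k : List (ℕ × List ℕ) → Bool, (List.rec k (fun u _ ih acc => sel (hasBit used u) (ih acc)
        (filterTo (fun v => sel (Nat.beq u v) false (look q (α, u) (β, v))) V
          (fun row => ih ((u, row) :: acc)) [])) l : List (ℕ × List ℕ) → Bool) acc = k R by
    obtain ⟨R, hR, hk⟩ := H _ (fun u hu => hu) [] (by simp)
    refine ⟨R, hR, fun k => ?_⟩
    rw [rowsTo, force_eq, filterTo_eq]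
    exact hk k
  intro l
  induction l with
  | nil => exact fun _ acc hacc => ⟨acc, hacc, fun k => rfl⟩
  | cons u l ih =>
    intro hl acc hacc
    cases hu : hasBit used u
    · obtain ⟨R, hR, hk⟩ := ih (fun u hu => hl u (by simp [hu]))
        ((u, (V.filter fun v => sel (Nat.beq u v) false (look q (α, u) (β, v))).reverse ++ []) :: acc) (by
          simp only [List.mem_cons, forall_eq_or_imp]
          refine ⟨⟨hl u (by simp), ?_, fun v hv => ?_⟩, hacc⟩
          · rw [List.append_nil, List.nodup_reverse]
            exact hV1.filter _
          · rw [List.append_nil, List.mem_reverse, List.mem_filter] at hv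
            have h := hv.2
            cases huv : Nat.beq u v
            · rw [huv, sel_false] at h
              exact ⟨hV2 v hv.1, Nat.ne_of_beq_eq_false huv, h⟩
            · rw [huv] at h
              exact absurd h (by simp))
      refine ⟨R, hR, fun k => ?_⟩
      refine Eq.trans ?_ (hk k)
      dsimp only
      rw [hu, sel_false, filterTo_eq]
    · obtain ⟨R, hR, hk⟩ := ih (fun u hu => hl u (by simp [hu])) acc hacc
      refine ⟨R, hR, fun k => ?_⟩
      refine Eq.trans ?_ (hk k)
      dsimp only
      rw [hu, sel_true]

/-- The pair `(u, v)` differs from `(x, y)`. -/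
def notBoth (u v x y : ℕ) : Bool := sel (Nat.beq u x) (sel (Nat.beq v y) false true) true

theorem notBoth_iff {u v x y : ℕ} : notBoth u v x y = true ↔ ¬ (u = x ∧ v = y) := by
  have h : ∀ a b : Bool, sel a (sel b false true) true = true ↔ ¬ (a = true ∧ b = true) := by
    decide
  rw [notBoth, h, Nat.beq_eq, Nat.beq_eq]

/-- The vertex `u` differs from `x` and `y`. -/
def neBoth (u x y : ℕ) : Bool := sel (Nat.beq u x) false (sel (Nat.beq u y) false true)

theorem neBoth_iff {u x y : ℕ} : neBoth u x y = true ↔ u ≠ x ∧ u ≠ y := by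
  have h : ∀ a b : Bool, sel a false (sel b false true) = true ↔ ¬ a = true ∧ ¬ b = true := by
    decide
  rw [neBoth, h, Nat.beq_eq, Nat.beq_eq]

/-- Two vertices `α`, `β` of the same parity and one blocked vertex `w`: some `u ≠ w` can be
combined with at least three vertices `v`, so that at least one choice of the crossing vertices `u`,
`v` remains after the exclusion of `w` and one further vertex for `v`; or else `w` is enclosed. -/
def checkSame (q : Pair) (α β : ℕ) : Bool := rowsTo q α β fun R =>
  allL (fun w => sel (anyL (fun ρ => sel (Nat.beq ρ.1 w) false (Nat.ble 3 (len ρ.2))) R) true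
    (enclosed [0, 1, q.1, q.2, α, β] w)) (opposite α)

/-- Two vertices `α`, `β` of different parities: there is a choice of crossing vertices `u`, `v`
that avoids `w`, `y` and `w'`, `x`, and such that the differences of the pairs `{w, w'}`, `{u, x}`,
`{v, y}` are not all equal, unless there is no edge among the pairs `q`, `{w, w'}` and no equality
among `α = x` and `β = y`. -/
def checkDiff (q : Pair) (α β : ℕ) : Bool := rowsTo q α β fun R =>
  filterTo (fun ρ => Nat.ble 4 (len ρ.2)) R (fun R₄ =>
    allL (fun w => allL (fun y => sel (Nat.beq w y) true (sel (anyL (fun ρ => neBoth ρ.1 w y) R₄) true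
      (allL (fun w' => allL (fun x => sel (Nat.beq w' x) true
        (sel (sel (isEdge q) true (sel (adjB w w') true (sel (Nat.beq α x) true (Nat.beq β y))))
        (anyL (fun ρ => sel (neBoth ρ.1 w y) (anyL (fun v => sel (neBoth v w' x)
          (notBoth (Nat.xor ρ.1 x) (Nat.xor v y) (Nat.xor w w') (Nat.xor w w')) false) ρ.2) false)
        R) true)) (opposite β)) (opposite β)))) (opposite α)) (opposite α)) []

/-- The ends `α`, `β` of two crossing pairs in the lower half, which contains the pairs `{0, 1}` and
`q`, pass the test for equal or for different parities. -/
def checkTwoOne (q : Pair) (α β : ℕ) : Bool :=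
  sel (sel (apart (0, 1) q) (sel (avoids [0, 1, q.1, q.2] α) (avoids [0, 1, q.1, q.2, α] β) false)
    false) (sel (Nat.beq (par α) (par β)) (checkSame q α β) (checkDiff q α β)) true

/-- An order of the vertices of `Q 4`, the even ones first. -/
def rank (v : ℕ) : ℕ := Nat.add (Nat.mul 16 (par v)) v

theorem checkTwoOne_eq {k : ℕ} (hk : k < 9) {α β : ℕ} (hα : α < 16) (hβ : β < 16)
    (hαβ : rank α < rank β) : checkTwoOne (pairOf (byte repTab k)) α β = true := by
  have h : allN 9 (fun k => forceP (pairOf (byte repTab k)) fun q => allN 16 fun α => allN 16 fun β =>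
      sel (Nat.blt (rank α) (rank β)) (checkTwoOne q α β) true) = true := by
    decide +kernel
  have := allN_iff.1 h k hk
  rw [forceP_eq] at this
  have := allN_iff.1 (allN_iff.1 this α hα) β hβ
  rwa [show Nat.blt (rank α) (rank β) = true by rw [Nat.blt_eq]; exact hαβ] at this

theorem exists_mem_not_mem {l : List ℕ} (hl : l.Nodup) (E : List ℕ)
    (h : E.length + 1 ≤ len l) : ∃ v ∈ l, v ∉ E := by
  have hlen : len l = l.length := by
    clear hl h
    induction l with
    | nil => rfl
    | cons a l ih => exact congrArg (· + 1) ih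
  by_contra! hc
  have := (hl.subperm hc).length_le
  omega

/-- Crossing vertices for two pairs whose ends in the lower half have the same parity. -/
theorem exists_crossing_same {q : Pair} {α β w : ℕ}
    (h : checkSame q α β = true) (hw : w ∈ opposite α)
    (henc : enclosed [0, 1, q.1, q.2, α, β] w = false) (x y : ℕ) :
    ∃ u ∈ opposite α, ∃ v ∈ opposite β, look q (α, u) (β, v) = true ∧ u ≠ v ∧ u ≠ w ∧ v ≠ w ∧
      ¬ (u = x ∧ v = y) := by
  obtain ⟨R, hR, hk⟩ := rowsTo_spec q α β
  rw [checkSame, hk] at h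
  have := allL_iff.1 h w hw
  rw [henc, sel_true_left, or_iff_left (by simp), anyL_iff] at this
  obtain ⟨ρ, hρ, h3⟩ := this
  obtain ⟨r1, r2, r3⟩ := hR ρ hρ
  have hρw : ρ.1 ≠ w := fun e => by
    rw [e, Nat.beq_refl] at h3
    exact absurd h3 (by simp)
  have h3' : 3 ≤ len ρ.2 := by
    cases hb : Nat.beq ρ.1 w
    · rw [hb, sel_false, Nat.ble_eq] at h3
      exact h3
    · exact absurd (Nat.eq_of_beq_eq_true hb) hρw
  obtain ⟨v, hv, hvE⟩ := exists_mem_not_mem r2 [w, y] h3'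
  simp only [List.mem_cons, List.not_mem_nil, or_false, not_or] at hvE
  exact ⟨ρ.1, r1, v, (r3 v hv).1, (r3 v hv).2.2, (r3 v hv).2.1, hρw, hvE.1, fun e => hvE.2 e.2⟩

/-- Crossing vertices for two pairs whose ends in the lower half have different parities. -/
theorem exists_crossing_diff {q : Pair} {α β w w' x y : ℕ}
    (h : checkDiff q α β = true) (hw : w ∈ opposite α) (hy : y ∈ opposite α) (hwy : w ≠ y)
    (hw' : w' ∈ opposite β) (hx : x ∈ opposite β) (hwx : w' ≠ x)
    (hedge : isEdge q = true ∨ adjB w w' = true ∨ α = x ∨ β = y) :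
    ∃ u ∈ opposite α, ∃ v ∈ opposite β, look q (α, u) (β, v) = true ∧ u ≠ v ∧ u ≠ w ∧ u ≠ y ∧ v ≠ w' ∧
      v ≠ x ∧ ¬ (u ^^^ x = w ^^^ w' ∧ v ^^^ y = w ^^^ w') := by
  obtain ⟨R, hR, hk⟩ := rowsTo_spec q α β
  rw [checkDiff, hk, filterTo_eq, List.append_nil] at h
  have := allL_iff.1 (allL_iff.1 h w hw) y hy
  rw [show Nat.beq w y = false from Bool.eq_false_iff.2 fun e => hwy (Nat.eq_of_beq_eq_true e),
    sel_false, sel_true_left, anyL_iff] at this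
  rcases this with ⟨ρ, hρ, hn⟩ | this
  · rw [List.mem_reverse, List.mem_filter, Nat.ble_eq] at hρ
    rw [neBoth_iff] at hn
    obtain ⟨r1, r2, r3⟩ := hR ρ hρ.1
    obtain ⟨v, hv, hvE⟩ := exists_mem_not_mem r2 [w', x, y ^^^ (w ^^^ w')] hρ.2
    simp only [List.mem_cons, List.not_mem_nil, or_false, not_or] at hvE
    exact ⟨ρ.1, r1, v, (r3 v hv).1, (r3 v hv).2.2, (r3 v hv).2.1, hn.1, hn.2, hvE.1, hvE.2.1,
      fun e => hvE.2.2 (xor_eq_iff.1 e.2)⟩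
  · have := allL_iff.1 (allL_iff.1 this w' hw') x hx
    rw [show Nat.beq w' x = false from Bool.eq_false_iff.2 fun e => hwx (Nat.eq_of_beq_eq_true e),
      sel_false, show sel (isEdge q) true (sel (adjB w w') true (sel (Nat.beq α x) true
        (Nat.beq β y))) = true by
          rw [sel_true_left, sel_true_left, sel_true_left, Nat.beq_eq, Nat.beq_eq]
          exact hedge, sel_true, anyL_iff] at this
    obtain ⟨ρ, hρ, this⟩ := this
    rw [sel_false_right, neBoth_iff, anyL_iff] at this
    obtain ⟨hn, v, hv, this⟩ := this
    rw [sel_false_right, neBoth_iff, notBoth_iff] at this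
    obtain ⟨r1, r2, r3⟩ := hR ρ hρ
    exact ⟨ρ.1, r1, v, (r3 v hv).1, (r3 v hv).2.2, (r3 v hv).2.1, hn.1, hn.2, this.1.1, this.1.2, this.2⟩

theorem xor_farEnd {α β : ℕ} (hpar : par α ≠ par β) {p : Pair} (hp : Odd4 p) :
    farEnd α p ^^^ farEnd β p = p.1 ^^^ p.2 := by
  have := par_lt α
  have := par_lt β
  have := par_lt p.1
  have := par_lt p.2
  have := hp.2.2
  unfold farEnd
  split <;> split
  · omega
  · exact Nat.xor_comm _ _
  · rfl
  · omega

/-- The crossing vertices are chosen such that the four pairs in the lower half are found in the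
table and the three pairs in the upper half have differences that are not all equal. There are
enough choices because no vertex is enclosed, or because of the second edge. -/
theorem linked_join_two_one {p q p' c d : Pair} (h : Halves [p, q] [p'] [c, d])
    (hp : isEdge p = true)
    (hedge : isEdge q = true ∨ isEdge p' = true ∨ c.1 = c.2 ∨ d.1 = d.2) :
    Linked 5 (join [p, q] [p'] [c, d]) := by
  have oq := h.odd₀ q (by simp)
  have op' := h.odd₁ p' (by simp)
  refine h.linked_of_edge hp fun g hg k hk hqk h => ?_
  replace hedge : isEdge (pairOf (byte repTab k)) = true ∨ isEdge (mapPair g p') = true ∨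
      (mapPair g c).1 = (mapPair g c).2 ∨ (mapPair g d).1 = (mapPair g d).2 := by
    rcases hedge with e | e | e | e
    · exact Or.inl (by rw [hqk.isEdge]; exact hg.isEdge oq e)
    · exact Or.inr (Or.inl (hg.isEdge op' e))
    · exact Or.inr (Or.inr (Or.inl (congrArg g e)))
    · exact Or.inr (Or.inr (Or.inr (congrArg g e)))
  clear oq op' hqk
  simp only [List.map_cons, List.map_nil] at h ⊢
  generalize mapPair g p' = p' at *
  generalize mapPair g c = c at *
  generalize mapPair g d = d at *
  have hck := fun α β => checkTwoOne_eq hk (α := α) (β := β)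
  generalize pairOf (byte repTab k) = q at *
  clear hk
  wlog hlt : rank c.1 < rank d.1 generalizing c d
  · refine linked_join_congr (.refl _) (.refl _) (.swap _ _ _)
      (this (c := d) (d := c) (or_congr_right (or_congr_right or_comm) |>.1 hedge)
        (h.congr (.refl _) (.refl _) (.swap _ _ _))
        (lt_of_le_of_ne (not_lt.1 hlt) fun e => ?_))
    have c1 := (h.even c (by simp)).1
    have d1 := (h.even d (by simp)).1
    have e' : 16 * par d.1 + d.1 = 16 * par c.1 + c.1 := e
    have hcd : d.1 = c.1 := by
      have := par_lt c.1
      have := par_lt d.1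
      omega
    have := h.nodup.1
    simp [vertsOf, hcd] at this
  have oq := h.odd₀ q (by simp)
  have op' := h.odd₁ p' (by simp)
  obtain ⟨c1, c2, c3⟩ := h.even c (by simp)
  obtain ⟨d1, d2, d3⟩ := h.even d (by simp)
  replace hck := hck c.1 d.1 c1 d1 hlt
  have a₀ := h.apart₀
  simp only [List.pairwise_cons, List.mem_cons, List.not_mem_nil, or_false, forall_eq] at a₀
  have henc := h.not_enclosed (mem_opposite.1 (farEnd_mem_opposite op' c.1)).1 (by
    rcases farEnd_eq c.1 p' with e | e <;> rw [e] <;> simp [vertsOf])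
  simp only [vertsOf, List.flatMap_cons, List.flatMap_nil, List.map_nil, List.map_cons,
    List.append_nil, List.cons_append, List.nil_append] at henc
  have hcd₀ : d.1 ≠ c.1 := fun e => by
    have := h.nodup.1
    simp [vertsOf, e] at this
  have hcd₁ : c.2 ≠ d.2 := fun e => by
    have := h.nodup.2
    simp [vertsOf, e] at this
  have nc := h.ne₁ (c := c) (p := p') (by simp) (by simp)
  have nd := h.ne₁ (c := d) (p := p') (by simp) (by simp)
  have g1 : apart (0, 1) q = true := apart_iff.2 a₀.1
  have g2 : avoids [0, 1, q.1, q.2] c.1 = true := by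
    have g1 := h.ne₀ (c := c) (p := (0, 1)) (by simp) (by simp)
    have g2 := h.ne₀ (c := c) (p := q) (by simp) (by simp)
    rw [avoids_iff]
    simp only [List.mem_cons, List.not_mem_nil, or_false, not_or]
    exact ⟨g1.1, g1.2, g2.1, g2.2⟩
  have g3 : avoids [0, 1, q.1, q.2, c.1] d.1 = true := by
    have g1 := h.ne₀ (c := d) (p := (0, 1)) (by simp) (by simp)
    have g2 := h.ne₀ (c := d) (p := q) (by simp) (by simp)
    rw [avoids_iff]
    simp only [List.mem_cons, List.not_mem_nil, or_false, not_or]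
    exact ⟨g1.1, g1.2, g2.1, g2.2, hcd₀⟩
  rw [checkTwoOne, g1, g2, g3, sel_true, sel_true, sel_true] at hck
  suffices H : ∃ u ∈ opposite c.1, ∃ v ∈ opposite d.1, look q (c.1, u) (d.1, v) = true ∧
      u ≠ v ∧ u ≠ farEnd c.1 p' ∧ v ≠ farEnd d.1 p' ∧ u ≠ d.2 ∧ v ≠ c.2 ∧
      ¬ (u ^^^ c.2 = p'.1 ^^^ p'.2 ∧ v ^^^ d.2 = p'.1 ^^^ p'.2) by
    obtain ⟨u, hu, v, hv, hl, huv, hup, hvp, hud, hvc, hx⟩ := H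
    have e1 := ne_of_ne_farEnd hu op' hup
    have e2 := ne_of_ne_farEnd hv op' hvp
    obtain ⟨u1, u2⟩ := mem_opposite.1 hu
    obtain ⟨v1, v2⟩ := mem_opposite.1 hv
    have k₀ := linked_of_look oq (r := (c.1, u)) (s := (d.1, v)) ⟨c1, u1, u2.symm⟩
      ⟨d1, v1, v2.symm⟩ hl
    have k₁ : Linked 4 [p', (u, c.2), (v, d.2)] := linked_three op' ⟨u1, c2, c3 ▸ u2⟩
      ⟨v1, d2, d3 ▸ v2⟩ (Apart.of_ne e1 nc).symm (Apart.of_ne e2 nd).symm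
      ⟨huv, hud, hvc.symm, hcd₁⟩
      (by
        by_contra! hc
        exact hx ⟨hc.1.symm, hc.2.symm⟩)
    refine Linked.glue [(c.1, u, c.2), (d.1, v, d.2)] (k₀.perm ?_) (k₁.perm ?_)
    · exact List.perm_append_comm (l₁ := [(0, 1), q]) (l₂ := [(c.1, u), (d.1, v)])
    · exact List.perm_append_comm (l₁ := [p']) (l₂ := [(u, c.2), (v, d.2)])
  have w1 := farEnd_mem_opposite op' c.1
  have w2 := farEnd_mem_opposite op' d.1
  by_cases hpar : par c.1 = par d.1
  · have hfar : farEnd d.1 p' = farEnd c.1 p' := by unfold farEnd; rw [hpar]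
    rw [show Nat.beq (par c.1) (par d.1) = true by rw [Nat.beq_eq]; exact hpar, sel_true] at hck
    obtain ⟨u, hu, v, hv, h1, h2, h3, h4, h5⟩ := exists_crossing_same hck w1 henc
      (c.2 ^^^ (p'.1 ^^^ p'.2)) (d.2 ^^^ (p'.1 ^^^ p'.2))
    refine ⟨u, hu, v, hv, h1, h2, h3, hfar ▸ h4, fun e => ?_, fun e => ?_, fun e =>
      h5 ⟨xor_eq_iff.1 e.1, xor_eq_iff.1 e.2⟩⟩
    · exact (mem_opposite.1 hu).2 (by rw [e, ← d3, hpar])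
    · exact (mem_opposite.1 hv).2 (by rw [e, ← c3, hpar])
  · rw [show Nat.beq (par c.1) (par d.1) = false from Bool.eq_false_iff.2 fun e =>
      hpar (Nat.eq_of_beq_eq_true e), sel_false] at hck
    have hx : c.2 ∈ opposite d.1 := mem_opposite.2 ⟨c2, by rw [← c3]; exact hpar⟩
    have hy : d.2 ∈ opposite c.1 := mem_opposite.2 ⟨d2, by rw [← d3]; exact Ne.symm hpar⟩
    have hne : ∀ v w, w ∈ [c.2, d.2] → farEnd v p' ≠ w := by
      intro v w hw
      simp only [List.mem_cons, List.not_mem_nil, or_false] at hw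
      rcases farEnd_eq v p' with e | e <;> rw [e] <;> rcases hw with rfl | rfl
      exacts [nc.1.symm, nd.1.symm, nc.2.symm, nd.2.symm]
    have hxor := xor_farEnd hpar op'
    obtain ⟨u, hu, v, hv, h1, h2, h3, h4, h5, h6, h7⟩ := exists_crossing_diff hck w1 hy
      (hne _ _ (by simp)) w2 hx (hne _ _ (by simp)) (by
        rcases hedge with e | e | e | e
        · exact Or.inl e
        · refine Or.inr (Or.inl ?_)
          unfold adjB
          rw [show Nat.xor (farEnd c.1 p') (farEnd d.1 p') = Nat.xor p'.1 p'.2 from hxor]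
          exact e
        · exact Or.inr (Or.inr (Or.inl e))
        · exact Or.inr (Or.inr (Or.inr e)))
    rw [hxor] at h7
    exact ⟨u, hu, v, hv, h1, h2, h3, h5, h4, h6, h7⟩

/-! ### Profiles of five pairs along a coordinate -/

/-- The part of an odd pair in the profile along the top coordinate. The digits of a profile in base
`8` are the number of pairs in the lower half, the number of pairs in the upper half, the number of
edges in the lower half, the number of edges in the upper half, and the number of edges. -/
def topProf (p : Pair) : ℕ :=
  sel (Nat.ble 16 p.1)
    (sel (Nat.ble 16 p.2) (sel (isEdge p) 4616 8) (sel (isEdge p) 4096 0))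
    (sel (Nat.ble 16 p.2) (sel (isEdge p) 4096 0) (sel (isEdge p) 4161 1))

/-- The part of a pair in the profile along the coordinate `d`. -/
def prof (d : ℕ) (p : Pair) : ℕ :=
  sel (hasBit p.1 d)
    (sel (hasBit p.2 d) (sel (isEdge p) 4616 8) (sel (isEdge p) 4096 0))
    (sel (hasBit p.2 d) (sel (isEdge p) 4096 0) (sel (isEdge p) 4161 1))

theorem topProf_appP {d : ℕ} (hd : d < 5) {p : Pair} (h₁ : p.1 < 32) (h₂ : p.2 < 32) :
    topProf (appP (swapTab d) p) = prof d p := by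
  have h : allN 5 (fun d => allN 32 fun x => allN 32 fun y =>
      Nat.beq (topProf (app (swapTab d) x, app (swapTab d) y)) (prof d (x, y))) = true := by
    decide +kernel
  exact Nat.eq_of_beq_eq_true (allN_iff.1 (allN_iff.1 (allN_iff.1 h d hd) _ h₁) _ h₂)

theorem topProf_eq_of_sameEnds {p q : Pair} (h : SameEnds p q) : topProf p = topProf q := by
  rcases h with rfl | rfl
  · rfl
  · have he : isEdge (p.2, p.1) = isEdge p := SameEnds.isEdge (Or.inr rfl)
    unfold topProf
    rw [he]
    cases Nat.ble 16 p.1 <;> cases Nat.ble 16 p.2 <;> rfl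

theorem SameSys.sum_topProf {L M : List Pair} (h : SameSys L M) :
    (L.map topProf).sum = (M.map topProf).sum := by
  obtain ⟨N, h1, h2⟩ := h.exists_perm
  rw [(h1.map topProf).sum_eq]
  clear h1 h
  induction h2 with
  | nil => rfl
  | cons hab _ ih => rw [List.map_cons, List.map_cons, List.sum_cons, List.sum_cons, ih,
      topProf_eq_of_sameEnds hab]

theorem sum_topProf_join {L₀ L₁ C : List Pair} (lt₀ : ∀ p ∈ L₀, p.1 < 16 ∧ p.2 < 16)
    (lt₁ : ∀ p ∈ L₁, p.1 < 16 ∧ p.2 < 16) (ltC : ∀ p ∈ C, p.1 < 16 ∧ p.2 < 16) :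
    ((join L₀ L₁ C).map topProf).sum = L₀.length + 8 * L₁.length + 64 * L₀.countP isEdge +
      512 * L₁.countP isEdge + 4096 * (L₀.countP isEdge + L₁.countP isEdge +
        C.countP fun c => Nat.beq c.1 c.2) := by
  have hcheck : allN 16 (fun x => allN 16 fun y => sel (Nat.beq (topProf (x, y))
      (sel (isEdge (x, y)) 4161 1)) (sel (Nat.beq (topProf (Nat.add 16 x, Nat.add 16 y))
        (sel (isEdge (x, y)) 4616 8)) (Nat.beq (topProf (x, Nat.add 16 y))
          (sel (Nat.beq x y) 4096 0)) false) false) = true := by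
    decide +kernel
  have key : ∀ p : Pair, p.1 < 16 ∧ p.2 < 16 →
      topProf p = (if isEdge p then 4161 else 1) ∧
      topProf (2 ^ 4 + p.1, 2 ^ 4 + p.2) = (if isEdge p then 4616 else 8) ∧
      topProf (p.1, 2 ^ 4 + p.2) = (if Nat.beq p.1 p.2 then 4096 else 0) := by
    intro p hp
    have := allN_iff.1 (allN_iff.1 hcheck _ hp.1) _ hp.2
    rw [sel_false_right, sel_false_right, Nat.beq_eq, Nat.beq_eq, Nat.beq_eq] at this
    obtain ⟨h1, h2, h3⟩ := this
    refine ⟨h1.trans ?_, h2.trans ?_, h3.trans ?_⟩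
    · change sel (isEdge p) 4161 1 = _
      cases isEdge p <;> rfl
    · change sel (isEdge p) 4616 8 = _
      cases isEdge p <;> rfl
    · cases Nat.beq p.1 p.2 <;> rfl
  have hC : ((C.map fun p => (p.1, 2 ^ 4 + p.2)).map topProf).sum =
      4096 * C.countP fun c => Nat.beq c.1 c.2 := by
    clear lt₀ lt₁
    induction C with
    | nil => rfl
    | cons c C ih =>
      rw [List.map_cons, List.map_cons, List.sum_cons, ih fun p hp => ltC p (by simp [hp]),
        (key c (ltC c (by simp))).2.2, List.countP_cons]
      split <;> omega
  have h₀ : (L₀.map topProf).sum = L₀.length + 4160 * L₀.countP isEdge := by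
    clear lt₁ ltC hC
    induction L₀ with
    | nil => rfl
    | cons c C ih =>
      rw [List.map_cons, List.sum_cons, ih fun p hp => lt₀ p (by simp [hp]),
        (key c (lt₀ c (by simp))).1, List.countP_cons, List.length_cons]
      split <;> omega
  have h₁ : ((L₁.map fun p => (2 ^ 4 + p.1, 2 ^ 4 + p.2)).map topProf).sum =
      8 * L₁.length + 4608 * L₁.countP isEdge := by
    clear lt₀ ltC hC h₀
    induction L₁ with
    | nil => rfl
    | cons c C ih =>
      rw [List.map_cons, List.map_cons, List.sum_cons, ih fun p hp => lt₁ p (by simp [hp]),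
        (key c (lt₁ c (by simp))).2.1, List.countP_cons, List.length_cons]
      split <;> omega
  rw [join, List.map_append, List.map_append, List.sum_append, List.sum_append, hC, h₀, h₁]
  omega

theorem exists_perm_edge {L : List Pair} (h : 0 < L.countP isEdge) :
    ∃ p M, L.Perm (p :: M) ∧ isEdge p = true := by
  obtain ⟨p, hp, he⟩ := List.countP_pos_iff.1 h
  exact ⟨p, L.erase p, List.perm_cons_erase hp, he⟩

/-- Five pairs, at least two of them edges, are always joined by a path system if `a` of them are in
the lower half, `b` of them in the upper half, and `ea` of those in the lower half are edges. -/
def GoodProf (a b ea : ℕ) : Prop :=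
  a = 3 ∧ b = 2 ∧ 1 ≤ ea ∨ a = 2 ∧ b = 2 ∧ 1 ≤ ea ∨ a = 2 ∧ b = 1 ∧ 1 ≤ ea ∨ a = 3 ∧ b = 1 ∧ 2 ≤ ea

instance (a b ea : ℕ) : Decidable (GoodProf a b ea) := by
  unfold GoodProf
  infer_instance

theorem Halves.linked_of_goodProf {L₀ L₁ C : List Pair} (h : Halves L₀ L₁ C)
    (hlen : L₀.length + L₁.length + C.length = 5)
    (hedges : 2 ≤ L₀.countP isEdge + L₁.countP isEdge + C.countP fun c => Nat.beq c.1 c.2)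
    (hg : GoodProf L₀.length L₁.length (L₀.countP isEdge)) :
    Linked 5 (join L₀ L₁ C) := by
  have hpos : 0 < L₀.countP isEdge := by
    rcases hg with hg | hg | hg | hg <;> omega
  obtain ⟨p, M, hM, hp⟩ := exists_perm_edge hpos
  rw [hM.length_eq] at hlen hg
  rw [hM.countP_eq] at hg hedges
  rw [List.countP_cons, if_pos hp] at hg hedges
  refine linked_join_congr (.of_perm hM) (.refl _) (.refl _) ?_
  replace h := h.congr (.of_perm hM) (.refl _) (.refl _)
  clear hM hpos
  simp only [List.length_cons] at hlen hg
  rcases hg with ⟨h1, h2, h3⟩ | ⟨h1, h2, h3⟩ | ⟨h1, h2, h3⟩ | ⟨h1, h2, h3⟩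
  · obtain ⟨q, r, rfl⟩ := List.length_eq_two.1 (show M.length = 2 by omega)
    obtain ⟨p', q', rfl⟩ := List.length_eq_two.1 h2
    obtain rfl := List.length_eq_zero_iff.1 (show C.length = 0 by omega)
    exact linked_join_three_two h hp
  · obtain ⟨q, rfl⟩ := List.length_eq_one_iff.1 (show M.length = 1 by omega)
    obtain ⟨p', q', rfl⟩ := List.length_eq_two.1 h2
    obtain ⟨c, rfl⟩ := List.length_eq_one_iff.1 (show C.length = 1 by omega)
    exact linked_join_two_two h hp
  · obtain ⟨q, rfl⟩ := List.length_eq_one_iff.1 (show M.length = 1 by omega)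
    obtain ⟨p', rfl⟩ := List.length_eq_one_iff.1 h2
    obtain ⟨c, d, rfl⟩ := List.length_eq_two.1 (show C.length = 2 by omega)
    refine linked_join_two_one h hp ?_
    by_contra! hc
    obtain ⟨k1, k2, k3, k4⟩ := hc
    have k3' : Nat.beq c.1 c.2 = false := Bool.eq_false_iff.2 fun e => k3 (Nat.eq_of_beq_eq_true e)
    have k4' : Nat.beq d.1 d.2 = false := Bool.eq_false_iff.2 fun e => k4 (Nat.eq_of_beq_eq_true e)
    simp [k1, k2, k3', k4'] at hedges
  · obtain ⟨q, N, hN, hq⟩ := exists_perm_edge (show 0 < M.countP isEdge by omega)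
    have := hN.length_eq
    rw [List.length_cons] at this
    obtain ⟨r, rfl⟩ := List.length_eq_one_iff.1 (show N.length = 1 by omega)
    obtain ⟨p', rfl⟩ := List.length_eq_one_iff.1 h2
    obtain ⟨c, rfl⟩ := List.length_eq_one_iff.1 (show C.length = 1 by omega)
    have hs : SameSys (p :: M) [p, q, r] := .of_perm (hN.cons p)
    exact linked_join_congr hs (.refl _) (.refl _)
      (linked_join_three_one (h.congr hs (.refl _) (.refl _)) hp hq)

/-- The binary digit `a + 8 * b + 64 * ea + 512 * eb` tells whether `GoodProf a b ea` or
`GoodProf b a eb`. -/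
def safeTab : ℕ := 0x60e0c0000000000060e0c0000000000060e0c0000000000060e0c0000000000060e0c0000000000060e0c0000000000060e0400000000000606000000000000060e0c0000000000060e0c0000000000060e0c0000000000060e0c0000000000060e0c0000000000060e0c0000000000060e0400000000000606000000000000060e0c0000000000060e0c0000000000060e0c0000000000060e0c0000000000060e0c0000000000060e0c0000000000060e0400000000000606000000000000060e0c0000000000060e0c0000000000060e0c0000000000060e0c0000000000060e0c0000000000060e0c0000000000060e0400000000000606000000000000060e0c0000000000060e0c0000000000060e0c0000000000060e0c0000000000060e0c0000000000060e0c0000000000060e0400000000000606000000000000060e0c0000000000060e0c0000000000060e0c0000000000060e0c0000000000060e0c0000000000060e0c0000000000060e0400000000000606000000000000040e0c0000000000040e0c0000000000040e0c0000000000040e0c0000000000040e0c0000000000040e0c0000000000040e0400000000000406000000000000000c0c0000000000000c0c0000000000000c0c0000000000000c0c0000000000000c0c0000000000000c0c0000000000000c04000000000000000000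

theorem safeTab_spec {a b ea eb : ℕ} (ha : a < 8) (hb : b < 8) (hea : ea < 8) (heb : eb < 8)
    (h : hasBit safeTab (a + 8 * b + 64 * ea + 512 * eb) = true) :
    GoodProf a b ea ∨ GoodProf b a eb := by
  have hcheck : allN 8 (fun a => allN 8 fun b => allN 8 fun ea => allN 8 fun eb =>
      sel (hasBit safeTab (Nat.add (Nat.add (Nat.add a (Nat.mul 8 b)) (Nat.mul 64 ea))
        (Nat.mul 512 eb))) (decide (GoodProf a b ea ∨ GoodProf b a eb)) true) = true := by
    decide +kernel
  have := allN_iff.1 (allN_iff.1 (allN_iff.1 (allN_iff.1 hcheck a ha) b hb) ea hea) eb heb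
  rw [show hasBit safeTab (Nat.add (Nat.add (Nat.add a (Nat.mul 8 b)) (Nat.mul 64 ea))
    (Nat.mul 512 eb)) = true from h, sel_true] at this
  exact of_decide_eq_true this

theorem sum_prof (d : ℕ) (L : List Pair) : ∃ r ≤ 520 * L.length,
    (L.map (prof d)).sum = r + 4096 * L.countP isEdge := by
  induction L with
  | nil => exact ⟨0, by simp, by simp⟩
  | cons p L ih =>
    obtain ⟨r, h1, h2⟩ := ih
    have : ∃ s ≤ 520, prof d p = s + if isEdge p then 4096 else 0 := by
      unfold prof
      cases hasBit p.1 d <;> cases hasBit p.2 d <;> cases isEdge p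
      · exact ⟨1, by norm_num, rfl⟩
      · exact ⟨65, by norm_num, rfl⟩
      · exact ⟨0, by norm_num, rfl⟩
      · exact ⟨0, by norm_num, rfl⟩
      · exact ⟨0, by norm_num, rfl⟩
      · exact ⟨0, by norm_num, rfl⟩
      · exact ⟨8, by norm_num, rfl⟩
      · exact ⟨520, by norm_num, rfl⟩
    obtain ⟨s, h3, h4⟩ := this
    refine ⟨s + r, by rw [List.length_cons]; omega, ?_⟩
    rw [List.map_cons, List.sum_cons, h2, h4, List.countP_cons]
    split <;> omega

/-- Five pairs, at least two of them edges, are joined if the numbers of pairs and of edges in the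
two halves along some coordinate suit one of the gluing lemmas. The number of all edges in the
profile, which is its highest digit, is ignored. -/
theorem linked_of_safeTab {d : ℕ} (hd : d < 5) {L : List Pair} (hL : Valid 5 L) (hn : NoEnc 5 L)
    (hlen : L.length = 5) (hedges : 2 ≤ L.countP isEdge)
    (h : hasBit safeTab (Nat.land (L.map (prof d)).sum 4095) = true) : Linked 5 L := by
  have haut := swapTab_spec hd
  obtain ⟨L₀, L₁, C, -, hs, -⟩ := (IsSplit.nil (swapTab d)).split L
  rw [List.append_nil] at hs
  have hh : Halves L₀ L₁ C := ⟨hs.lt₀, hs.lt₁, hs.ltC, hs.same.symm.valid (hL.map haut),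
    hs.same.symm.noEnc (hn.map hL haut)⟩
  have hlt : ∀ p ∈ L, p.1 < 32 ∧ p.2 < 32 := fun p hp => ⟨(hL.1 p hp).1, (hL.1 p hp).2.1⟩
  have hsum : (L.map (prof d)).sum = ((join L₀ L₁ C).map topProf).sum := by
    rw [hs.same.sum_topProf, List.map_map]
    congr 1
    exact List.map_congr_left fun p hp => (topProf_appP hd (hlt p hp).1 (hlt p hp).2).symm
  have hjl : L₀.length + L₁.length + C.length = 5 := by
    have := List.Perm.length_eq hs.same
    simp only [join, List.length_map, List.length_append] at this
    omega
  obtain ⟨r, hr, hrs⟩ := sum_prof d L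
  have hj := sum_topProf_join hs.lt₀ hs.lt₁ hs.ltC
  have l₀ := List.countP_le_length (p := isEdge) (l := L₀)
  have l₁ := List.countP_le_length (p := isEdge) (l := L₁)
  rw [hsum, hj] at hrs
  rw [hsum, hj, show ∀ n, Nat.land n 4095 = n % 4096 from fun n =>
    Nat.and_two_pow_sub_one_eq_mod _ 12, Nat.add_mul_mod_self_left, Nat.mod_eq_of_lt (by omega)] at h
  refine Linked.of_map_same haut hL hs.same.symm ?_
  rcases safeTab_spec (by omega) (by omega) (by omega) (by omega) h with hg | hg
  · exact hh.linked_of_goodProf hjl (by omega) hg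
  · refine hh.linked_of_swap (hh.swap.linked_of_goodProf (by simp; omega) ?_ hg)
    rw [List.countP_map, List.countP_congr (l := C) (q := fun c : Pair => Nat.beq c.1 c.2)
      fun c _ => ?_]
    · omega
    · simp only [Function.comp, Prod.fst_swap, Prod.snd_swap, Nat.beq_eq]
      exact eq_comm

/-! ### Sets of codes of pairs

A set of codes below `256` is represented by the binary digits of a numeral, so that a whole row
of the search is handled by a few operations. -/

/-- The code of an odd pair in `Q 5`: the upper digits of the even and of the odd vertex. -/
def code5 (p : Pair) : ℕ :=
  sel (Nat.beq (par p.1) 0)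
    (Nat.add (Nat.shiftRight p.1 1) (Nat.shiftLeft (Nat.shiftRight p.2 1) 4))
    (Nat.add (Nat.shiftRight p.2 1) (Nat.shiftLeft (Nat.shiftRight p.1 1) 4))

/-- The odd pair in `Q 5` with a given code, the even vertex first. -/
def pair5 (c : ℕ) : Pair := (evenV (Nat.land c 15), oddV (Nat.shiftRight c 4))

/-- An odd pair of vertices of `Q 5`. -/
def Odd5 (p : Pair) : Prop := p.1 < 32 ∧ p.2 < 32 ∧ par p.1 ≠ par p.2

theorem code5_spec {p : Pair} (hp : Odd5 p) : code5 p < 256 ∧ SameEnds p (pair5 (code5 p)) ∧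
    code5 (p.2, p.1) = code5 p := by
  have h : allN 32 (fun x => allN 32 fun y => sel (Nat.beq (par x) (par y)) true
      (sel (Nat.blt (code5 (x, y)) 256) (sel (Nat.beq (code5 (y, x)) (code5 (x, y)))
        ((fun q : Pair => sel (sel (Nat.beq q.1 x) (Nat.beq q.2 y) false) true
          (sel (Nat.beq q.1 y) (Nat.beq q.2 x) false)) (pair5 (code5 (x, y)))) false) false)) =
      true := by
    decide +kernel
  obtain ⟨x, y⟩ := p
  obtain ⟨h1, h2, h3⟩ := hp
  have := allN_iff.1 (allN_iff.1 h x h1) y h2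
  have h3' : Nat.beq (par x) (par y) = false := by
    rw [← Bool.not_eq_true, Nat.beq_eq]; exact h3
  rw [h3', sel_false, sel_false_right, sel_false_right, Nat.blt_eq, sel_true_left, sel_false_right,
    sel_false_right] at this
  simp only [Nat.beq_eq] at this
  refine ⟨this.1, ?_, this.2.1⟩
  rcases this.2.2 with ⟨h4, h5⟩ | ⟨h4, h5⟩
  · exact Or.inl (Prod.ext h4 h5)
  · exact Or.inr (Prod.ext h4 h5)

theorem code5_congr {p q : Pair} (hp : Odd5 p) (h : SameEnds p q) : code5 q = code5 p := by
  rcases h with rfl | rfl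
  · rfl
  · exact (code5_spec hp).2.2

theorem Odd5.map {g : ℕ → ℕ} (hg : IsAut 5 g) {p : Pair} (hp : Odd5 p) : Odd5 (mapPair g p) :=
  ⟨hg.lt _ hp.1, hg.lt _ hp.2.1, hg.par _ hp.1 _ hp.2.1 hp.2.2⟩

theorem SameEnds.mapPair {p q : Pair} (h : SameEnds p q) (g : ℕ → ℕ) :
    SameEnds (mapPair g p) (mapPair g q) := by
  rcases h with rfl | rfl
  · exact Or.inl rfl
  · exact Or.inr rfl

/-- The set of the numbers below `n` that satisfy `f`, as a binary numeral. -/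
def maskOf (f : ℕ → Bool) (n : ℕ) : ℕ :=
  Nat.rec 0 (fun k ih => force ih fun m => sel (f k) (Nat.lor m (single k)) m) n

theorem hasBit_maskOf {f : ℕ → Bool} {n i : ℕ} :
    hasBit (maskOf f n) i = true ↔ i < n ∧ f i = true := by
  induction n with
  | zero => simp [maskOf, hasBit_eq]
  | succ n ih =>
    change hasBit (force (maskOf f n) fun m => sel (f n) (Nat.lor m (single n)) m) i = true ↔ _
    rw [force_eq]
    by_cases hin : i = n
    · subst hin
      cases h : f i
      · exact ih.trans (by simp [h])
      · rw [sel_true, hasBit_eq]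
        change Nat.testBit (maskOf f i ||| single i) i = true ↔ _
        simp [single_eq, Nat.testBit_or]
    · have hlt : i < n + 1 ↔ i < n := by omega
      rw [hlt, ← ih]
      cases f n
      · rfl
      · rw [sel_true, hasBit_eq, hasBit_eq]
        change Nat.testBit (maskOf f n ||| single n) i = true ↔ _
        rw [Nat.testBit_or, single_eq, Nat.testBit_two_pow, decide_eq_false (Ne.symm hin),
          Bool.or_false]

/-- Compute the numbers `g a`, for the entries `a` of `l`, and pass the list of the pairs `(a, g
a)`, in reverse order, to the continuation `f`. -/
def tabulate {α β : Type} (g : α → ℕ) (l : List α) (f : List (α × ℕ) → β) :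
    List (α × ℕ) → β :=
  List.rec f (fun a _ ih acc => force (g a) fun n => ih ((a, n) :: acc)) l

theorem tabulate_eq {α β : Type} (g : α → ℕ) (l : List α) (f : List (α × ℕ) → β)
    (acc : List (α × ℕ)) :
    tabulate g l f acc = f ((l.map fun a => (a, g a)).reverse ++ acc) := by
  induction l generalizing acc with
  | nil => rfl
  | cons a l ih =>
    change (force (g a) fun n => tabulate g l f ((a, n) :: acc)) = _
    rw [force_eq, ih]
    simp

/-- `leaf (b + i)` holds for every element `i` of the subset `m` of the numbers below `2 ^ k`. -/
def drain (leaf : ℕ → Bool) (k : ℕ) : ℕ → ℕ → Bool :=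
  Nat.rec (motive := fun _ => ℕ → ℕ → Bool) (fun b m => sel (Nat.beq m 0) true (leaf b))
    (fun k ih b m => sel (Nat.beq m 0) true (force (Nat.shiftLeft 1 k) fun s =>
      force (Nat.land m (Nat.sub (Nat.shiftLeft 1 s) 1)) fun lo =>
      force (Nat.shiftRight m s) fun hi => force (Nat.add b s) fun b' =>
        sel (ih b lo) (ih b' hi) false)) k

theorem drain_spec {leaf : ℕ → Bool} {k b m : ℕ} (h : drain leaf k b m = true) {i : ℕ}
    (hi : i < 2 ^ k) (hm : hasBit m i = true) : leaf (b + i) = true := by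
  rw [hasBit_eq] at hm
  induction k generalizing b m i with
  | zero =>
    obtain rfl : i = 0 := by simpa using hi
    replace h : sel (Nat.beq m 0) true (leaf b) = true := h
    rw [sel_true_left, Nat.beq_eq] at h
    rcases h with rfl | h
    · simp at hm
    · exact h
  | succ k ih =>
    replace h : sel (Nat.beq m 0) true (force (Nat.shiftLeft 1 k) fun s =>
      force (Nat.land m (Nat.sub (Nat.shiftLeft 1 s) 1)) fun lo =>
      force (Nat.shiftRight m s) fun hi => force (Nat.add b s) fun b' =>
        sel (drain leaf k b lo) (drain leaf k b' hi) false) = true := h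
    simp only [force_eq] at h
    rw [sel_true_left, Nat.beq_eq, sel_false_right] at h
    rcases h with rfl | ⟨h1, h2⟩
    · simp at hm
    rw [show Nat.shiftLeft 1 k = 2 ^ k from single_eq k] at h1 h2
    rw [show Nat.shiftLeft 1 (2 ^ k) = 2 ^ 2 ^ k from single_eq _] at h1
    rcases lt_or_ge i (2 ^ k) with hik | hik
    · refine ih h1 hik ?_
      change Nat.testBit (m &&& (2 ^ 2 ^ k - 1)) i = true
      rw [Nat.testBit_and, hm, Nat.testBit_two_pow_sub_one, decide_eq_true hik]
      rfl
    · have := ih h2 (i := i - 2 ^ k) (by rw [pow_succ] at hi; omega) (by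
        change Nat.testBit (m >>> 2 ^ k) _ = true
        rw [Nat.testBit_shiftRight, Nat.add_sub_of_le hik]
        exact hm)
      rwa [show Nat.add b (2 ^ k) + (i - 2 ^ k) = b + i by
        change b + 2 ^ k + (i - 2 ^ k) = b + i; omega] at this

/-! ### Profiles of sets of pairs -/

/-- The coordinates, and the possible profiles of a pair along a coordinate, disregarding crossing
edges. -/
def profiles : List (ℕ × ℕ) :=
  [(0, 0), (0, 1), (0, 65), (0, 8), (0, 520), (1, 0), (1, 1), (1, 65), (1, 8), (1, 520),
   (2, 0), (2, 1), (2, 65), (2, 8), (2, 520), (3, 0), (3, 1), (3, 65), (3, 8), (3, 520),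
   (4, 0), (4, 1), (4, 65), (4, 8), (4, 520)]

/-- The codes of the pairs with profile `t.2` along the coordinate `t.1`. -/
def profMask (t : ℕ × ℕ) : ℕ :=
  maskOf (fun k => Nat.beq (Nat.land (prof t.1 (pair5 k)) 4095) t.2) 256

/-- The union of the sets `g a`, for the entries `a` of `l` that satisfy `f`. -/
def unionOf {α : Type} (f : α → Bool) (g : α → ℕ) (l : List α) : ℕ :=
  List.rec 0 (fun a _ ih => force ih fun m => sel (f a) (Nat.lor m (g a)) m) l

theorem unionOf_spec {α : Type} {f : α → Bool} {g : α → ℕ} {l : List α} {k : ℕ}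
    (h : hasBit (unionOf f g l) k = true) : ∃ a ∈ l, f a = true ∧ hasBit (g a) k = true := by
  induction l with
  | nil =>
    rw [hasBit_eq] at h
    exact absurd ((Nat.zero_testBit k).symm.trans h) (by simp)
  | cons a l ih =>
    replace h : hasBit (force (unionOf f g l) fun m => sel (f a) (Nat.lor m (g a)) m) k = true := h
    rw [force_eq] at h
    have hl : hasBit (unionOf f g l) k = true → ∃ b ∈ a :: l, f b = true ∧ hasBit (g b) k = true :=
      fun h => by
        obtain ⟨b, h1, h2⟩ := ih h
        exact ⟨b, List.mem_cons_of_mem _ h1, h2⟩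
    cases h1 : f a
    · rw [h1] at h; exact hl h
    rw [h1, sel_true, hasBit_eq] at h
    change Nat.testBit (unionOf f g l ||| g a) k = true at h
    rw [Nat.testBit_or, Bool.or_eq_true] at h
    rcases h with h | h
    · exact hl (by rw [hasBit_eq]; exact h)
    · exact ⟨a, List.mem_cons_self, h1, by rw [hasBit_eq]; exact h⟩

/-- `B` lists sets `b.2` of codes of pairs, with profile `b.1.2` along the coordinate `b.1.1`. The
result is the union of those which lead to safe profiles, together with a pair with profile `t.2`
and further pairs with the sum `s` of profiles, along the coordinate `t.1`. -/
def safeMask (B : List ((ℕ × ℕ) × ℕ)) (s : ℕ) (t : ℕ × ℕ) : ℕ :=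
  unionOf (fun b => sel (Nat.beq b.1.1 t.1)
    (hasBit safeTab (Nat.land (Nat.add s (Nat.add t.2 b.1.2)) 4095)) false) (fun b => b.2) B

/-! ### Enclosed vertices -/

/-- The set of the vertices of the pairs in the list. -/
def vertMask (L : List Pair) : ℕ :=
  List.rec 0 (fun p _ ih => Nat.lor ih (Nat.lor (single p.1) (single p.2))) L

theorem hasBit_vertMask {L : List Pair} {v : ℕ} : hasBit (vertMask L) v = true ↔ v ∈ vertsOf L := by
  rw [hasBit_eq]
  induction L with
  | nil => simp [vertMask, vertsOf]
  | cons p L ih =>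
    change Nat.testBit (vertMask L ||| (single p.1 ||| single p.2)) v = true ↔ _
    rw [Nat.testBit_or, Nat.testBit_or, Bool.or_eq_true, Bool.or_eq_true, ih, single_eq, single_eq,
      Nat.testBit_two_pow, Nat.testBit_two_pow, decide_eq_true_iff, decide_eq_true_iff, vertsOf_cons,
      List.mem_cons, List.mem_cons]
    constructor
    · rintro (h | h | h)
      exacts [Or.inr (Or.inr h), Or.inl h.symm, Or.inr (Or.inl h.symm)]
    · rintro (h | h | h)
      exacts [Or.inr (Or.inl h.symm), Or.inr (Or.inr h.symm), Or.inl h]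

/-- If `d` is a power of two and `M` consists of the vertices of `Q 5` without the corresponding
digit, this is the set of the vertices whose neighbours in this direction belong to `m`. -/
def flipMask (m d M : ℕ) : ℕ :=
  Nat.lor (Nat.shiftLeft (Nat.land m M) d) (Nat.land (Nat.shiftRight m d) M)

/-- Some vertex of `Q 5` does not belong to the set `m`, but all its neighbours do. -/
def encloses (m : ℕ) : Bool :=
  sel (Nat.beq (Nat.land (Nat.xor m 0xffffffff) (Nat.land (flipMask m 1 0x55555555)
    (Nat.land (flipMask m 2 0x33333333) (Nat.land (flipMask m 4 0x0f0f0f0f)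
      (Nat.land (flipMask m 8 0x00ff00ff) (flipMask m 16 0x0000ffff)))))) 0) false true

theorem testBit_flipMask {m d M w : ℕ} :
    Nat.testBit (flipMask m d M) w = ((decide (d ≤ w) && (m.testBit (w - d) && M.testBit (w - d))) ||
      (m.testBit (d + w) && M.testBit w)) := by
  change Nat.testBit ((m &&& M) <<< d ||| (m >>> d &&& M)) w = _
  rw [Nat.testBit_or, Nat.testBit_shiftLeft, Nat.testBit_and, Nat.testBit_and,
    Nat.testBit_shiftRight]

theorem testBit_flipMask_of_low {d M : ℕ}
    (h : ∀ w < 32, (d ≤ w ∧ M.testBit (w - d) = true ∧ M.testBit w = false ∧ w - d = w ^^^ d) ∨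
      ((d ≤ w → M.testBit (w - d) = false) ∧ M.testBit w = true ∧ d + w = w ^^^ d))
    {m w : ℕ} (hw : w < 32) : Nat.testBit (flipMask m d M) w = m.testBit (w ^^^ d) := by
  rw [testBit_flipMask]
  rcases h w hw with ⟨h1, h2, h3, h4⟩ | ⟨h1, h2, h3⟩
  · rw [h2, h3, h4, decide_eq_true h1]
    simp
  · rw [h2, h3]
    by_cases hd : d ≤ w
    · simp [h1 hd]
    · simp [hd]

theorem encloses_iff {m : ℕ} : encloses m = true ↔
    ∃ w < 32, hasBit m w = false ∧ ∀ i < 5, hasBit m (w ^^^ 2 ^ i) = true := by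
  have hsel : ∀ c : Bool, sel c false true = true ↔ c = false := by decide
  have key : ∀ w < 32, Nat.testBit (Nat.land (Nat.xor m 0xffffffff)
      (Nat.land (flipMask m 1 0x55555555) (Nat.land (flipMask m 2 0x33333333)
        (Nat.land (flipMask m 4 0x0f0f0f0f) (Nat.land (flipMask m 8 0x00ff00ff)
          (flipMask m 16 0x0000ffff)))))) w = true ↔
      hasBit m w = false ∧ ∀ i < 5, hasBit m (w ^^^ 2 ^ i) = true := by
    intro w hw
    change Nat.testBit ((m ^^^ 0xffffffff) &&& (flipMask m 1 0x55555555 &&&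
      (flipMask m 2 0x33333333 &&& (flipMask m 4 0x0f0f0f0f &&& (flipMask m 8 0x00ff00ff &&&
          flipMask m 16 0x0000ffff))))) w = true ↔ _
    have hfull : ∀ w < 32, Nat.testBit 0xffffffff w = true := by decide
    simp only [Nat.testBit_and, Nat.testBit_xor, hfull w hw,
      testBit_flipMask_of_low (d := 1) (M := 0x55555555) (by decide +kernel) hw,
      testBit_flipMask_of_low (d := 2) (M := 0x33333333) (by decide +kernel) hw,
      testBit_flipMask_of_low (d := 4) (M := 0x0f0f0f0f) (by decide +kernel) hw,
      testBit_flipMask_of_low (d := 8) (M := 0x00ff00ff) (by decide +kernel) hw,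
      testBit_flipMask_of_low (d := 16) (M := 0x0000ffff) (by decide +kernel) hw, hasBit_eq,
      Bool.and_eq_true, Bool.xor_true, Bool.not_eq_true']
    refine and_congr_right' ⟨fun ⟨h0, h1, h2, h3, h4⟩ i hi => ?_, fun h =>
      ⟨h 0 (by norm_num), h 1 (by norm_num), h 2 (by norm_num), h 3 (by norm_num),
        h 4 (by norm_num)⟩⟩
    interval_cases i
    exacts [h0, h1, h2, h3, h4]
  rw [encloses, hsel]
  constructor
  · intro h
    obtain ⟨w, hw⟩ := Nat.exists_testBit_of_ne_zero (Nat.ne_of_beq_eq_false h)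
    have hlt : w < 32 := by
      by_contra hc
      have h16 : Nat.testBit (flipMask m 16 0x0000ffff) w = false := by
        have hM : ∀ v, 16 ≤ v → Nat.testBit 0xffff v = false := fun v hv =>
          Nat.testBit_lt_two_pow (lt_of_lt_of_le (by norm_num)
            (Nat.pow_le_pow_right (n := 2) (by norm_num) hv))
        rw [testBit_flipMask, hM w (by omega), hM (w - 16) (by omega)]
        simp
      replace hw : Nat.testBit ((m ^^^ 0xffffffff) &&& (flipMask m 1 0x55555555 &&&
        (flipMask m 2 0x33333333 &&& (flipMask m 4 0x0f0f0f0f &&& (flipMask m 8 0x00ff00ff &&&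
            flipMask m 16 0x0000ffff))))) w = true := hw
      simp [Nat.testBit_and, h16] at hw
    exact ⟨w, hlt, (key w hlt).1 hw⟩
  · rintro ⟨w, hw, h⟩
    rw [Bool.eq_false_iff]
    intro h0
    have := (key w hw).2 h
    rw [Nat.eq_of_beq_eq_true h0] at this
    simp at this

/-- A list of pairs encloses a vertex exactly if `NoEnc` fails. -/
theorem encloses_eq_false_iff {m : ℕ} {L : List Pair}
    (hm : ∀ v, hasBit m v = true ↔ v ∈ vertsOf L) : encloses m = false ↔ NoEnc 5 L := by
  rw [Bool.eq_false_iff, Ne, encloses_iff]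
  constructor
  · intro h w hw hwL
    by_contra! hc
    refine h ⟨w, hw, Bool.eq_false_iff.2 fun e => hwL ((hm w).1 e), fun i hi => ?_⟩
    by_contra hb
    refine hb ((hm _).2 (hc _ (xor_two_pow_lt hw hi) (adj_xor_two_pow w i)))
  · rintro h ⟨w, hw, hwL, hnb⟩
    obtain ⟨v, hv, ⟨i, hi⟩, hvL⟩ := h w hw fun hwL' => by
      rw [(hm w).2 hwL'] at hwL
      exact absurd hwL (by simp)
    have hi5 : i < 5 := by
      have : w ^^^ v < 2 ^ 5 := Nat.xor_lt_two_pow hw hv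
      rw [hi] at this
      exact (Nat.pow_lt_pow_iff_right (by norm_num)).1 this
    have := hnb i hi5
    rw [← xor_eq_iff.1 ((Nat.xor_comm v w).trans hi), hm] at this
    exact hvL this

/-! ### Enumerating three pairs up to symmetry -/

/-- The list `S` contains the code of a path system for `L`. -/
def listed (S : List ℕ) (L : List Pair) : Bool :=
  anyL (fun m => (fun P : List (List ℕ) => sel (decide (P.map ends = L)) (goodSys 5 P) false)
    (decodeSys 5 m)) S

theorem linked_of_listed {S : List ℕ} {L : List Pair} (h : listed S L = true) : Linked 5 L := by
  obtain ⟨m, -, hm⟩ := anyL_iff.1 h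
  rw [sel_false_right, decide_eq_true_iff] at hm
  rw [← hm.1]
  exact linked_of_goodSys hm.2

/-- Data for the search of path systems for lists that consist of some fixed pairs and three further
pairs. -/
structure Config where
  /-- the fixed pairs -/
  fixed : List Pair
  /-- tables of automorphisms that permute the fixed pairs -/
  tabs : List ℕ
  /-- for each code of a pair, the code of an image of the pair under one of these automorphisms;
  one byte for each -/
  canon : ℕ
  /-- codes of some path systems -/
  systems : List ℕ

/-- The automorphisms of a configuration have the required properties. -/
def Config.checkTabs (c : Config) : Bool :=
  sel (allL (fun P => sel (checkAut 5 P) (decide ((c.fixed.map fun p => code5 (appP P p)).Perm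
      (c.fixed.map code5))) false) c.tabs)
    (allN 256 fun i => anyL (fun P => Nat.beq (code5 (appP P (pair5 i))) (byte c.canon i)) c.tabs)
    false

/-- The numbers below `16`. -/
def digits : List ℕ := [0, 1, 2, 3, 4, 5, 6, 7, 8, 9, 10, 11, 12, 13, 14, 15]

/-- The set of the codes of pairs whose even vertex comes after the one with upper digits `x`. -/
def laterMask (x : ℕ) : ℕ := maskOf (fun k => Nat.blt x (Nat.land k 15)) 256

/-- The set of the codes of pairs whose odd vertex is different from the one with upper digits `y`.
-/
def otherMask (y : ℕ) : ℕ := maskOf (fun k => sel (Nat.beq (Nat.shiftRight k 4) y) false true) 256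

/-- The set of the codes `j` of pairs which satisfy `allow`, are disjoint from the fixed pairs and
from `p`, and satisfy `i ≤ byte c.canon j`. -/
def Config.partners (c : Config) (allow : Pair → Bool) (i : ℕ) (p : Pair) : ℕ :=
  maskOf (fun j => sel (Nat.ble i (byte c.canon j)) (forceP (pair5 j) fun q => sel (allow q)
    (allL (fun f => apart f q) (p :: c.fixed)) false) false) 256

/-- Enumerate the lists of three pairs that satisfy `allow`, are disjoint from the fixed pairs, and
have codes `i`, `j`, `k` with `i ≤ byte c.canon l` for `l = i, j, k`; the even vertex of the third
pair comes after the one of the second pair. For each possible first pair, `body` provides a test to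
be applied to `j` and the set of all `k`. -/
def Config.checkRows (c : Config) (allow : Pair → Bool)
    (body : Pair → ((ℕ → ℕ → Bool) → Bool) → Bool) : Bool :=
  tabulate laterMask digits (fun X => tabulate otherMask digits (fun Y => allN 256 fun i =>
    forceP (pair5 i) fun p =>
      sel (sel (Nat.ble i (byte c.canon i)) (sel (allow p) (allL (fun f => apart f p) c.fixed) false)
        false)
      (force (c.partners allow i p) fun A => body p fun test =>
        allL (fun x => allL (fun y => force (Nat.add x.1 (Nat.mul 16 y.1)) fun j => sel (hasBit A j)
          (force (Nat.land A (Nat.land x.2 y.2)) fun R => test j R) true) Y) X) true) []) []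

theorem mem_digits {x : ℕ} (hx : x < 16) : x ∈ digits := by
  have : ∀ x < 16, x ∈ digits := by decide
  exact this x hx

theorem code_ne_of_apart {j k : ℕ} (h : Apart (pair5 j) (pair5 k)) :
    j % 16 ≠ k % 16 ∧ j / 16 ≠ k / 16 := by
  have hmod : ∀ v, Nat.land v 15 = v % 16 := fun v => Nat.and_two_pow_sub_one_eq_mod _ 4
  have hdiv : ∀ v, Nat.shiftRight v 4 = v / 16 := fun v => Nat.shiftRight_eq_div_pow _ 4
  obtain ⟨h1, -, -, h2⟩ := h
  simp only [pair5, hmod, hdiv] at h1 h2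
  exact ⟨fun e => h1 (by rw [e]), fun e => h2 (by rw [e])⟩

/-- The lists enumerated by `Config.checkRows`. -/
structure Config.Canonical (c : Config) (allow : Pair → Bool) (i j k : ℕ) : Prop where
  lt_i : i < 256
  lt_j : j < 256
  lt_k : k < 256
  lt : j % 16 < k % 16
  le_i : i ≤ byte c.canon i
  le_j : i ≤ byte c.canon j
  le_k : i ≤ byte c.canon k
  valid : Valid 5 (c.fixed ++ [pair5 i, pair5 j, pair5 k])
  allow_i : allow (pair5 i) = true
  allow_j : allow (pair5 j) = true
  allow_k : allow (pair5 k) = true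

/-- The test is applied to a set that contains the third pair. -/
theorem Config.Canonical.test {c : Config} {allow : Pair → Bool}
    {body : Pair → ((ℕ → ℕ → Bool) → Bool) → Bool} (hc : c.checkRows allow body = true) {i j k : ℕ}
    (h : c.Canonical allow i j k) {test : ℕ → ℕ → Bool}
    (hbody : ∀ f, body (pair5 i) f = f test) : ∃ R, hasBit R k = true ∧ test j R = true := by
  have hap := List.pairwise_append.1 (pairwise_apart h.valid.2)
  simp only [List.pairwise_cons, List.mem_cons, List.not_mem_nil, or_false, forall_eq_or_imp,
    forall_eq] at hap
  obtain ⟨-, ⟨⟨ij, ik⟩, jk, -⟩, hF⟩ := hap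
  rw [Config.checkRows, tabulate_eq, tabulate_eq, List.append_nil, List.append_nil, allN_iff] at hc
  have hrow := hc i h.lt_i
  simp only [forceP_eq, force_eq] at hrow
  rw [sel_false_right.2 ⟨Nat.ble_eq_true_of_le h.le_i, sel_false_right.2 ⟨h.allow_i,
    allL_iff.2 fun f hf => apart_iff.2 (hF f hf).1⟩⟩, sel_true, hbody, allL_iff] at hrow
  have hA : ∀ {m}, m < 256 → i ≤ byte c.canon m → allow (pair5 m) = true →
      (∀ f ∈ c.fixed, Apart f (pair5 m)) → Apart (pair5 i) (pair5 m) →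
      hasBit (c.partners allow i (pair5 i)) m = true := by
    intro m hm h1 h2 h3 h4
    refine hasBit_maskOf.2 ⟨hm, ?_⟩
    rw [forceP_eq]
    refine sel_false_right.2 ⟨Nat.ble_eq_true_of_le h1, sel_false_right.2 ⟨h2, allL_iff.2 ?_⟩⟩
    intro f hf
    rcases List.mem_cons.1 hf with rfl | hf
    · exact apart_iff.2 h4
    · exact apart_iff.2 (h3 f hf)
  have hj := h.lt_j
  have hx : (j % 16, laterMask (j % 16)) ∈ (digits.map fun a => (a, laterMask a)).reverse :=
    List.mem_reverse.2 (List.mem_map_of_mem (mem_digits (Nat.mod_lt _ (by norm_num))))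
  have hy : (j / 16, otherMask (j / 16)) ∈ (digits.map fun a => (a, otherMask a)).reverse :=
    List.mem_reverse.2 (List.mem_map_of_mem (mem_digits (by omega)))
  have := allL_iff.1 (hrow _ hx) _ hy
  rw [show Nat.add (j % 16) (Nat.mul 16 (j / 16)) = j from Nat.mod_add_div j 16,
    hA h.lt_j h.le_j h.allow_j (fun f hf => (hF f hf).2.1) ij, sel_true] at this
  have hmod : ∀ v, Nat.land v 15 = v % 16 := fun v => Nat.and_two_pow_sub_one_eq_mod _ 4
  have hdiv : ∀ v, Nat.shiftRight v 4 = v / 16 := fun v => Nat.shiftRight_eq_div_pow _ 4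
  have hlater : hasBit (laterMask (j % 16)) k = true := by
    refine hasBit_maskOf.2 ⟨h.lt_k, ?_⟩
    rw [Nat.blt_eq, hmod]
    exact h.lt
  have hother : hasBit (otherMask (j / 16)) k = true := by
    refine hasBit_maskOf.2 ⟨h.lt_k, ?_⟩
    rw [hdiv]
    have : Nat.beq (k / 16) (j / 16) = false :=
      Bool.eq_false_iff.2 fun e => (code_ne_of_apart jk).2 (Nat.eq_of_beq_eq_true e).symm
    rw [this]
    rfl
  have hAk := hA h.lt_k h.le_k h.allow_k (fun f hf => (hF f hf).2.2) ik
  have hland : ∀ a b d, hasBit a k = true → hasBit b k = true → hasBit d k = true →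
      hasBit (Nat.land a (Nat.land b d)) k = true := by
    intro a b d h1 h2 h3
    rw [hasBit_eq] at h1 h2 h3 ⊢
    change Nat.testBit (a &&& (b &&& d)) k = true
    simp only [Nat.testBit_and, h1, h2, h3, Bool.and_true]
  dsimp only at this
  generalize laterMask (j % 16) = X at hlater this
  generalize otherMask (j / 16) = Y at hother this
  generalize c.partners allow i (pair5 i) = A at hAk this
  exact ⟨_, hland A X Y hAk hlater hother, this⟩

/-- Lists of odd pairs with the same codes agree up to order. -/
theorem sameSys_of_code5 {L M : List Pair} (hL : ∀ p ∈ L, Odd5 p) (hM : ∀ p ∈ M, Odd5 p)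
    (h : (L.map code5).Perm (M.map code5)) : SameSys L M := by
  have key : ∀ L : List Pair, (∀ p ∈ L, Odd5 p) → L.map (fun p => s(p.1, p.2)) =
      (L.map code5).map fun c => s((pair5 c).1, (pair5 c).2) := by
    intro L hL
    rw [List.map_map]
    exact List.map_congr_left fun p hp => sameEnds_iff.1 (code5_spec (hL p hp)).2.1
  unfold SameSys
  rw [key L hL, key M hM]
  exact h.map _

/-- An automorphism that leads to the pair with code `byte c.canon (code5 s)`. -/
theorem Config.exists_aut {c : Config} (hc : c.checkTabs = true) (he : ∀ p ∈ c.fixed, Odd5 p)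
    {s : Pair} (hs : Odd5 s) : ∃ P ∈ c.tabs, IsAut 5 (app P) ∧
      SameSys (c.fixed.map (mapPair (app P))) c.fixed ∧
      code5 (mapPair (app P) s) = byte c.canon (code5 s) := by
  rw [Config.checkTabs, sel_false_right, allL_iff, allN_iff] at hc
  obtain ⟨h1, h2⟩ := hc
  obtain ⟨hlt, hs5, -⟩ := code5_spec hs
  obtain ⟨P, hP, hPs⟩ := anyL_iff.1 (h2 _ hlt)
  have := h1 P hP
  rw [sel_false_right, decide_eq_true_iff] at this
  obtain ⟨haut, hperm⟩ := this
  replace haut := isAut_of_check haut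
  refine ⟨P, hP, haut, sameSys_of_code5 (fun q hq => ?_) he (by rw [List.map_map]; exact hperm), ?_⟩
  · obtain ⟨p, hp, rfl⟩ := List.mem_map.1 hq
    exact (he p hp).map haut
  · rw [← code5_congr (hs.map haut) (hs5.mapPair (app P))]
    exact Nat.eq_of_beq_eq_true hPs

/-- It suffices to consider the lists enumerated by `Config.checkRows`: any other list can be moved,
by an automorphism, to one whose first pair has a smaller code. -/
theorem Config.linked {c : Config} (hc : c.checkTabs = true) {allow : Pair → Bool}
    (hallow : ∀ p q, Odd5 p → SameEnds p q → allow q = allow p)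
    (hmap : ∀ P ∈ c.tabs, IsAut 5 (app P) → ∀ p, Odd5 p → allow p = true →
      allow (mapPair (app P) p) = true)
    {K : List Pair → Prop} (hsame : ∀ L M, SameSys L M → K L → K M)
    (hK : ∀ g, IsAut 5 g → ∀ L, Valid 5 L → K L → K (L.map (mapPair g)))
    (H : ∀ i j k, c.Canonical allow i j k → K (c.fixed ++ [pair5 i, pair5 j, pair5 k]) →
      Linked 5 (c.fixed ++ [pair5 i, pair5 j, pair5 k]))
    {p q r : Pair} (hv : Valid 5 (c.fixed ++ [p, q, r])) (hk : K (c.fixed ++ [p, q, r]))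
    (ap : allow p = true) (aq : allow q = true) (ar : allow r = true) :
    Linked 5 (c.fixed ++ [p, q, r]) := by
  generalize hi : code5 p = i
  induction i using Nat.strong_induction_on generalizing p q r with
  | _ i ih =>
  have hF : ∀ f ∈ c.fixed, Odd5 f := fun f hf => hv.1 f (List.mem_append_left _ hf)
  have hodd : ∀ f ∈ [p, q, r], Odd5 f := fun f hf => hv.1 f (List.mem_append_right _ hf)
  simp only [List.mem_cons, List.not_mem_nil, or_false, forall_eq_or_imp, forall_eq] at hodd
  obtain ⟨hp, hq, hr⟩ := hodd
  have move : ∀ s t u : Pair, Odd5 s → List.Perm [s, t, u] [p, q, r] →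
      byte c.canon (code5 s) < i → Linked 5 (c.fixed ++ [p, q, r]) := by
    intro s t u hs hperm hlt
    have hperm' : SameSys (c.fixed ++ [p, q, r]) (c.fixed ++ [s, t, u]) :=
      .of_perm (hperm.symm.append_left _)
    obtain ⟨P, hP, hg, hfix, hcode⟩ := Config.exists_aut hc hF hs
    have hsm : SameSys ((c.fixed ++ [s, t, u]).map (mapPair (app P)))
        (c.fixed ++ [mapPair (app P) s, mapPair (app P) t, mapPair (app P) u]) := by
      rw [List.map_append]
      exact hfix.append (.refl _)
    have hv' := hperm'.valid hv
    have hk' := hsame _ _ hperm' hk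
    have hall : ∀ f ∈ [s, t, u], allow (mapPair (app P) f) = true := fun f hf => by
      have hf' := hperm.subset hf
      have : allow f = true := by
        simp only [List.mem_cons, List.not_mem_nil, or_false] at hf'
        rcases hf' with rfl | rfl | rfl <;> assumption
      exact hmap P hP hg f (hv.1 f (List.mem_append_right _ hf')) this
    refine hperm'.symm.linked (Linked.of_map_same hg hv' hsm ?_)
    exact ih _ hlt (hsm.valid (hv'.map hg)) (hsame _ _ hsm (hK _ hg _ hv' hk')) (hall s (by simp))
      (hall t (by simp)) (hall u (by simp)) hcode
  by_cases h1 : byte c.canon (code5 p) < i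
  · exact move p q r hp (.refl _) h1
  by_cases h2 : byte c.canon (code5 q) < i
  · exact move q p r hq (.swap _ _ _) h2
  by_cases h3 : byte c.canon (code5 r) < i
  · exact move r p q hr ((List.Perm.swap _ _ _).trans (.cons _ (.swap _ _ _))) h3
  rw [not_lt] at h1 h2 h3
  obtain ⟨lp, sp, -⟩ := code5_spec hp
  obtain ⟨lq, sq, -⟩ := code5_spec hq
  obtain ⟨lr, sr, -⟩ := code5_spec hr
  rw [← hallow p _ hp sp] at ap
  rw [← hallow q _ hq sq] at aq
  rw [← hallow r _ hr sr] at ar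
  rw [hi] at h1 lp sp ap
  have hs1 : SameSys (c.fixed ++ [p, q, r])
      (c.fixed ++ [pair5 i, pair5 (code5 q), pair5 (code5 r)]) :=
    SameSys.append (.refl _) (.cons sp (.cons sq (.cons sr (.refl []))))
  have hs2 : SameSys (c.fixed ++ [pair5 i, pair5 (code5 q), pair5 (code5 r)])
      (c.fixed ++ [pair5 i, pair5 (code5 r), pair5 (code5 q)]) :=
    SameSys.append (.refl _) (.of_perm (.cons _ (.swap _ _ _)))
  have hv' := hs1.valid hv
  have hk' := hsame _ _ hs1 hk
  have hap := (List.pairwise_append.1 (pairwise_apart hv'.2)).2.1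
  simp only [List.pairwise_cons, List.mem_cons, List.not_mem_nil, or_false, forall_eq_or_imp,
    forall_eq] at hap
  refine hs1.symm.linked ?_
  rcases lt_or_gt_of_ne (code_ne_of_apart hap.2.1).1 with hlt | hlt
  · exact H _ _ _ ⟨lp, lq, lr, hlt, h1, h2, h3, hv', ap, aq, ar⟩ hk'
  · exact hs2.symm.linked (H _ _ _ ⟨lp, lr, lq, hlt, h1, h3, h2, hs2.valid hv', ap, ar, aq⟩
      (hsame _ _ hs2 hk'))

/-- A test for the pairs `p` and `q` and the pair with code `k`, together with the fixed pairs: if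
the test `easy` fails, then a path system is constructed, either by gluing with at most two crossing
pairs, or from the list `c.systems`, or by gluing with at most four crossing pairs. -/
def Config.leaf (c : Config) (easy : List Pair → Bool) (S : List Split) (p q : Pair) (k : ℕ) :
    Bool :=
  forceP (pair5 k) fun r => sel (easy (p :: q :: r :: c.fixed)) true
    (sel (anyL (glueFrom 2 [q, r]) S) true
      (sel (listed c.systems (c.fixed ++ [p, q, r])) true (anyL (glueFrom 4 [q, r]) S)))

theorem Config.linked_of_leaf {c : Config} {easy : List Pair → Bool} {S : List Split} {p q : Pair}
    {k : ℕ} (hv : Valid 5 (c.fixed ++ [p, q, pair5 k]))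
    (hS : ∀ s ∈ S, IsAut 5 (app s.tab) ∧ IsSplit s.tab (p :: c.fixed) s.lower s.upper s.cross)
    (h : c.leaf easy S p q k = true) :
    easy (p :: q :: pair5 k :: c.fixed) = true ∨ Linked 5 (c.fixed ++ [p, q, pair5 k]) := by
  rw [Config.leaf, forceP_eq, sel_true_left, sel_true_left, sel_true_left] at h
  have hglue : ∀ n, anyL (glueFrom n [q, pair5 k]) S = true →
      Linked 5 (c.fixed ++ [p, q, pair5 k]) := fun n h => by
    obtain ⟨s, hs, h⟩ := anyL_iff.1 h
    have hp : List.Perm (c.fixed ++ [p, q, pair5 k]) ([q, pair5 k] ++ (p :: c.fixed)) :=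
      (List.perm_append_comm (l₂ := [p, q, pair5 k])).trans
        ((List.perm_append_comm (l₁ := [p]) (l₂ := [q, pair5 k])).append_right _)
    obtain ⟨h1, h2⟩ := hS s hs
    exact (linked_of_glueFrom h1 h2 ((SameSys.of_perm hp).valid hv) h).perm hp.symm
  rcases h with h | h | h | h
  · exact Or.inl h
  · exact Or.inr (hglue 2 h)
  · exact Or.inr (linked_of_listed h)
  · exact Or.inr (hglue 4 h)

/-! ### Two edges and three pairs -/

/-- The check of a configuration whose fixed pairs are two edges. Third pairs that lead to a safe
profile along some coordinate are removed from the row, all at once; a path system is constructed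
for the remaining ones, unless they enclose a vertex. -/
def Config.checkFive (c : Config) : Bool :=
  tabulate profMask profiles (fun B => c.checkRows (fun _ => true) fun p k =>
    tabulate (fun b => safeMask B
        (List.rec (prof b.1.1 p) (fun f _ ih => Nat.add (prof b.1.1 f) ih) c.fixed) b.1) B (fun W =>
      splits (p :: c.fixed) fun S => k fun j R =>
        force (unionOf (fun w => hasBit w.1.2 j) (fun w => w.2) W) fun U =>
          force (Nat.xor (Nat.lor R U) U) fun R' => forceP (pair5 j) fun q =>
            drain (c.leaf (fun L => encloses (vertMask L)) S p q) 8 0 R') []) []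

theorem Config.linked_of_checkFive {c : Config} (hc : c.checkFive = true)
    (hlen : c.fixed.length = 2) (hedges : c.fixed.countP isEdge = 2) {i j k : ℕ}
    (h : c.Canonical (fun _ => true) i j k)
    (hn : NoEnc 5 (c.fixed ++ [pair5 i, pair5 j, pair5 k])) :
    Linked 5 (c.fixed ++ [pair5 i, pair5 j, pair5 k]) := by
  rw [Config.checkFive, tabulate_eq, List.append_nil] at hc
  obtain ⟨S, hS, hsplits⟩ := splits_spec (pair5 i :: c.fixed)
  obtain ⟨R, hR, htest⟩ := h.test hc (fun f => by rw [tabulate_eq, hsplits])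
  simp only [force_eq, forceP_eq, List.append_nil] at htest
  generalize hU : unionOf _ _ _ = U at htest
  cases hbit : hasBit U k
  · have hR : hasBit (Nat.xor (Nat.lor R U) U) k = true := by
      rw [hasBit_eq] at hbit hR ⊢
      change Nat.testBit ((R ||| U) ^^^ U) k = true
      simp only [Nat.testBit_xor, Nat.testBit_or, hbit, hR, Bool.or_false, Bool.xor_false]
    have hleaf := drain_spec htest (show k < 2 ^ 8 from h.lt_k) hR
    rw [Nat.zero_add] at hleaf
    rcases Config.linked_of_leaf h.valid hS hleaf with he | he
    · have hp : SameSys (c.fixed ++ [pair5 i, pair5 j, pair5 k])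
          (pair5 i :: pair5 j :: pair5 k :: c.fixed) :=
        .of_perm (List.perm_append_comm (l₂ := [pair5 i, pair5 j, pair5 k]))
      rw [(encloses_eq_false_iff fun v => hasBit_vertMask).2 (hp.noEnc hn)] at he
      exact absurd he (by simp)
    · exact he
  · rw [← hU] at hbit
    obtain ⟨w, hw, hwj, hwk⟩ := unionOf_spec hbit
    obtain ⟨b, hb, rfl⟩ := List.mem_map.1 (List.mem_reverse.1 hw)
    dsimp only at hwj hwk
    obtain ⟨b', hb', h2, h3⟩ := unionOf_spec hwk
    obtain ⟨t, ht, rfl⟩ := List.mem_map.1 (List.mem_reverse.1 hb)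
    obtain ⟨t', ht', rfl⟩ := List.mem_map.1 (List.mem_reverse.1 hb')
    dsimp only at hwj h2 h3
    have hlt : ∀ t ∈ profiles, t.1 < 5 := by decide
    have e1 := Nat.eq_of_beq_eq_true (hasBit_maskOf.1 hwj).2
    have e2 := Nat.eq_of_beq_eq_true (hasBit_maskOf.1 h3).2
    rw [sel_false_right, Nat.beq_eq] at h2
    obtain ⟨e3, h2⟩ := h2
    rw [e3] at e2
    refine linked_of_safeTab (hlt t ht) h.valid hn (by simp [hlen]) ?_ ?_
    · rw [List.countP_append]
      omega
    · rw [← e1, ← e2] at h2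
      have hland : ∀ v, Nat.land v 4095 = v % 4096 := fun v => Nat.and_two_pow_sub_one_eq_mod _ 12
      have hadd : ∀ v w, Nat.add v w = v + w := fun v w => rfl
      have hsum : ∀ (F : List Pair) (x : ℕ), (List.rec x (fun f _ ih => Nat.add (prof t.1 f) ih) F : ℕ)
          = (F.map (prof t.1)).sum + x := by
        intro F x
        induction F with
        | nil => simp
        | cons f F ih =>
          change prof t.1 f + _ = _
          rw [ih, List.map_cons, List.sum_cons, add_assoc]
      rw [hsum] at h2
      simp only [hland, hadd, List.map_append, List.sum_append, List.map_cons, List.map_nil,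
        List.sum_cons, List.sum_nil] at h2 ⊢
      refine Eq.trans (congrArg (hasBit safeTab) ?_) h2
      omega

/-- The table of the automorphism `v ↦ v ^^^ c`. -/
def xorTab (c : ℕ) : ℕ :=
  Nat.rec 0 (fun v ih => force ih fun t => Nat.lor t (Nat.shiftLeft (Nat.xor v c) (Nat.mul 5 v))) 32

theorem exists_aut_xor {c : ℕ} (hc : c < 32) : ∃ g, IsAut 5 g ∧ ∀ v < 32, g v = c ^^^ v := by
  have h : allN 32 (fun c => force (xorTab c) fun P => sel (checkAut 5 P) (allN 32 fun v =>
      Nat.beq (app P v) (Nat.xor c v)) false) = true := by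
    decide +kernel
  have := allN_iff.1 h c hc
  rw [force_eq, sel_false_right, allN_iff] at this
  exact ⟨_, isAut_of_check this.1, fun v hv => Nat.eq_of_beq_eq_true (this.2 v hv)⟩

/-- The ends of an odd pair have distance one, three or five. -/
theorem exists_aut_pair {p : Pair} (hp : Odd5 p) :
    (∃ g, IsAut 5 g ∧ (mapPair g p = (0, 1) ∨ mapPair g p = (0, 7))) ∨ p.1 ^^^ p.2 = 31 := by
  have h : allN 32 (fun d => sel (Nat.beq (par d) 0) true (anyN 5 fun a => anyN 5 fun b =>
      anyN 5 fun c => (fun g : ℕ → ℕ => sel (Nat.beq (g 0) 0) (force (g d) fun x =>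
        sel (Nat.beq x 1) true (sel (Nat.beq x 7) true (Nat.beq d 31))) false)
          fun v => app (swapTab a) (app (swapTab b) (app (swapTab c) v)))) = true := by
    decide +kernel
  obtain ⟨g, hg, hgv⟩ := exists_aut_xor hp.1
  have hgp : mapPair g p = (0, p.1 ^^^ p.2) :=
    Prod.ext ((hgv _ hp.1).trans (Nat.xor_self _)) (hgv _ hp.2.1)
  have hd := (hp.map hg).2
  rw [hgp] at hd
  dsimp only at hd
  generalize p.1 ^^^ p.2 = d at hgp hd
  have := allN_iff.1 h d hd.1
  rw [show Nat.beq (par d) 0 = false from Bool.eq_false_iff.2 fun e =>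
    hd.2 (Nat.eq_of_beq_eq_true e).symm, sel_false] at this
  obtain ⟨a, ha, this⟩ := anyN_iff.1 this
  obtain ⟨b, hb, this⟩ := anyN_iff.1 this
  obtain ⟨c, hc, this⟩ := anyN_iff.1 this
  simp only [sel_false_right, force_eq, sel_true_left, Nat.beq_eq] at this
  rw [or_iff_not_imp_right]
  intro hd31
  refine ⟨(app (swapTab a) ∘ app (swapTab b) ∘ app (swapTab c)) ∘ g,
    ((swapTab_spec ha).comp ((swapTab_spec hb).comp (swapTab_spec hc))).comp hg, ?_⟩
  have hmap : mapPair ((app (swapTab a) ∘ app (swapTab b) ∘ app (swapTab c)) ∘ g) p =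
      mapPair (app (swapTab a) ∘ app (swapTab b) ∘ app (swapTab c)) (mapPair g p) := rfl
  rw [hmap, hgp]
  rcases this with ⟨h0, h1 | h1 | h1⟩
  · exact Or.inl (Prod.ext h0 h1)
  · exact Or.inr (Prod.ext h0 h1)
  · exact absurd h1 hd31

theorem isEdge_mapPair {g : ℕ → ℕ} (hg : IsAut 5 g) {p : Pair} (hp : Odd5 p) :
    isEdge (mapPair g p) = isEdge p := by
  have key : ∀ {g : ℕ → ℕ}, IsAut 5 g → ∀ {p : Pair}, Odd5 p → isEdge p = true →
      isEdge (mapPair g p) = true := fun hg p hp h =>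
    adjB_of_adj (hg.lt _ hp.1) (hg.lt _ hp.2.1) (hg.adj _ hp.1 _ hp.2.1 (adj_of_adjB h))
  refine Bool.eq_iff_iff.2 ⟨fun h => ?_, key hg hp⟩
  obtain ⟨f, hf, hfg, -⟩ := hg.exists_inverse
  have := key hf (hp.map hg) h
  rwa [show mapPair f (mapPair g p) = p from
    Prod.ext (hfg _ hp.1) (hfg _ hp.2.1)] at this

theorem exists_aut_edge {p : Pair} (hp : Odd5 p) (he : isEdge p = true) :
    ∃ g, IsAut 5 g ∧ mapPair g p = (0, 1) := by
  rcases exists_aut_pair hp with ⟨g, hg, h⟩ | h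
  · rw [← isEdge_mapPair hg hp] at he
    rcases h with h | h
    · exact ⟨g, hg, h⟩
    · rw [h] at he
      exact absurd he (by decide)
  · rw [isEdge, adjB, show Nat.xor p.1 p.2 = 31 from h] at he
    exact absurd he (by decide)

/-- The configurations with two edges as fixed pairs. The first edge is `{0, 1}`, and the second
edge takes each position up to symmetry. -/
def twoEdges : List Config :=
  [⟨[(0, 1), (3, 2)],
    [0xffbbcdeb38bdab49ca307b9ac5a928398a418820, 0xe77dfc675ba56d784653635cf4254b214c700443,
     0xf7f9db5e9573d8d31c85d6f1994e1152d0910c01, 0xef3fead2f66b1ee290e6ce37a8c2724a16a08062,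
     0xffbbc7b9acdeb385a928bdab4398a49ca3018820, 0xe77df635cfc675b4254ba56d7214c78465300443,
     0xffbbcbdab47b9ac398a4deb389ca305a92818820, 0xf7f9dd6f19b5e9594e1173d8d52d0931c8510c01,
     0xf7f9d73d8dd6f1952d09b5e9531c8594e1110c01, 0xef3fece37aad2f68c2726b1ee4a16a290e608062,
     0xef3fe6b1eece37a4a16aad2f6290e68c27208062, 0xe77dfa56d7635cf214c7c675b846534254b00443,
     0xffbbcdeb387b9ac5a928bdab49ca30398a418820, 0xffbbcbdab4deb389ca307b9ac398a45a92818820,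
     0xffbbc7b9acbdab4398a4deb385a9289ca3018820, 0xf7f9dd6f1973d8d52d09b5e9594e1131c8510c01,
     0xf7f9db5e95d6f1994e1173d8d31c8552d0910c01, 0xf7f9d73d8db5e9531c85d6f1952d0994e1110c01,
     0xef3fece37a6b1ee4a16aad2f68c272290e608062, 0xef3fead2f6ce37a8c2726b1ee290e64a16a08062,
     0xef3fe6b1eead2f6290e6ce37a4a16a8c27208062, 0xe77dfc675b635cf4254ba56d784653214c700443,
     0xe77dfa56d7c675b84653635cf214c74254b00443, 0xe77df635cfa56d7214c7c675b4254b8465300443],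
    0xeeef6e6f6e6f2e2f6e6f2e2f2e2f0e0fefee6f6e6f6e2f2e6f6e2f2e2f2e0f0e6e6f66676a6b26276a6b26272c2d06076f6e67666b6a27266b6a27262d2c07066e6f6a6b666726276a6b2c2d262706076f6e6b6a676627266b6a2d2c272607062e2f2627262722232c2d2425242502032f2e2726272623222d2c2524252403026e6f6a6b6a6b2c2d66672627262706076f6e6b6a6b6a2d2c67662726272607062e2f26272c2d242526272223242502032f2e27262d2c252427262322252403022e2f2c2d2627242526272425222302032f2e2d2c2726252427262524232203020e0f06070607020306070203020300010f0e0706070603020706030203020100,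
    [0x2041470c8086194551601061d75924db69e7dd34f38a2c98020e0040,
     0x2035d65180831c79f6da6104935d65151601061cf38a2c98020e0040,
     0x2035d71e7db4d181961a4905155d618716010c38f2ca2098020e0040,
     0x202186515548104936da79f75c32010534f38a2c98021965c70e0040,
     0x2020a2c935d7148104551473ce3201065977de69b6588024930e0040,
     0x205571cf2ca38c81c60824d16010659441165b69e7dd8024930e0040,
     0x2034921841481c30e3c75d51601065924d165b69e7dd80228b0e0040,
     0x2034f3865948154592483201051d74d241869b7de71d80228b0e0040]⟩,
   ⟨[(0, 1), (6, 7)],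
    [0xffbbcdeb38bdab49ca307b9ac5a928398a418820, 0xce37aef3fe8c272ad2f64a16a6b1ee08062290e6,
     0xffb7aef3387b96a6b128bda72ad2303986229020, 0xce3bcdebfe4a1ac5a9ee8c2b49caf6080a4188e6,
     0xf7f9dd6f19b5e9594e1173d8d52d0931c8510c01, 0xc675be77df84653a56d74254b635cf00443214c7,
     0xf7f5be771973d4b63509b5e53a561131c4321401, 0xc679dd6fdf4258d52dcf8469594ed70048510cc7,
     0xffbbcdeb387b9ac5a928bdab49ca30398a418820, 0xffb7aef338bda72ad2307b96a6b1283986229020,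
     0xf7f9dd6f1973d8d52d09b5e9594e1131c8510c01, 0xf7f5be7719b5e53a561173d4b6350931c4321401,
     0xce3bcdebfe8c2b49caf64a1ac5a9ee080a4188e6, 0xce37aef3fe4a16a6b1ee8c272ad2f608062290e6,
     0xc679dd6fdf8469594ed74258d52dcf0048510cc7, 0xc675be77df4254b635cf84653a56d700443214c7],
    0xcccdcdcf4c5c5c4f4c5c5c4f0c1c1c0fcddddecd4d5d5e4d4d5d5e4d0d1d1e0dcddeddcd4d5e5d4d4d5e5d4d0d1e1d0dcfcdcdcc4f5c5c4c4f5c5c4c0f1c1c0c4c4d4d4f444545474849494b041414075c5d5e5c4555564549595a49051516055c5e5d5c45565545495a5949051615054f4d4d4c474545444b494948071414044c4d4d4f4849494b44454547041414075c5d5e5c49595a4945555645051516055c5e5d5c495a594945565545051615054f4d4d4c4b49494847454544071414040c0d0d0f0405050704050507000101031c1d1e1c1415161414151614011112011c1e1d1c1416151414161514011211010f0d0d0c070505040705050403010100,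
    [0x202cf38c11480d1554504a020965871d7de5978070d36da2821a0040,
     0x204d154510c20a81a78e3cd24b0e00924145977dd71865b8071a0040,
     0x202c934511441281a7965d54530e008a20c38f7dd71865b8071a0040]⟩,
   ⟨[(0, 1), (15, 14)],
    [0xffbbcdeb38bdab49ca307b9ac5a928398a418820, 0x84719a579d94f5bb5fdf005092158d10d4b31dcf,
     0xf7ed7e7695d6e53c661173cc76348552c4342401, 0x8c2b49caf6ce3bcdebfe080a4188e64a1ac5a9ee,
     0xffb7abda72ef338ad2307b96a398626b12829020, 0x8c272ce37aad2f6ef3fe080624a16a290e66b1ee,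
     0xf7f9dd6f19b5e9594e1173d8d52d0931c8510c01, 0xf7f5bb5e53e7719a561173d4b31c436350921401,
     0xffaf6ef2b4dea72ce2307b8e66b0a45a8624a020, 0x8c338ad3bc9cb7abdbfe08128291ac1896a399ee,
     0x8469594ed7c679dd6fdf0048510cc74258d52dcf, 0x84653c675ba56d7e77df004434254b214c7635cf,
     0xffbbcbdab4deb389ca307b9ac398a45a92818820, 0xffb7aef338bda72ad2307b96a6b1283986229020,
     0xffaf6dea72ef2b4ce2307b8e65a8626b0a44a020, 0xf7f9db5e95d6f1994e1173d8d31c8552d0910c01,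
     0xf7f5be7719b5e53a561173d4b6350931c4321401, 0xf7ed7d6e53e7695c661173cc752c436348542401,
     0x8c3389cb7aad3bcbdbfe081281896a291ac399ee, 0x8c2b4ce3bc9caf6debfe080a44a1ac188e65a9ee,
     0x8c272ad2f6ce37aef3fe08062290e64a16a6b1ee, 0x8471994f5ba579db5fdf0050910d4b2158d31dcf,
     0x84695c679d94ed7d6fdf004854258d10cc752dcf, 0x84653a56d7c675be77df00443214c74254b635cf],
    0x8889898b898b8b8f0818181f181f1f0f89999a9b9a9b9e8b09191a1b1a1b1e0b899a999b9a9e9b8b091a191b1a1e1b0b8b9b9b999e9a9a890b1b1b191e1a1a09899a9a9e999b9b8b091a1a1e191b1b0b8b9b9e9a9b999a890b1b1e1a1b191a098b9e9b9a9b9a99890b1e1b1a1b1a19098f8b8b898b8989880f1f1f181f1818080809090b090b0b0f000101030103030718191a1b1a1b1e1f0111121312131603181a191b1a1e1b1f01121113121613031f1b1b191e1a1a180313131116121201181a1a1e191b1b1f01121216111313031f1b1e1a1b191a1803131612131112011f1e1b1a1b1a191803161312131211010f0b0b090b0909080703030103010100,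
    []⟩,
   ⟨[(0, 1), (30, 31)],
    [0xffbbcdeb38bdab49ca307b9ac5a928398a418820, 0x8230292b44a3386b3bc18a7239af65ab7a7bbfe,
     0xffb7abda727b96a39862ef338ad2306b12829020, 0xffaf67b8e6ef2b46b0a4dea725a862ce2304a020,
     0xff9eeef1acde96ace128bd8e6ad0a49c8628c020, 0x80a48c2b4188e69caf64a1acce3bc5a9eedebfe,
     0x81281896a291ac399ee8c3389cb7aad3bcbdbfe, 0x80624a16a8c272ce37a290e66b1eead2f6ef3fe,
     0xf7f9dd6f1973d8d52d09b5e9594e1131c8510c01, 0xf7f5bb5e53e7719a561173d4b31c436350921401,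
     0xf7dcfe758dd6d4bc6509b5cc7a548594c4384401, 0x61110e532169531ed74271952f5b6379d73fdf,
     0x509847192158da579d10d4b94f5b31dcfb5fdf, 0x4434254b84653c675b214c7635cfa56d7e77df,
     0xf7f5bb5e5373d4b31c43e7719a56116350921401, 0xf7ed773cc7e769563485d6e5352c43c661142401,
     0x4858469510cc794ed74258dc679d52dcfd6fdf, 0x443214c74254b635cf84653a56d7c675be77df,
     0xffb7abda72ef338ad2307b96a398626b12829020, 0xf7dcfd6d4bb5cc794c43e758dc6509a548584401,
     0x81288c338291acad3bc1896a9cb7a399eebdbfe, 0xffaf67b8e6dea725a862ef2b46b0a4ce2304a020,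
     0xff9eede96abd8e69c862ef1acce128ad0a48c020, 0xf7f9d73d8dd6f1952d09b5e9531c8594e1110c01,
     0x8062290e64a16a6b1ee8c272ad2f6ce37aef3fe, 0x61121695427196379d10e5331ed752f5b73fdf,
     0x6112169510e5331ed7427196379d52f5b73fdf, 0xffbbcbdab47b9ac398a4deb389ca305a92818820,
     0xffbbc7b9acdeb385a928bdab4398a49ca3018820, 0xffb7aef338bda72ad2307b96a6b1283986229020,
     0xffaf6ef2b47b8e66b0a4dea72ce2305a8624a020, 0xff9eede96aef1acce128bd8e69c862ad0a48c020,
     0xf7f5be7719b5e53a561173d4b6350931c4321401, 0xf7ed7e769573cc763485d6e53c661152c4342401,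
     0xf7ed773cc7d6e5352c43e769563485c661142401, 0xf7dcfd6d4be758dc6509b5cc794c43a548584401,
     0x82304a33818a725ab7a292b46b3bc39af67bbfe, 0x823018a724a3385ab7a292b439af66b3bc7bbfe,
     0x8128291ac1896a399ee8c338ad3bc9cb7abdbfe, 0x80a44a1ac8c2b4ce3bc188e65a9ee9caf6debfe,
     0x80a4188e68c2b49caf64a1ac5a9eece3bcdebfe, 0x80628c272290e6ad2f64a16ace37a6b1eeef3fe,
     0x50910d4b8471994f5b2158d31dcfa579db5fdf, 0x4854258d84695c679d10cc752dcf94ed7d6fdf,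
     0x48510cc74258d52dcf8469594ed7c679dd6fdf, 0x44384653214c7a56d74254bc675b635cfe77df,
     0xf7f9dd6f19b5e9594e1173d8d52d0931c8510c01, 0xf7f9db5e9573d8d31c85d6f1994e1152d0910c01,
     0x6114271910e5352f5b216956379d31ed773fdf, 0x5092158d10d4b31dcf84719a579d94f5bb5fdf],
    0x1010301030307010303070307070f01111213121316171213161716171e07011211131216131712161317161e17070313133316353513163535133c16160301121216111313171216161e13171707031316351333351316353c16351316030316133513353313163c35163516130307171713171313111e16161216121201011212161216161e11131317131717070313163516353c16133335133513160303161335163c35161335331335161303071717131e16161217131311161212010316163c13353516133535163313130307171e16171316121713161213111201071e17161716131217161312131211010f070703070303010703030103010100,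
    []⟩,
   ⟨[(0, 1), (6, 4)],
    [0xffbbcdeb38bdab49ca307b9ac5a928398a418820, 0xde758ff7dc9c650bd6d45a5487b5cc18440394c4,
     0xffbbcdeb387b9ac5a928bdab49ca30398a418820, 0xde758ff7dc5a5487b5cc9c650bd6d418440394c4],
    0xcdddfded5d4d6d7d5d4d6d7d0d1d3d2dccdcedec5c4c6c7c5c4c6c7c0c1c3c2ccededddc5e4e6e7e5e4e6e7e0e1e3e2ecfcecdcc5f4f6f7f5f4f6f7f0f1f3f2f7f7e7d7c5444647458486878041434246f6e6d6c5545656459496968051535255f5e5d5c574755545b4b5958071737274f4e4d4c474645444b4a4948061636267f7e7d7c5848687854446474041434246f6e6d6c5949696855456564051535255f5e5d5c5b4b595857475554071737274f4e4d4c4b4a494847464544061636263f3e3d3c3736353437363534011131212f2e2d2c2726252427262524001021201f1e1d1c1716151417161514021211100f0e0d0c070605040706050403020100,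
    [0x2041471e68a8086196df7554530e00925971c534c38f2c98041a0040,
     0x2021871e5928105154535df7596da2a00831c534c38f2c98041a0040,
     0x2039e69865b4d781651c75f3e01c55514120832ca20934c8041a0040,
     0x202cf1c555141480d30e29a6d34a020965871d7de5978041a0043080,
     0x204115453492ca80830e3c70e00924d759471d7de69b6588041a0040,
     0x202092cf1d75928104530e008a38c34555471d7de69b6588041a0040,
     0x2041471e38a81a6df3cd30824b0c71600925974d155d6588041a0040,
     0x2020c7144114d281a6df3cd24b0c716008a39e59755d6588041a0040,
     0x2020c3455518104930cb26008a38f1d759471d7de69b6588041a0040,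
     0x2020c7145928104530cb26008a38f3451d755d7de69b6588041a0040,
     0x202093451c34d181051c30e3cb2a009259755d7de69b6588041a0040,
     0x202093451d759281051c30e3cb2a00834d155d7de69b6588041a0040,
     0x2065141208a81a6d30c714d3082602cf39e7dd7188045155d61a0040,
     0x204d154534c2092ca81a78e3c70e00924145977dd71865b8041a0040,
     0x202c93455544114d281a7965c70e008a20c38f7dd71865b8041a0040,
     0x202cf38c71441281345514d2482a00831d759e7dd65869b8041a0040,
     0x203455514c308a81a4905165c73cb26020c39e7dd71865b8041a0040,
     0x206514c308a81a4965c714d30e3cb26021841455d71e7db8041a0040,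
     0x207145451c308a81a78e3cb26020c35d7d75924d141865b8041a0040,
     0x202ca0834d141881a49651514d26020c38f1d77de71d65b8041a0040,
     0x202cf1d75924188194530c22a020934555471d7de69b80430e1a0040,
     0x2034920a2c34d75948151473ce32009241165869b7de71d8041a0040,
     0x2038c2092db4d781651514d3e01c308a69241165871d7de8041a0040]⟩,
   ⟨[(0, 1), (12, 14)],
    [0xffbbcdeb38bdab49ca307b9ac5a928398a418820, 0x9c650bd6d4de758ff7dc18440394c45a5487b5cc,
     0xffbbcbdab4deb389ca307b9ac398a45a92818820, 0x9c650de758bd6d4ff7dc184405a548394c47b5cc],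
    0x98999b9a9b9a9e9f919092939293979688898b8a8b8a8e8f8180828382838786a8a9abaaadacaeafa1a0a2a3a4a5a7a6afaeabaaadaca9a8a7a6a3a2a5a4a1a0a8a9adacabaaaeafa1a0a4a5a2a3a7a6afaeadacabaaa9a8a7a6a5a4a3a2a1a09f9e9b9a9b9a999897969392939291908f8e8b8a8b8a8988878683828382818008090b0a0b0a0e0f010002030203070618191b1a1b1a1e1f111012131213171638393b3a3d3c3938313032323434313028292b2a2d2c2928212022222424212038393d3c3b3a3938313034343232313028292d2c2b2a292821202424222221201f1e1b1a1b1a191817161312131211100f0e0b0a0b0a09080706030203020100,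
    [0x2055d34920a08681679a6df3cb0c71601147186514124d780e320040,
     0x201c32c965d71481679f3cd16010608a21869b4d241155780e320040,
     0x201cf7de7148157596cb0c21a010534920a6984114d259780e320040,
     0x201cf34965880b0d35d652008610555141269b7de71d80e288320040]⟩,
   ⟨[(0, 1), (30, 28)],
    [0xffbbcdeb38bdab49ca307b9ac5a928398a418820, 0x184409c650394c4bd6d45a548de7587b5ccff7dc,
     0xffbbcbdab47b9ac398a4deb389ca305a92818820, 0xffbbc7b9acdeb385a928bdab4398a49ca3018820,
     0x184405a5489c650de758394c47b5ccbd6d4ff7dc, 0x18440394c45a5487b5cc9c650bd6d4de758ff7dc,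
     0xffbbcdeb387b9ac5a928bdab49ca30398a418820, 0xffbbcbdab4deb389ca307b9ac398a45a92818820,
     0xffbbc7b9acbdab4398a4deb385a9289ca3018820, 0x184409c6505a548de758394c4bd6d47b5ccff7dc,
     0x184405a548394c47b5cc9c650de758bd6d4ff7dc, 0x18440394c49c650bd6d45a5487b5ccde758ff7dc],
    0x111312131216171312161716171f1e10010302030206070302060706070e1e00212322234246272342462726878717003133323352563623525636269686160021234243222627234246878627271700313352533236362352569686362616007173727372733323d2d35343534313006162726272623222d2c2524252421200212342434246878322262726272717003133525352569683323636263626160071737273d2d35343727333235343130061627262d2c2524272623222524212007173d2d37273534372735343332313006162d2c2726252427262524232221200e1e17161716131217161312131211100f0e0706070603020706030203020100,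
    [0x2054510c38a8196da60824b3c71a035d7d75944114d281c7a0043080]⟩]

set_option maxHeartbeats 4000000 in
theorem twoEdges_check : ∀ c ∈ twoEdges, c.checkFive = true := by
  simp only [twoEdges, List.mem_cons, List.not_mem_nil, or_false, forall_eq_or_imp, forall_eq]
  refine ⟨?_, ?_, ?_, ?_, ?_, ?_, ?_⟩ <;> decide +kernel

/-- Tables of automorphisms that preserve the edge `{0, 1}`. -/
def secondTabs : List ℕ :=
  [0xffbbcdeb38bdab49ca307b9ac5a928398a418820, 0xffb7abda727b96a39862ef338ad2306b12829020,
   0xffb7a7b96aef3386b128bda7239862ad23029020, 0xff9eeef1acde96ace128bd8e6ad0a49c8628c020,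
   0xf7ed7e769573cc763485d6e53c661152c4342401, 0xf7ed773cc7e769563485d6e5352c43c661142401,
   0xf7f9dd6f19b5e9594e1173d8d52d0931c8510c01, 0xf7f5bb5e5373d4b31c43e7719a56116350921401,
   0xffbbcbdab47b9ac398a4deb389ca305a92818820, 0xf7f9db5e9573d8d31c85d6f1994e1152d0910c01,
   0xffbbc7b9acdeb385a928bdab4398a49ca3018820, 0xf7f9d73d8dd6f1952d09b5e9531c8594e1110c01,
   0xffb7aef338bda72ad2307b96a6b1283986229020, 0xf7f5be7719b5e53a561173d4b6350931c4321401,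
   0xf7f5bb5e53e7719a561173d4b31c436350921401, 0xffaf6ef2b47b8e66b0a4dea72ce2305a8624a020,
   0xffaf6dea72ef2b4ce2307b8e65a8626b0a44a020, 0xffaf67b8e6dea725a862ef2b46b0a4ce2304a020,
   0xf7ed773cc7d6e5352c43e769563485c661142401, 0xf7dcfe758dd6d4bc6509b5cc7a548594c4384401,
   0xf7dcfd6d4be758dc6509b5cc794c43a548584401, 0xff9eede96abd8e69c862ef1acce128ad0a48c020,
   0xf7dcfd6d4bb5cc794c43e758dc6509a548584401, 0xff9eebd8e6ef1acad0a4de96a9c862ce1288c020]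

/-- Two disjoint edges can be moved to the fixed edges of a configuration. -/
theorem exists_twoEdges {e : Pair} (he : Odd5 e) (hedge : isEdge e = true) (h : Apart (0, 1) e) :
    ∃ c ∈ twoEdges, c.checkTabs = true ∧ c.fixed.length = 2 ∧ c.fixed.countP isEdge = 2 ∧
      ∃ g, IsAut 5 g ∧ SameSys ([(0, 1), e].map (mapPair g)) c.fixed := by
  have hconf : ∀ c ∈ twoEdges, c.checkTabs = true ∧ c.fixed.length = 2 ∧
      c.fixed.countP isEdge = 2 ∧ ∀ p ∈ c.fixed, p.1 < 32 ∧ p.2 < 32 ∧ par p.1 ≠ par p.2 := by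
    decide +kernel
  have hcheck : sel (allL (fun P => checkAut 5 P) secondTabs) (allN 256 fun i => forceP (pair5 i)
      fun e => sel (isEdge e) (sel (apart (0, 1) e) (anyL (fun P => anyL (fun c : Config =>
        decide ([code5 (appP P (0, 1)), code5 (appP P e)].Perm (c.fixed.map code5))) twoEdges)
          secondTabs) true) true) false = true := by
    decide +kernel
  rw [sel_false_right, allL_iff, allN_iff] at hcheck
  obtain ⟨h1, h2⟩ := hcheck
  obtain ⟨hlt, hs, -⟩ := code5_spec he
  have := h2 _ hlt
  rw [forceP_eq, hs.isEdge, hedge, apart_iff.2 (h.congr (.refl _) hs), sel_true, sel_true,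
    anyL_iff] at this
  obtain ⟨P, hP, hc⟩ := this
  obtain ⟨c, hc, hperm⟩ := anyL_iff.1 hc
  obtain ⟨k1, k2, k3, k4⟩ := hconf c hc
  have haut := isAut_of_check (h1 P hP)
  refine ⟨c, hc, k1, k2, k3, app P, haut, sameSys_of_code5 (fun q hq => ?_) k4 ?_⟩
  · obtain ⟨p, hp, rfl⟩ := List.mem_map.1 hq
    refine Odd5.map haut ?_
    simp only [List.mem_cons, List.not_mem_nil, or_false] at hp
    rcases hp with rfl | rfl
    · exact ⟨by norm_num, by norm_num, by decide⟩
    · exact he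
  · rw [decide_eq_true_iff, show appP P = mapPair (app P) from rfl,
      code5_congr (he.map haut) (hs.mapPair _)] at hperm
    exact hperm

/-- Five pairs of vertices of `Q 5`, two of them edges, are joined by a path system if they do not
enclose a vertex. -/
theorem linked_of_two_edges {L : List Pair} (hL : Valid 5 L) (hn : NoEnc 5 L)
    (hlen : L.length = 5) (hedges : 2 ≤ L.countP isEdge) : Linked 5 L := by
  obtain ⟨a, M, hM, ha⟩ := exists_perm_edge (show 0 < L.countP isEdge by omega)
  rw [hM.length_eq, List.length_cons] at hlen
  rw [hM.countP_eq, List.countP_cons_of_pos ha] at hedges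
  refine Linked.perm hM.symm ?_
  replace hL := (SameSys.of_perm hM).valid hL
  replace hn := (SameSys.of_perm hM).noEnc hn
  clear hM
  obtain ⟨b, N, hN, hb⟩ := exists_perm_edge (show 0 < M.countP isEdge by omega)
  rw [hN.length_eq, List.length_cons] at hlen
  refine Linked.perm (hN.symm.cons a) ?_
  replace hL := (SameSys.of_perm (hN.cons a)).valid hL
  replace hn := (SameSys.of_perm (hN.cons a)).noEnc hn
  obtain ⟨p, q, r, rfl⟩ := List.length_eq_three.1 (show N.length = 3 by omega)
  clear hN hlen hedges
  have oa : Odd5 a := hL.1 a (by simp)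
  have ob : Odd5 b := hL.1 b (by simp)
  obtain ⟨g, hg, hga⟩ := exists_aut_edge oa ha
  have hap := (Apart.map hg ((List.pairwise_cons.1 (pairwise_apart hL.2)).1 b (by simp))
    ⟨oa.1, oa.2.1⟩ ⟨ob.1, ob.2.1⟩)
  rw [hga] at hap
  obtain ⟨c, hc, htabs, hlen, hedges, h, hh, hfix⟩ :=
    exists_twoEdges (ob.map hg) ((isEdge_mapPair hg ob).trans hb) hap
  have haut := hh.comp hg
  have hsame : SameSys ([a, b, p, q, r].map (mapPair (h ∘ g)))
      (c.fixed ++ [mapPair (h ∘ g) p, mapPair (h ∘ g) q, mapPair (h ∘ g) r]) := by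
    refine SameSys.append (L := [mapPair (h ∘ g) a, mapPair (h ∘ g) b]) ?_ (.refl _)
    rw [← hga] at hfix
    exact hfix
  refine Linked.of_map_same haut hL hsame (Config.linked htabs (allow := fun _ => true)
    (K := NoEnc 5) (fun _ _ _ _ => rfl) (fun _ _ _ _ _ _ => rfl) (fun _ _ h => h.noEnc)
    (fun g hg L hL hn => hn.map hL hg) (fun i j k h hn =>
      Config.linked_of_checkFive (twoEdges_check c hc) hlen hedges h hn)
    (hsame.valid (hL.map haut)) (hsame.noEnc (hn.map hL haut)) rfl rfl rfl)

/-! ### Splitting a pair -/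

/-- The neighbours of a vertex of `Q 5`. -/
def nbrs (v : ℕ) : Finset ℕ := (Finset.range 5).image fun i => v ^^^ 2 ^ i

theorem mem_nbrs {u v : ℕ} : u ∈ nbrs v ↔ ∃ i < 5, u = v ^^^ 2 ^ i := by
  simp [nbrs, eq_comm]

theorem card_nbrs (v : ℕ) : (nbrs v).card = 5 := by
  rw [nbrs, Finset.card_image_of_injective, Finset.card_range]
  intro i j h
  exact Nat.pow_right_injective le_rfl (Nat.xor_right_injective h)

/-- Two different vertices have at most two common neighbours. -/
theorem card_nbrs_inter {v w : ℕ} (hv : v < 32) (hw : w < 32) (hvw : v ≠ w) :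
    (nbrs v ∩ nbrs w).card ≤ 2 := by
  have : ∀ v < 32, ∀ w < 32, v ≠ w → (nbrs v ∩ nbrs w).card ≤ 2 := by decide +kernel
  exact this v hv w hw hvw

/-- Adding a suitable neighbour of `v` to a set of at most four vertices does not produce a set that
contains all neighbours of a vertex other than `v`. If adding `u` does, for the vertex `γ`, then the
set consists of four neighbours of `γ`; hence `γ` is unique, and one may add a vertex which is not
adjacent to `γ`. -/
theorem exists_nbr {S : Finset ℕ} (hS : S.card ≤ 4) {v : ℕ} (hv : v < 32) :
    ∃ u ∈ nbrs v, u ∉ S ∧ ∀ γ < 32, γ ≠ v → ¬ nbrs γ ⊆ insert u S := by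
  by_contra! hc
  have hsub : ∀ u γ, nbrs γ ⊆ insert u S → u ∈ nbrs γ ∧ S ⊆ nbrs γ ∧ S.card = 4 := by
    intro u γ h
    have h1 := Finset.card_insert_le u S
    have h2 := Finset.eq_of_subset_of_card_le h (by rw [card_nbrs]; omega)
    have h3 := card_nbrs γ
    rw [h2] at h3
    exact ⟨h2 ▸ Finset.mem_insert_self _ _, h2 ▸ Finset.subset_insert _ _, by omega⟩
  obtain ⟨u, hu, huS⟩ := Finset.exists_mem_notMem_of_card_lt_card
    (show S.card < (nbrs v).card by rw [card_nbrs]; omega)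
  obtain ⟨γ, hγ, hγv, h⟩ := hc u hu huS
  obtain ⟨-, h1, h2⟩ := hsub u γ h
  obtain ⟨u', hu', hu'γ⟩ := Finset.exists_mem_notMem_of_card_lt_card
    (show (nbrs v ∩ nbrs γ).card < (nbrs v).card by
      have := card_nbrs_inter hv hγ hγv.symm
      rw [card_nbrs]
      omega)
  have hu'γ' : u' ∉ nbrs γ := fun h => hu'γ (Finset.mem_inter.2 ⟨hu', h⟩)
  obtain ⟨γ', hγ', -, h'⟩ := hc u' hu' fun h => hu'γ' (h1 h)
  obtain ⟨h3, h4, -⟩ := hsub u' γ' h'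
  have h5 := Finset.card_le_card (Finset.subset_inter h1 h4)
  have := card_nbrs_inter hγ hγ' fun e => hu'γ' (e ▸ h3)
  omega

/-- Each odd pair contributes one vertex of each parity. -/
theorem card_filter_vertsOf {L : List Pair} (hL : ∀ p ∈ L, par p.1 ≠ par p.2) (c : ℕ) :
    ((vertsOf L).filter fun v => par v = c).toFinset.card ≤ L.length := by
  refine (List.toFinset_card_le _).trans ?_
  rw [← List.countP_eq_length_filter]
  induction L with
  | nil => simp [vertsOf]
  | cons p L ih =>
    rw [vertsOf_cons, List.countP_cons, List.countP_cons, List.length_cons]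
    have := ih fun q hq => hL q (by simp [hq])
    have hp := hL p (by simp)
    by_cases h1 : par p.1 = c
    · rw [decide_eq_true h1, decide_eq_false fun h2 => hp (h1.trans h2.symm)]
      simpa using this
    · rw [decide_eq_false h1]
      by_cases h2 : par p.2 = c <;> simp [h2] <;> omega

/-- A pair can be split into an edge and another pair, so that the resulting list of at most five
pairs does not enclose a vertex. -/
theorem exists_split {p : Pair} {L : List Pair} (hv : Valid 5 (p :: L)) (hlen : L.length ≤ 3) :
    ∃ u v, isEdge (p.1, u) = true ∧ Adj u v ∧ Valid 5 ((p.1, u) :: (v, p.2) :: L) ∧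
      NoEnc 5 ((p.1, u) :: (v, p.2) :: L) := by
  obtain ⟨hp1, hp2, hp⟩ := hv.1 p (by simp)
  have hpar : ∀ q ∈ p :: L, par q.1 ≠ par q.2 := fun q hq => (hv.1 q hq).2.2
  have hc := fun c => (card_filter_vertsOf hpar c).trans (show L.length + 1 ≤ 4 by omega)
  obtain ⟨u, hu, huS, hu'⟩ := exists_nbr (hc (par p.2)) hp1
  obtain ⟨i, hi, rfl⟩ := mem_nbrs.1 hu
  have hu32 := xor_two_pow_lt hp1 hi
  have hup := par_xor_two_pow hp1 hi
  have huadj := adj_xor_two_pow p.1 i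
  set u := p.1 ^^^ 2 ^ i
  obtain ⟨v, hv', hvS, hv''⟩ := exists_nbr (hc (par p.1)) hu32
  obtain ⟨j, hj, rfl⟩ := mem_nbrs.1 hv'
  have hv32 := xor_two_pow_lt hu32 hj
  have hvp := par_xor_two_pow hu32 hj
  have hvadj := adj_xor_two_pow u j
  set v := u ^^^ 2 ^ j
  have l1 := par_lt p.1
  have l2 := par_lt p.2
  have l3 := par_lt u
  have l4 := par_lt v
  have huW : u ∉ vertsOf (p :: L) := fun h => huS (by
    rw [List.mem_toFinset, List.mem_filter, decide_eq_true_iff]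
    exact ⟨h, by omega⟩)
  have hvW : v ∉ vertsOf (p :: L) := fun h => hvS (by
    rw [List.mem_toFinset, List.mem_filter, decide_eq_true_iff]
    exact ⟨h, by omega⟩)
  have hperm : (vertsOf ((p.1, u) :: (v, p.2) :: L)).Perm (u :: v :: vertsOf (p :: L)) := by
    simp only [vertsOf_cons]
    exact ((List.Perm.swap _ _ _).trans (.cons _ (.swap _ _ _)))
  refine ⟨u, v, adjB_of_adj hp1 hu32 huadj, hvadj, ⟨fun q hq => ?_, ?_⟩, fun w hw hwL => ?_⟩
  · rcases List.mem_cons.1 hq with rfl | hq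
    · exact ⟨hp1, hu32, hup.symm⟩
    rcases List.mem_cons.1 hq with rfl | hq
    · exact ⟨hv32, hp2, by dsimp only; omega⟩
    · exact hv.1 q (by simp [hq])
  · rw [hperm.nodup_iff, List.nodup_cons, List.nodup_cons]
    refine ⟨fun h => ?_, hvW, hv.2⟩
    rcases List.mem_cons.1 h with h | h
    · exact hvp (by rw [← h])
    · exact huW h
  · rw [hperm.mem_iff] at hwL
    have hwp1 : w ≠ p.1 := by
      rintro rfl
      exact hwL (by simp [vertsOf_cons])
    have hwu : w ≠ u := by
      rintro rfl
      exact hwL (by simp)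
    have l5 := par_lt w
    by_cases hwpar : par w = par p.1
    · obtain ⟨x, hx, hxS⟩ := Finset.not_subset.1 (hu' w hw hwp1)
      obtain ⟨k, hk, rfl⟩ := mem_nbrs.1 hx
      have hxp := par_xor_two_pow hw hk
      have l6 := par_lt (w ^^^ 2 ^ k)
      refine ⟨_, xor_two_pow_lt hw hk, adj_xor_two_pow w k, fun h => hxS ?_⟩
      rw [hperm.mem_iff, List.mem_cons, List.mem_cons] at h
      rw [Finset.mem_insert, List.mem_toFinset, List.mem_filter, decide_eq_true_iff]
      rcases h with h | h | h
      · exact Or.inl h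
      · rw [h] at hxp
        omega
      · exact Or.inr ⟨h, by omega⟩
    · obtain ⟨x, hx, hxS⟩ := Finset.not_subset.1 (hv'' w hw hwu)
      obtain ⟨k, hk, rfl⟩ := mem_nbrs.1 hx
      have hxp := par_xor_two_pow hw hk
      have l6 := par_lt (w ^^^ 2 ^ k)
      refine ⟨_, xor_two_pow_lt hw hk, adj_xor_two_pow w k, fun h => hxS ?_⟩
      rw [hperm.mem_iff, List.mem_cons, List.mem_cons] at h
      rw [Finset.mem_insert, List.mem_toFinset, List.mem_filter, decide_eq_true_iff]
      rcases h with h | h | h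
      · rw [h] at hxp
        omega
      · exact Or.inl h
      · exact Or.inr ⟨h, by omega⟩

/-! ### Four pairs -/

/-- The configuration with one fixed pair, whose ends have distance three. -/
def distThree : Config :=
  ⟨[(0, 7)],
    [0xffbbcdeb38bdab49ca307b9ac5a928398a418820, 0xc6b9ecefbf84a968ceb74298e4adaf0088608ca7,
     0xfefdaee7987adca6a588bced2ac69038cc228480, 0xc675be77df4254b635cf84653a56d700443214c7,
     0xff779f7358bd671b52507b569731483946131040, 0xc733dd7b7f8523595a774312d5396f0102511867,
     0xc675be77df84653a56d74254b635cf00443214c7, 0xffb7aef3387b96a6b128bda72ad2303986229020,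
     0xfefdaee798bced2ac6907adca6a58838cc228480, 0xc6b9ecefbf4298e4adaf84a968ceb70088608ca7,
     0xc733dd7b7f4312d5396f8523595a770102511867, 0xff779f73587b56973148bd671b52503946131040,
     0xffbbcdeb387b9ac5a928bdab49ca30398a418820, 0xc679dd6fdf8469594ed74258d52dcf0048510cc7,
     0xff7dcde758bd6d49c6507b5cc5a548394c418440, 0xc6b3be7bbf84a33a5ab74292b639af00823218a7,
     0xfefb9f6b98bceb1b4a907ada97298838ca130880, 0xc735ecf77f852568d6774314e4b56f0104609467,
     0xffb7aef338bda72ad2307b96a6b1283986229020, 0xc679dd6fdf4258d52dcf8469594ed70048510cc7,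
     0xff7dcde7587b5cc5a548bd6d49c650394c418440, 0xc6b3be7bbf4292b639af84a33a5ab700823218a7,
     0xfefb9f6b987ada972988bceb1b4a9038ca130880, 0xc735ecf77f4314e4b56f852568d6770104609467],
    0xccccccfc4c5c5c5c4c5c5c5c0c0c0c3ccdcdcfcc4d5d5e5e4d5d5e5e0d0d0f3dcdcfcdcc4d5e5d5e4d5e5d5e0d0f0d3dcfcdcdcc4d5e5e5d4d5e5e5d0f0d0d3d5d5e5e5c445454564858585a040505345e5d5e5c4454565448585a58050405345e5e5d5c44565454485a5858050504344d4d4d4c474444444b484848070707375d5e5e5c4858585a44545456040505345e5d5e5c48585a5844545654050405345e5e5d5c485a585844565454050504344d4d4d4c4b48484847444444070707373d3d3d3c3734343437343434000000300d0d0f0c0704050507040505010103000d0f0d0c0705040507050405010301000f0d0d0c070505040705050403010100,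
    []⟩

/-- The configuration with one fixed pair, whose ends are antipodal; only the identity is used as an
automorphism. -/
def distFive : Config :=
  ⟨[(0, 31)], [xorTab 0],
    0xfffefdfcfbfaf9f8f7f6f5f4f3f2f1f0efeeedecebeae9e8e7e6e5e4e3e2e1e0dfdedddcdbdad9d8d7d6d5d4d3d2d1d0cfcecdcccbcac9c8c7c6c5c4c3c2c1c0bfbebdbcbbbab9b8b7b6b5b4b3b2b1b0afaeadacabaaa9a8a7a6a5a4a3a2a1a09f9e9d9c9b9a999897969594939291908f8e8d8c8b8a898887868584838281807f7e7d7c7b7a797877767574737271706f6e6d6c6b6a696867666564636261605f5e5d5c5b5a595857565554535251504f4e4d4c4b4a494847464544434241403f3e3d3c3b3a393837363534333231302f2e2d2c2b2a292827262524232221201f1e1d1c1b1a191817161514131211100f0e0d0c0b0a09080706050403020100,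
    []⟩

/-- The check of a configuration with one fixed pair. -/
def Config.checkFour (c : Config) (allow : Pair → Bool) (easy : List Pair → Bool) : Bool :=
  c.checkRows allow fun p k => splits (p :: c.fixed) fun S => k fun j R => forceP (pair5 j) fun q =>
    drain (c.leaf easy S p q) 8 0 R

theorem Config.linked_of_checkFour {c : Config} {allow : Pair → Bool} {easy : List Pair → Bool}
    (hc : c.checkFour allow easy = true) {i j k : ℕ} (h : c.Canonical allow i j k) :
    easy (pair5 i :: pair5 j :: pair5 k :: c.fixed) = true ∨
      Linked 5 (c.fixed ++ [pair5 i, pair5 j, pair5 k]) := by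
  obtain ⟨S, hS, hsplits⟩ := splits_spec (pair5 i :: c.fixed)
  obtain ⟨R, hR, htest⟩ := h.test hc (fun f => hsplits _)
  rw [forceP_eq] at htest
  have hleaf := drain_spec htest (show k < 2 ^ 8 from h.lt_k) hR
  rw [Nat.zero_add] at hleaf
  exact Config.linked_of_leaf h.valid hS hleaf

/-- The inner edges of the six paths of length three from `0` to `7`. -/
def innerEdges : List (ℕ × ℕ) := [(1, 3), (1, 5), (2, 3), (2, 6), (4, 5), (4, 6)]

/-- The pair `(0, 7)` of the list `L` can be split into two edges, so that no vertex is enclosed. -/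
def splitsWell (L : List Pair) : Bool :=
  force (vertMask L) fun m => anyL (fun e => sel (hasBit m e.1) false (sel (hasBit m e.2) false
    (sel (encloses (Nat.lor m (Nat.lor (single e.1) (single e.2)))) false true))) innerEdges

/-- After the pair `{0, 7}` is split along an inner edge, there are five pairs, two of them edges.
-/
theorem linked_of_splitsWell {p q r : Pair} (hv : Valid 5 [(0, 7), p, q, r])
    (h : splitsWell [p, q, r, (0, 7)] = true) : Linked 5 [(0, 7), p, q, r] := by
  have hsel : ∀ c b : Bool, sel c false b = true ↔ c = false ∧ b = true := by decide
  rw [splitsWell, force_eq, anyL_iff] at h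
  obtain ⟨e, he, h⟩ := h
  rw [hsel, hsel, hsel] at h
  obtain ⟨h1, h2, h3, -⟩ := h
  have hmem : ∀ {v}, hasBit (vertMask [p, q, r, (0, 7)]) v = true ↔ v ∈ vertsOf [(0, 7), p, q, r] := by
    intro v
    rw [hasBit_vertMask]
    exact (vertsOf_perm (List.perm_append_comm (l₁ := [p, q, r]) (l₂ := [(0, 7)]))).mem_iff
  have n1 : e.1 ∉ vertsOf [(0, 7), p, q, r] := fun h => by
    rw [hmem.2 h] at h1
    exact absurd h1 (by simp)
  have n2 : e.2 ∉ vertsOf [(0, 7), p, q, r] := fun h => by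
    rw [hmem.2 h] at h2
    exact absurd h2 (by simp)
  have hprop : ∀ e ∈ innerEdges, isEdge (0, e.1) = true ∧ isEdge (e.2, 7) = true ∧
      adjB e.1 e.2 = true ∧ e.1 < 32 ∧ e.2 < 32 ∧ par 0 ≠ par e.1 ∧ par e.2 ≠ par 7 ∧
      e.1 ≠ e.2 := by decide
  obtain ⟨k1, k2, k3, k4, k5, k6, k7, k8⟩ := hprop e he
  have hperm : (vertsOf [(0, e.1), (e.2, 7), p, q, r]).Perm
      (e.1 :: e.2 :: vertsOf [(0, 7), p, q, r]) := by
    simp only [vertsOf_cons]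
    exact ((List.Perm.swap _ _ _).trans (.cons _ (.swap _ _ _)))
  refine Linked.merge (adj_of_adjB k3) (linked_of_two_edges ⟨?_, ?_⟩ ?_ rfl ?_)
  · have := hv.1
    simp only [List.mem_cons, List.not_mem_nil, or_false, forall_eq_or_imp, forall_eq] at this ⊢
    exact ⟨⟨by norm_num, k4, k6⟩, ⟨k5, by norm_num, k7⟩, this.2⟩
  · rw [hperm.nodup_iff, List.nodup_cons, List.nodup_cons]
    refine ⟨fun h => ?_, n2, hv.2⟩
    rcases List.mem_cons.1 h with h | h
    · exact k8 h
    · exact n1 h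
  · refine (encloses_eq_false_iff fun v => ?_).1 h3
    rw [hperm.mem_iff, List.mem_cons, List.mem_cons, ← hmem, hasBit_eq, hasBit_eq]
    change Nat.testBit (vertMask [p, q, r, (0, 7)] ||| (single e.1 ||| single e.2)) v = true ↔ _
    rw [Nat.testBit_or, Nat.testBit_or, single_eq, single_eq, Nat.testBit_two_pow,
      Nat.testBit_two_pow, Bool.or_eq_true, Bool.or_eq_true, decide_eq_true_iff, decide_eq_true_iff]
    constructor
    · rintro (h | h | h)
      exacts [Or.inr (Or.inr h), Or.inl h.symm, Or.inr (Or.inl h.symm)]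
    · rintro (h | h | h)
      exacts [Or.inr (Or.inl h.symm), Or.inr (Or.inr h.symm), Or.inl h]
  · rw [List.countP_cons_of_pos k1, List.countP_cons_of_pos k2]
    omega

/-- The pair is not an edge. -/
def nonEdge (p : Pair) : Bool := sel (isEdge p) false true

/-- The ends of the pair are antipodal. -/
def antipodal (p : Pair) : Bool := Nat.beq (Nat.xor p.1 p.2) 31

theorem nonEdge_iff {p : Pair} : nonEdge p = true ↔ isEdge p = false := by
  unfold nonEdge
  cases isEdge p <;> simp

theorem distThree_check : distThree.checkTabs = true ∧
    distThree.checkFour nonEdge splitsWell = true := by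
  constructor <;> decide +kernel

theorem distFive_check : distFive.checkTabs = true ∧
    distFive.checkFour antipodal (fun _ => false) = true := by
  constructor <;> decide +kernel

/-- Four pairs of vertices of `Q 5` are joined by a path system. If one of them is an edge,
splitting another one reduces this to five pairs with two edges. Otherwise some pair has distance
three and can be moved to `{0, 7}`, or all pairs are antipodal. -/
theorem linked_four {L : List Pair} (hL : Valid 5 L) (hlen : L.length = 4) : Linked 5 L := by
  have hodd : ∀ p ∈ L, Odd5 p := hL.1
  by_cases hedge : ∃ p ∈ L, isEdge p = true
  · obtain ⟨e, he, hedge⟩ := hedge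
    have hp := List.perm_cons_erase he
    have hlen' := hp.length_eq
    rw [hlen, List.length_cons] at hlen'
    obtain ⟨p, q, r, hM⟩ := List.length_eq_three.1 (show (L.erase e).length = 3 by omega)
    rw [hM] at hp
    replace hp := hp.trans (.swap p e _)
    refine Linked.perm hp.symm ?_
    obtain ⟨u, v, h1, h2, h3, h4⟩ := exists_split ((SameSys.of_perm hp).valid hL) le_rfl
    refine Linked.merge h2 (linked_of_two_edges h3 h4 rfl ?_)
    rw [List.countP_cons_of_pos h1]
    have := List.countP_pos_iff (p := isEdge) (l := [(v, p.2), e, q, r]).2 ⟨e, by simp, hedge⟩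
    omega
  have hnon : ∀ p ∈ L, nonEdge p = true := fun p hp =>
    nonEdge_iff.2 (Bool.eq_false_iff.2 fun h => hedge ⟨p, hp, h⟩)
  by_cases hthree : ∃ p ∈ L, ∃ g, IsAut 5 g ∧ mapPair g p = (0, 7)
  · obtain ⟨e, he, g, hg, hge⟩ := hthree
    have hp := List.perm_cons_erase he
    have hlen' := hp.length_eq
    rw [hlen, List.length_cons] at hlen'
    obtain ⟨p, q, r, hM⟩ := List.length_eq_three.1 (show (L.erase e).length = 3 by omega)
    rw [hM] at hp
    have hsame : SameSys (L.map (mapPair g))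
        (distThree.fixed ++ [mapPair g p, mapPair g q, mapPair g r]) := by
      have := hp.map (mapPair g)
      rw [List.map_cons, hge] at this
      exact .of_perm this
    have hmap : ∀ {g}, IsAut 5 g → ∀ p, Odd5 p → nonEdge p = true → nonEdge (mapPair g p) = true :=
      fun hg p hp h => by
        rw [nonEdge_iff] at h ⊢
        rw [isEdge_mapPair hg hp, h]
    have hall : ∀ f ∈ [p, q, r], nonEdge (mapPair g f) = true := fun f hf => by
      have := hp.symm.subset (List.mem_cons_of_mem e hf)
      exact hmap hg f (hodd f this) (hnon f this)
    refine Linked.of_map_same hg hL hsame (Config.linked distThree_check.1 (allow := nonEdge)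
      (K := fun _ => True) (fun p q _ h => ?_) (fun _ _ hP => hmap hP) (fun _ _ _ _ => trivial)
      (fun _ _ _ _ _ => trivial) (fun i j k h _ => ?_) (hsame.valid (hL.map hg)) trivial
      (hall p (by simp)) (hall q (by simp)) (hall r (by simp)))
    · unfold nonEdge
      rw [h.isEdge]
    · rcases Config.linked_of_checkFour distThree_check.2 h with he | he
      · exact linked_of_splitsWell h.valid he
      · exact he
  have hanti : ∀ p ∈ L, p.1 ^^^ p.2 = 31 := fun p hp => by
    rcases exists_aut_pair (hodd p hp) with ⟨g, hg, h | h⟩ | h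
    · refine absurd ⟨p, hp, ?_⟩ hedge
      rw [← isEdge_mapPair hg (hodd p hp), h]
      decide
    · exact absurd ⟨p, hp, g, hg, h⟩ hthree
    · exact h
  obtain ⟨e, p, q, r, rfl⟩ : ∃ e p q r, L = [e, p, q, r] := by
    match L, hlen with
    | [e, p, q, r], _ => exact ⟨e, p, q, r, rfl⟩
  have oe : Odd5 e := hodd e (by simp)
  obtain ⟨g, hg, hgv⟩ := exists_aut_xor oe.1
  have hxor : ∀ f ∈ [e, p, q, r], (mapPair g f).1 ^^^ (mapPair g f).2 = 31 := fun f hf => by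
    obtain ⟨h1, h2, -⟩ := hodd f hf
    rw [mapPair, hgv _ h1, hgv _ h2, ← hanti f hf, Nat.xor_comm e.1 f.1, Nat.xor_assoc,
      ← Nat.xor_assoc e.1, Nat.xor_self, Nat.zero_xor]
  have hge : mapPair g e = (0, 31) := by
    refine Prod.ext ((hgv _ oe.1).trans (Nat.xor_self _)) ((hgv _ oe.2.1).trans ?_)
    exact hanti e (by simp)
  have hsame : SameSys ([e, p, q, r].map (mapPair g))
      (distFive.fixed ++ [mapPair g p, mapPair g q, mapPair g r]) := by
    rw [List.map_cons, hge]
    exact .refl _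
  have hant : ∀ {f : Pair}, antipodal f = true ↔ f.1 ^^^ f.2 = 31 := by
    intro f
    rw [antipodal, Nat.beq_eq]
    rfl
  refine Linked.of_map_same hg hL hsame (Config.linked distFive_check.1 (allow := antipodal)
    (K := fun _ => True) (fun p q _ h => ?_) (fun P hP _ f hf h => ?_) (fun _ _ _ _ => trivial)
    (fun _ _ _ _ _ => trivial) (fun i j k h _ => ?_) (hsame.valid (hL.map hg)) trivial
    (hant.2 (hxor p (by simp))) (hant.2 (hxor q (by simp))) (hant.2 (hxor r (by simp))))
  · rcases h with rfl | rfl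
    · rfl
    · unfold antipodal
      rw [show Nat.xor p.2 p.1 = Nat.xor p.1 p.2 from Nat.xor_comm _ _]
  · obtain rfl : P = xorTab 0 := by simpa [distFive] using hP
    have hid : ∀ v < 32, app (xorTab 0) v = v := by decide +kernel
    rw [hant] at h ⊢
    rw [mapPair, hid _ hf.1, hid _ hf.2.1, h]
  · rcases Config.linked_of_checkFour distFive_check.2 h with he | he
    · exact absurd he (by simp)
    · exact he

/-- At most four pairs of vertices of `Q 5` are joined by a path system: pairs are split until there
are four of them. -/
theorem linked_of_length_le_four {L : List Pair} (hL : Valid 5 L) (hne : L ≠ [])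
    (hlen : L.length ≤ 4) : Linked 5 L := by
  generalize hk : 4 - L.length = k
  induction k generalizing L with
  | zero => exact linked_four hL (by omega)
  | succ k ih =>
    obtain ⟨p, M, rfl⟩ := List.exists_cons_of_ne_nil hne
    rw [List.length_cons] at hlen hk
    obtain ⟨u, v, -, h2, h3, -⟩ := exists_split hL (by omega)
    exact Linked.merge h2 (ih h3 (by simp) (by simp; omega) (by simp; omega))

/-! ### From codes to vectors -/

/-- The code of a vector: the number whose binary digits are the coordinates. -/
def encode {n : ℕ} (α : V n) : ℕ := Nat.ofBits α

/-- The vector of the last `n` binary digits of a number. -/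
def decode (n k : ℕ) : V n := fun i => k.testBit i

theorem encode_lt {n : ℕ} (α : V n) : encode α < 2 ^ n := Nat.ofBits_lt_two_pow α

theorem decode_encode {n : ℕ} (α : V n) : decode n (encode α) = α := by
  funext i
  simp [decode, encode]

theorem encode_decode {n k : ℕ} (hk : k < 2 ^ n) : encode (decode n k) = k := by
  exact (Nat.ofBits_testBit k n).trans (Nat.mod_eq_of_lt hk)

theorem encode_injective {n : ℕ} : Function.Injective (encode (n := n)) :=
  Function.LeftInverse.injective decode_encode

theorem vxor_decode (n a b : ℕ) : vxor (decode n a) (decode n b) = decode n (a ^^^ b) := by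
  funext i
  simp [vxor, decode]

theorem decode_two_pow {n : ℕ} (i : Fin n) : decode n (2 ^ i.val) = e i := by
  funext j
  simp [decode, e, Nat.testBit_two_pow, Fin.ext_iff]

theorem adj_decode_iff {n a b : ℕ} (ha : a < 2 ^ n) (hb : b < 2 ^ n) :
    (Q n).Adj (decode n a) (decode n b) ↔ Adj a b := by
  change (∃ i : Fin n, vxor (decode n a) (decode n b) = e i) ↔ ∃ i, a ^^^ b = 2 ^ i
  have hx : a ^^^ b < 2 ^ n := Nat.xor_lt_two_pow ha hb
  constructor
  · rintro ⟨i, hi⟩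
    rw [vxor_decode, ← decode_two_pow] at hi
    refine ⟨i, ?_⟩
    rw [← encode_decode hx, hi, encode_decode (Nat.pow_lt_pow_right one_lt_two i.2)]
  · rintro ⟨i, hi⟩
    have hin : i < n := by
      rw [hi] at hx
      exact (Nat.pow_lt_pow_iff_right one_lt_two).1 hx
    exact ⟨⟨i, hin⟩, by rw [vxor_decode, hi, ← decode_two_pow]⟩

theorem adj_encode_iff {n : ℕ} {α β : V n} : Adj (encode α) (encode β) ↔ (Q n).Adj α β := by
  rw [← adj_decode_iff (encode_lt α) (encode_lt β), decode_encode, decode_encode]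

theorem parity_eq (α : V 5) : parity α = (-1) ^ par (encode α) := by
  revert α
  decide +kernel

/-- The pair of codes of an unordered pair of vectors, in an arbitrary order. -/
noncomputable def codePair {n : ℕ} (p : Sym2 (V n)) : Pair :=
  (encode (Quot.out p).1, encode (Quot.out p).2)

theorem codePair_lt {n : ℕ} (p : Sym2 (V n)) : (codePair p).1 < 2 ^ n ∧ (codePair p).2 < 2 ^ n :=
  ⟨encode_lt _, encode_lt _⟩

theorem decode_codePair {n : ℕ} (p : Sym2 (V n)) :
    s(decode n (codePair p).1, decode n (codePair p).2) = p := by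
  rw [codePair, decode_encode, decode_encode]
  exact Quot.out_eq p

theorem codePair_injective {n : ℕ} : Function.Injective (codePair (n := n)) := fun p q h => by
  rw [← decode_codePair p, h, decode_codePair]

theorem mem_iff_codePair {n : ℕ} {p : Sym2 (V n)} {α : V n} :
    α ∈ p ↔ encode α = (codePair p).1 ∨ encode α = (codePair p).2 := by
  conv_lhs => rw [← Quot.out_eq p]
  rw [codePair, encode_injective.eq_iff, encode_injective.eq_iff]
  exact Sym2.mem_iff

/-- The list of pairs of codes of a set of pairs. -/
noncomputable def codeList {n : ℕ} (A : Finset (Sym2 (V n))) : List Pair := A.toList.map codePair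

theorem length_codeList {n : ℕ} (A : Finset (Sym2 (V n))) : (codeList A).length = A.card := by
  simp [codeList]

theorem mem_codeList {n : ℕ} {A : Finset (Sym2 (V n))} {c : Pair} :
    c ∈ codeList A ↔ ∃ p ∈ A, codePair p = c := by
  simp [codeList]

theorem encode_mem_vertsOf {n : ℕ} {A : Finset (Sym2 (V n))} {α : V n} :
    encode α ∈ vertsOf (codeList A) ↔ α ∈ verts A := by
  simp only [mem_vertsOf, mem_codeList, exists_exists_and_eq_and, ← mem_iff_codePair]
  rfl

theorem par_codePair_ne {p : Sym2 (V 5)} (hp : IsOddPair p) :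
    par (codePair p).1 ≠ par (codePair p).2 := by
  obtain ⟨α, β, rfl, h⟩ := hp
  have h' : par (encode α) ≠ par (encode β) := fun hc => h (by rw [parity_eq, parity_eq, hc])
  have := decode_codePair s(α, β)
  rw [Sym2.eq_iff] at this
  rw [← encode_decode (codePair_lt s(α, β)).1, ← encode_decode (codePair_lt s(α, β)).2]
  rcases this with ⟨h1, h2⟩ | ⟨h1, h2⟩
  · rwa [h1, h2]
  · rw [h1, h2]
    exact h'.symm

theorem valid_codeList {A : Finset (Sym2 (V 5))} (hA : IsOddPairSet A) : Valid 5 (codeList A) := by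
  refine ⟨fun c hc => ?_, ?_⟩
  · obtain ⟨p, hp, rfl⟩ := mem_codeList.1 hc
    exact ⟨(codePair_lt p).1, (codePair_lt p).2, par_codePair_ne (hA.2 p hp)⟩
  · rw [vertsOf, codeList, List.flatMap_map, List.nodup_flatMap]
    constructor
    · intro p hp
      simpa using fun h => par_codePair_ne (hA.2 p (Finset.mem_toList.1 hp)) (congrArg par h)
    · refine (Finset.nodup_toList A).imp_of_mem fun {p q} hp hq hpq => ?_
      intro v hv hv'
      have hdisj := hA.1.1 p (Finset.mem_toList.1 hp) q (Finset.mem_toList.1 hq) hpq (decode 5 v)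
      have hlt : v < 2 ^ 5 := by
        simp only [List.mem_cons, List.not_mem_nil, or_false] at hv
        rcases hv with rfl | rfl <;> exact encode_lt _
      rw [mem_iff_codePair, mem_iff_codePair, encode_decode hlt] at hdisj
      exact hdisj ⟨by simpa using hv, by simpa using hv'⟩

theorem isEdge_codePair {p : Sym2 (V 5)} (hp : IsEdgePair p) : isEdge (codePair p) = true := by
  rw [IsEdgePair, ← decode_codePair p, SimpleGraph.mem_edgeSet,
    adj_decode_iff (codePair_lt p).1 (codePair_lt p).2] at hp
  exact adjB_of_adj (codePair_lt p).1 (codePair_lt p).2 hp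

theorem noEnc_codeList {n : ℕ} {A : Finset (Sym2 (V n))} (hA : enc (verts A) = ∅) :
    NoEnc n (codeList A) := by
  intro w hw hwL
  by_contra! hall
  have hmem : decode n w ∈ enc (verts A) := by
    refine ⟨fun β hβ => ?_, fun h => hwL ?_⟩
    · rw [← encode_mem_vertsOf]
      refine hall _ (encode_lt β) ?_
      rw [← encode_decode hw]
      exact adj_encode_iff.2 hβ
    · rw [← encode_decode hw]
      exact encode_mem_vertsOf.2 h
  rw [hA] at hmem
  exact hmem

theorem two_le_countP_codeList {A : Finset (Sym2 (V 5))} {p q : Sym2 (V 5)} (hp : p ∈ A)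
    (hq : q ∈ A) (hpq : p ≠ q) (hp' : IsEdgePair p) (hq' : IsEdgePair q) :
    2 ≤ (codeList A).countP isEdge := by
  rw [List.countP_eq_length_filter]
  have hsub : [codePair p, codePair q].Subperm ((codeList A).filter isEdge) := by
    refine List.subperm_of_subset (by simpa using codePair_injective.ne hpq) ?_
    simp only [List.cons_subset, List.mem_filter, mem_codeList]
    exact ⟨⟨⟨p, hp, rfl⟩, isEdge_codePair hp'⟩, ⟨⟨q, hq, rfl⟩, isEdge_codePair hq'⟩, by simp⟩
  exact hsub.length_le

/-- A path of codes, read as a path of the graph `Q n`. -/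
theorem exists_path {n : ℕ} {l : List ℕ} (hne : l ≠ []) (hc : l.IsChain Adj) (hd : l.Nodup)
    (hlt : ∀ v ∈ l, v < 2 ^ n) :
    ∃ w : (Q n).Path (decode n (ends l).1) (decode n (ends l).2),
      ∀ γ, γ ∈ w.1.support ↔ encode γ ∈ l := by
  have hne' : l.map (decode n) ≠ [] := by simpa using hne
  have hc' : (l.map (decode n)).IsChain (Q n).Adj := by
    rw [List.isChain_map]
    exact hc.imp_of_mem_imp fun a b ha hb hab => (adj_decode_iff (hlt a ha) (hlt b hb)).2 hab
  have h1 : (l.map (decode n)).head hne' = decode n (ends l).1 := by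
    rw [ends_eq hne, List.head_map]
  have h2 : (l.map (decode n)).getLast hne' = decode n (ends l).2 := by
    rw [ends_eq hne, List.getLast_map]
  have hsupp : (((SimpleGraph.Walk.ofSupport _ hne' hc').copy h1 h2).support) =
      l.map (decode n) := by
    rw [SimpleGraph.Walk.support_copy, SimpleGraph.Walk.support_ofSupport]
  refine ⟨⟨(SimpleGraph.Walk.ofSupport _ hne' hc').copy h1 h2, ?_⟩, fun γ => ?_⟩
  · rw [SimpleGraph.Walk.isPath_def, hsupp]
    refine hd.map_on fun a ha b hb hab => ?_
    rw [← encode_decode (hlt a ha), hab, encode_decode (hlt b hb)]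
  · rw [hsupp, List.mem_map]
    constructor
    · rintro ⟨a, ha, rfl⟩
      rwa [encode_decode (hlt a ha)]
    · exact fun h => ⟨_, h, decode_encode γ⟩

/-- A path system for the codes provides a connector. -/
theorem connector_of_linked {n : ℕ} {A : Finset (Sym2 (V n))} (h : Linked n (codeList A)) :
    Nonempty (Connector A) := by
  obtain ⟨P, hP, hperm, hends⟩ := h
  have hnodup : P.flatten.Nodup := hperm.nodup_iff.2 List.nodup_range
  rw [List.nodup_flatten] at hnodup
  -- Two members of the path system with a common vertex are equal.
  have huniq : ∀ l ∈ P, ∀ m ∈ P, ∀ v, v ∈ l → v ∈ m → l = m := by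
    intro l hl m hm v hvl hvm
    by_contra hlm
    have : Std.Symm (List.Disjoint (α := ℕ)) := ⟨fun _ _ h => h.symm⟩
    exact hnodup.2.forall hl hm hlm hvl hvm
  have hlt : ∀ l ∈ P, ∀ v ∈ l, v < 2 ^ n := fun l hl v hv =>
    List.mem_range.1 (hperm.subset (List.mem_flatten.2 ⟨l, hl, hv⟩))
  have hex : ∀ p : {p // p ∈ A}, ∃ l ∈ P, ends l = codePair p.1 := by
    intro p
    have : codePair p.1 ∈ P.map ends := hends ▸ mem_codeList.2 ⟨p.1, p.2, rfl⟩
    simpa using this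
  choose T hTP hT using hex
  choose W hW using fun p => exists_path (hP _ (hTP p)).1 (hP _ (hTP p)).2 (hnodup.1 _ (hTP p))
    (hlt _ (hTP p))
  have hdisj : ∀ p q : {p // p ∈ A}, p ≠ q → ∀ γ : V n,
      ¬ (γ ∈ (W p).1.support ∧ γ ∈ (W q).1.support) := by
    intro p q hpq γ hγ
    rw [hW, hW] at hγ
    have hpq' := huniq _ (hTP p) _ (hTP q) _ hγ.1 hγ.2
    exact hpq (Subtype.ext (codePair_injective (by rw [← hT p, ← hT q, hpq'])))
  refine ⟨⟨_, _, fun p => ?_, W, hdisj, fun γ => ?_⟩⟩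
  · rw [hT p, decode_codePair]
  · have hmem : encode γ ∈ P.flatten := hperm.mem_iff.2 (List.mem_range.2 (encode_lt γ))
    obtain ⟨l, hl, hγ⟩ := List.mem_flatten.1 hmem
    obtain ⟨p, hp, hpl⟩ := mem_codeList.1 (hends ▸ List.mem_map_of_mem hl :
      ends l ∈ codeList A)
    -- The path chosen for `p` starts at the same vertex as `l`, so it is `l`.
    have hTl : T ⟨p, hp⟩ = l := by
      refine huniq _ (hTP _) _ hl (ends l).1 ?_ ?_
      · rw [← hpl, ← hT ⟨p, hp⟩, ends_eq (hP _ (hTP _)).1]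
        exact List.head_mem _
      · rw [ends_eq (hP _ hl).1]
        exact List.head_mem _
    have hin : γ ∈ (W ⟨p, hp⟩).1.support := by rw [hW, hTl]; exact hγ
    refine ⟨⟨p, hp⟩, hin, fun q hq => ?_⟩
    by_contra hne
    exact hdisj _ _ hne γ ⟨hq, hin⟩

end Hypercube

theorem mainTheorem5 (A : Finset (Sym2 (Hypercube.V 5))) (hne : A.Nonempty)
    (hA : Hypercube.IsDiminishable A) : Hypercube.IsConnectable A := by
  obtain ⟨hodd, hcase⟩ := hA
  have hvalid := Hypercube.valid_codeList hodd
  refine ⟨hodd.1, Hypercube.connector_of_linked ?_⟩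
  rcases hcase with ⟨hcard, -⟩ | ⟨hcard, -, ⟨p, hp, q, hq, hpq, hp', hq'⟩, henc⟩
  · refine Hypercube.linked_of_length_le_four hvalid (fun h => ?_) ?_
    · have := hne.card_pos
      rw [← Hypercube.length_codeList, h] at this
      simp at this
    · rw [Hypercube.length_codeList]
      omega
  · exact Hypercube.linked_of_two_edges hvalid (Hypercube.noEnc_codeList henc)
      (by rw [Hypercube.length_codeList, hcard])
      (Hypercube.two_le_countP_codeList hp hq hpq hp' hq')
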